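/- **Setting.** Let $F(\mathbf x)=\mathrm E_{\xi}[f(\mathbf x;\xi)]$, $\mathbf x\in\mathbb R^d$, $d\ge 1$, where for every $\xi$ the function $f(\cdot;\xi)$ is twice differentiable with $L_1$-Lipschitz gradient and $L_2$-Lipschitz Hessian (spectral norm). Let $\mathbf x_1$ satisfy $F(\mathbf x_1)-\inf F\le\Delta$, and assume that for all $\mathbf x$: $\mathrm E[\exp(\|\nabla f(\mathbf x;\xi)-\nabla F(\mathbf x)\|^2/G^2)]\le e$ and $\mathrm E\|\nabla f(\mathbf x;\xi)-\nabla F(\mathbf x)\|^2\le V$. For a set $S$ of i.i.d. samples let $F_S$ be the average of $f(\cdot;\xi)$ over $S$. One IFO call returns $(f(\mathbf x;\xi),\nabla f(\mathbf x;\xi))$ at one pair $(\mathbf x,\xi)$. An $(\epsilon,\gamma)$-second-order stationary point is a $\mathbf y$ with $\|\nabla F(\mathbf y)\|\le\epsilon$ and $\lambda_{\min}(\nabla^2F(\mathbf y))\ge-\gamma$. **Negative-curvature procedures.** For a function $g$ and a point $\mathbf x$ put $\hat g(\mathbf u)=g(\mathbf x+\mathbf u)-g(\mathbf x)-\nabla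 g(\mathbf x)^\top\mathbf u$. Parameters: $t,\eta,\mathcal F,U,r$ and, for NEON$^+$, $\zeta\in(0,1)$. * NEON: draw $\mathbf u_0$ uniformly from the ball of radius $r$, put $\mathbf u_{\tau+1}=\mathbf u_\tau-\eta\nabla\hat g(\mathbf u_\tau)$ for $\tau=0,\dots,t$; return a minimizer of $\hat g$ over the $\mathbf u_\tau$ with $\|\mathbf u_\tau\|\le U$ if the minimum is at most $-2.5\mathcal F$, and $0$ otherwise. * NEON$^+$ (with curvature tolerance $\gamma'$): draw $\mathbf y_0=\mathbf u_0$ uniformly from the ball of radius $r$; for $\tau=0,\dots,t$: if $\hat g(\mathbf y_\tau)-\hat g(\mathbf u_\tau)-\nabla\hat g(\mathbf u_\tau)^\top(\mathbf y_\tau-\mathbf u_\tau)<-\frac{\gamma'}2\|\mathbf y_\tau-\mathbf u_\tau\|^2$, stop and return the first $\mathbf y_j$, $j\le\tau$, with $\|\mathbf y_j-\mathbf u_j\|\ge\zeta\sqrt{6\eta\mathcal F}$ if there is one and $\mathbf y_\tau-\mathbf u_\tau$ otherwise; else $\mathbf y_{\tau+1}=\mathbf u_\tau-\eta\nabla\hat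 g(\mathbf u_\tau)$, $\mathbf u_{\tau+1}=\mathbf y_{\tau+1}+\zeta(\mathbf y_{\tau+1}-\mathbf y_\tau)$. At the end return a minimizer of $\hat g$ over the $\mathbf y_\tau$ with $\|\mathbf y_\tau\|\le U$ if the minimum is at most $-2\mathcal F$, and $0$ otherwise. **NEON-MSGD with tolerances $(\epsilon',\gamma')$.** For $j=1,2,\dots$, with fresh independent samples $S_1,S,S_2$: (a) $\mathbf y_j=\mathbf x_j$, $\mathbf z_j=\mathbf x_j-L_1^{-1}\nabla F_{S_1}(\mathbf x_j)$; (b) if $\|\nabla F_S(\mathbf y_j)\|>\epsilon'$, put $\mathbf x_{j+1}=\mathbf z_j$; (c) otherwise apply NEON (or NEON$^+$) to $F_{S_2}$ at $\mathbf y_j$; if the result $\mathbf u_j$ is $0$, return $\mathbf y_j$; else $\mathbf x_{j+1}=\mathbf y_j-\frac{c\gamma'\bar\xi}{L_2}\frac{\mathbf u_j}{\|\mathbf u_j\|}$ with an independent fair sign $\bar\xi=\pm1$, where $c\in(0,1]$ is a parameter. Let $\widetilde O(X)$ stand for a bound $C\,(1+\log\frac{d}{\epsilon\gamma\delta})^K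 X$, with an absolute constant $K$ and with $C$ depending only on $L_1,L_2,G,V,\Delta$ (and on which of the two procedures is used). **Corollary.** Let $\epsilon,\gamma,\delta\in(0,1)$ be arbitrary; no lower bound on $\gamma$ in terms of $\epsilon$ is required. There are parameters of NEON-MSGD (batch sizes, $c$, and the parameters of NEON or NEON$^+$), depending only on $d,\epsilon,\gamma,\delta,L_1,L_2,G,V,\Delta$ and the choice of procedure, with $|S_1|=\widetilde O(\epsilon^{-2})$, such that for every $f$, law of $\xi$ and $\mathbf x_1$ as above, with tolerances $(\epsilon',\gamma')=(\epsilon/2,\gamma/2)$: 1. the IFO complexity of step (a) is $T_a=\widetilde O(\epsilon^{-2})$; 2. for all $e\ge\epsilon/2$, if $\|\nabla F(\mathbf x)\|\ge e$ then $\mathrm E_{S_1}[F(\mathbf x-L_1^{-1}\nabla F_{S_1}(\mathbf x))-F(\mathbf x)]\le-\frac{e^2}{4L_1}$ (so, with $e=\epsilon$, the decrease $\varepsilon(\epsilon,\alpha)=\frac{\epsilon^2}{4L_1}$), while always $\mathrm E[F(\mathbf y_j)-F(\mathbf x_j)]\le0$; 3. the IFO complexity of step (c) is at most $T_n$, where $T_n=\widetilde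 O(\gamma^{-3})$ for NEON and $T_n=\widetilde O(\gamma^{-5/2})$ for NEON$^+$; 4. with probability at least $1-\delta$, NEON-MSGD terminates and returns an $(\epsilon,\gamma)$-second-order stationary point, with a total IFO complexity of $$\widetilde O\Big(R\,\max\big(\tfrac1{\epsilon^2},\tfrac1{\gamma^3}\big)\big(T_n+\tfrac1{\epsilon^2}\big)\Big),\qquad R=1+\min\big(\tfrac1\delta,\tfrac{\epsilon^2}{\gamma}\big).$$ In particular $R\le2$ whenever $\gamma\ge\epsilon^2$, and $R$ is bounded by the constant $1+1/\delta$ for every fixed confidence level $1-\delta$, whatever $\epsilon$ and $\gamma$ are. -/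

import Mathlib

open MeasureTheory ProbabilityTheory
open scoped RealInnerProductSpace

universe u

noncomputable section

/-- The Euclidean space `ℝᵈ`. -/
abbrev Vec (d : ℕ) : Type := EuclideanSpace ℝ (Fin d)

/-! ### The stochastic optimization problem -/

/-- The objective `F(x) = E_ξ[f(x; ξ)]`. -/
def objective {d : ℕ} {Ξ : Type u} [MeasurableSpace Ξ] (μ : Measure Ξ) (f : Vec d → Ξ → ℝ) :
    Vec d → ℝ :=
  fun x => ∫ ξ, f x ξ ∂μ

/-- The gradient `∇f(x; ξ)` in the variable `x`. -/
def sampleGrad {d : ℕ} {Ξ : Type u} (f : Vec d → Ξ → ℝ) (x : Vec d) (ξ : Ξ) : Vec d :=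
  gradient (fun y => f y ξ) x

/-- The Hessian of a function at a point, as the derivative of the gradient map. -/
def hess {d : ℕ} (g : Vec d → ℝ) (x : Vec d) : Vec d →L[ℝ] Vec d :=
  fderiv ℝ (gradient g) x

/-- The standing assumptions on the random function `f(·; ξ)`, `ξ ∼ μ`, and the initial point. -/
structure StandingAssumptions {d : ℕ} {Ξ : Type u} [MeasurableSpace Ξ] (μ : Measure Ξ)
    (f : Vec d → Ξ → ℝ) (x₁ : Vec d) (L₁ L₂ G V Δ : ℝ) : Prop where
  measurable : ∀ x, Measurable (f x)
  integrable : ∀ x, Integrable (f x) μ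
  differentiable : ∀ ξ, Differentiable ℝ (fun x => f x ξ)
  twice_differentiable : ∀ ξ, Differentiable ℝ (gradient (fun x => f x ξ))
  lipschitz_gradient : ∀ ξ x y, ‖sampleGrad f x ξ - sampleGrad f y ξ‖ ≤ L₁ * ‖x - y‖
  lipschitz_hessian : ∀ ξ x y,
    ‖hess (fun z => f z ξ) x - hess (fun z => f z ξ) y‖ ≤ L₂ * ‖x - y‖
  bounded_gap : ∀ x, objective μ f x₁ - objective μ f x ≤ Δ
  sub_gaussian : ∀ x,
    ∫⁻ ξ, ENNReal.ofReal
      (Real.exp (‖sampleGrad f x ξ - gradient (objective μ f) x‖ ^ 2 / G ^ 2)) ∂μ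
      ≤ ENNReal.ofReal (Real.exp 1)
  bounded_variance : ∀ x,
    ∫⁻ ξ, ENNReal.ofReal (‖sampleGrad f x ξ - gradient (objective μ f) x‖ ^ 2) ∂μ
      ≤ ENNReal.ofReal V

/-- `(ε, γ)`-second-order stationarity: `‖∇F(x)‖ ≤ ε` and `λ_min(∇²F(x)) ≥ -γ`. -/
def IsSecondOrderStationary {d : ℕ} (F : Vec d → ℝ) (ε γ : ℝ) (x : Vec d) : Prop :=
  ‖gradient F x‖ ≤ ε ∧ ∀ v : Vec d, -γ * ‖v‖ ^ 2 ≤ ⟪v, hess F x v⟫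

/-! ### Programs with an incremental first-order oracle -/

/-- A program that may ask the incremental first-order oracle (IFO) at pairs `(x, ξ)`; the answer
is the pair `(f(x; ξ), ∇f(x; ξ))`. -/
inductive IFOProg (E : Type) (Ξ : Type u) (α : Type) : Type u
  | done (a : α) : IFOProg E Ξ α
  | query (x : E) (ξ : Ξ) (next : ℝ × E → IFOProg E Ξ α) : IFOProg E Ξ α

namespace IFOProg

/-- Sequential composition of programs. -/
def bind {E : Type} {Ξ : Type u} {α β : Type} :
    IFOProg E Ξ α → (α → IFOProg E Ξ β) → IFOProg E Ξ β
  | done a, k => k a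
  | query x ξ next, k => query x ξ (fun r => bind (next r) k)

instance {E : Type} {Ξ : Type u} : Monad (IFOProg E Ξ) where
  pure := done
  bind := bind

/-- Execution of a program on the random function `f`: its result, and the number of IFO calls. -/
def run {d : ℕ} {Ξ : Type u} {α : Type} (f : Vec d → Ξ → ℝ) : IFOProg (Vec d) Ξ α → α × ℕ
  | done a => (a, 0)
  | query x ξ next =>
      let r := run f (next (f x ξ, sampleGrad f x ξ))
      (r.1, r.2 + 1)

/-- The result of a program. -/
def result {d : ℕ} {Ξ : Type u} {α : Type} (f : Vec d → Ξ → ℝ) (P : IFOProg (Vec d) Ξ α) : α :=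
  (P.run f).1

/-- The IFO complexity (number of oracle calls) of a program. -/
def cost {d : ℕ} {Ξ : Type u} {α : Type} (f : Vec d → Ξ → ℝ) (P : IFOProg (Vec d) Ξ α) : ℕ :=
  (P.run f).2

end IFOProg

/-- The sum of the oracle answers at `x` over a list of samples. -/
def batchSum {d : ℕ} {Ξ : Type u} (x : Vec d) : List Ξ → IFOProg (Vec d) Ξ (ℝ × Vec d)
  | [] => pure (0, 0)
  | ξ :: l => IFOProg.query x ξ fun a => do
      let b ← batchSum x l
      pure (a + b)

/-- Evaluation of `(F_S(x), ∇F_S(x))` for the mini-batch average `F_S = m⁻¹ ∑ᵢ f(·; ξᵢ)`. -/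
def evalBatch {d : ℕ} {Ξ : Type u} {m : ℕ} (S : Fin m → Ξ) (x : Vec d) :
    IFOProg (Vec d) Ξ (ℝ × Vec d) := do
  let s ← batchSum x (List.ofFn S)
  pure ((m : ℝ)⁻¹ • s)

/-! ### The negative-curvature procedures NEON and NEON⁺ -/

/-- The two procedures for extracting negative curvature: based on gradient descent (NEON), and
based on Nesterov's accelerated gradient method (NEON⁺). -/
inductive NeonVariant
  | neon
  | neonPlus

/-- The tuning parameters of NEON and NEON⁺ (`ζ` is used by NEON⁺ only). -/
structure NeonParams where
  /-- the number of iterations -/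
  t : ℕ
  /-- the step size -/
  η : ℝ
  /-- the threshold for the decrease -/
  Fthr : ℝ
  /-- the bound on the norm of the candidates -/
  U : ℝ
  /-- the radius of the noise -/
  r : ℝ
  /-- the momentum -/
  ζ : ℝ

/-- Evaluation of `f̂_x(u) = f(x + u) - f(x) - ∇f(x)ᵀu` and of `∇f̂_x(u) = ∇f(x + u) - ∇f(x)` for
`f = F_S`, where `base = (F_S(x), ∇F_S(x))` is already known. -/
def evalHat {d : ℕ} {Ξ : Type u} {m : ℕ} (S : Fin m → Ξ) (x : Vec d) (base : ℝ × Vec d)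
    (u : Vec d) : IFOProg (Vec d) Ξ (ℝ × Vec d) := do
  let a ← evalBatch S (x + u)
  pure (a.1 - base.1 - ⟪base.2, u⟫, a.2 - base.2)

open Classical in
/-- Among the candidates `(u, f̂(u))` with `‖u‖ ≤ U`, one with the smallest value of `f̂` if that
value is at most `-θ`; the zero vector if there is none. -/
def selectNC {d : ℕ} (U θ : ℝ) (l : List (Vec d × ℝ)) : Vec d :=
  match List.argmin (fun p : Vec d × ℝ => p.2) (l.filter fun p => decide (‖p.1‖ ≤ U)) with
  | some p => if p.2 ≤ -θ then p.1 else 0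
  | none => 0

/-- `k` gradient steps on `f̂_x`, started at `u`; returns the `k + 1` visited points with their
values of `f̂_x`. -/
def neonLoop {d : ℕ} {Ξ : Type u} {m : ℕ} (S : Fin m → Ξ) (x : Vec d) (base : ℝ × Vec d) (η : ℝ) :
    ℕ → Vec d → IFOProg (Vec d) Ξ (List (Vec d × ℝ))
  | 0, u => do
      let a ← evalHat S x base u
      pure [(u, a.1)]
  | k + 1, u => do
      let a ← evalHat S x base u
      let l ← neonLoop S x base η k (u - η • a.2)
      pure ((u, a.1) :: l)

/-- NEON applied to `F_S` at `x`, started at the noise vector `u₀`. -/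
def neonGD {d : ℕ} {Ξ : Type u} {m : ℕ} (q : NeonParams) (S : Fin m → Ξ) (x u₀ : Vec d) :
    IFOProg (Vec d) Ξ (Vec d) := do
  let base ← evalBatch S x
  let l ← neonLoop S x base q.η (q.t + 1) u₀
  pure (selectNC q.U (5 / 2 * q.Fthr) l)

open Classical in
/-- NCFind: `hist` is the history `(y_j, u_j)_{j ≤ τ}` in chronological order, and `y`, `u` are
the current `y_τ`, `u_τ`. -/
def ncFind {d : ℕ} (q : NeonParams) (hist : List (Vec d × Vec d)) (y u : Vec d) : Vec d :=
  match hist.find? fun e => decide (q.ζ * √(6 * q.η * q.Fthr) ≤ ‖e.1 - e.2‖) with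
  | some e => e.1
  | none => y - u

open Classical in
/-- The loop of NEON⁺ with `k` iterations left, at the current pair `(y, u)`; `hist` is the list of
the earlier `((y_j, u_j), f̂_x(y_j))`. -/
def neonPlusLoop {d : ℕ} {Ξ : Type u} {m : ℕ} (q : NeonParams) (γ : ℝ) (S : Fin m → Ξ) (x : Vec d)
    (base : ℝ × Vec d) :
    ℕ → List ((Vec d × Vec d) × ℝ) → Vec d → Vec d → IFOProg (Vec d) Ξ (Vec d)
  | 0, hist, y, _ => do
      let b ← evalHat S x base y
      pure (selectNC q.U (2 * q.Fthr) (hist.map (fun e => (e.1.1, e.2)) ++ [(y, b.1)]))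
  | k + 1, hist, y, u => do
      let b ← evalHat S x base y
      let a ← evalHat S x base u
      if b.1 - a.1 - ⟪a.2, y - u⟫ < -(γ / 2) * ‖y - u‖ ^ 2 then
        pure (ncFind q (hist.map Prod.fst ++ [(y, u)]) y u)
      else
        let y' := u - q.η • a.2
        neonPlusLoop q γ S x base k (hist ++ [((y, u), b.1)]) y' (y' + q.ζ • (y' - y))

/-- NEON⁺ applied to `F_S` at `x`, started at the noise vector `u₀`. -/
def neonAGD {d : ℕ} {Ξ : Type u} {m : ℕ} (q : NeonParams) (γ : ℝ) (S : Fin m → Ξ) (x u₀ : Vec d) :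
    IFOProg (Vec d) Ξ (Vec d) := do
  let base ← evalBatch S x
  neonPlusLoop q γ S x base (q.t + 1) [] u₀ u₀

/-- The chosen negative-curvature procedure. -/
def neonProc (v : NeonVariant) {d : ℕ} {Ξ : Type u} {m : ℕ} (q : NeonParams) (γ : ℝ)
    (S : Fin m → Ξ) (x u₀ : Vec d) : IFOProg (Vec d) Ξ (Vec d) :=
  match v with
  | .neon => neonGD q S x u₀
  | .neonPlus => neonAGD q γ S x u₀

/-! ### NEON-MSGD -/

/-- The parameters of NEON-MSGD: the sizes of the three mini-batches used in an iteration (for the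
SGD step, for checking the first-order condition, for the negative-curvature procedure), the
constant `c` in the escaping step, and the parameters of the negative-curvature procedure. -/
structure MSGDParams where
  m₁ : ℕ
  mc : ℕ
  m₂ : ℕ
  c : ℝ
  nc : NeonParams

/-- The ranges of the parameters. -/
structure MSGDParams.Admissible (p : MSGDParams) (L₁ : ℝ) : Prop where
  m₁_pos : 0 < p.m₁
  mc_pos : 0 < p.mc
  m₂_pos : 0 < p.m₂
  c_pos : 0 < p.c
  c_le : p.c ≤ 1
  η_pos : 0 < p.nc.η
  η_le : p.nc.η * L₁ ≤ 1
  Fthr_pos : 0 < p.nc.Fthr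
  U_pos : 0 < p.nc.U
  r_pos : 0 < p.nc.r
  ζ_pos : 0 < p.nc.ζ
  ζ_lt : p.nc.ζ < 1

/-- The randomness of one iteration: the three mini-batches, the noise direction in the unit ball,
and the fair sign. -/
abbrev Seed (d : ℕ) (Ξ : Type u) (p : MSGDParams) : Type u :=
  (Fin p.m₁ → Ξ) × (Fin p.mc → Ξ) × (Fin p.m₂ → Ξ) × Vec d × Bool

/-- The MSGD step `(y, z) = (x, x - L₁⁻¹ ∇F_{S₁}(x))`. -/
def msgd {d : ℕ} {Ξ : Type u} {m : ℕ} (L₁ : ℝ) (S₁ : Fin m → Ξ) (x : Vec d) :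
    IFOProg (Vec d) Ξ (Vec d × Vec d) := do
  let g ← evalBatch S₁ x
  pure (x, x - L₁⁻¹ • g.2)

open Classical in
/-- The negative-curvature step at `y`: call NEON (or NEON⁺) on `F_{S₂}` at `y`, started at the
noise vector `r e`; return `y` (`Sum.inr y`) if it gives `0`, and otherwise continue
(`Sum.inl`) from `y - (c γ ξ̄ / L₂) u / ‖u‖`, where `ξ̄ = ±1`. -/
def ncStep (v : NeonVariant) {d : ℕ} {Ξ : Type u} (p : MSGDParams) (L₂ γ : ℝ) (S₂ : Fin p.m₂ → Ξ)
    (e : Vec d) (sgn : Bool) (y : Vec d) : IFOProg (Vec d) Ξ (Vec d ⊕ Vec d) := do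
  let w ← neonProc v p.nc γ S₂ y (p.nc.r • e)
  if w = 0 then pure (Sum.inr y)
  else pure (Sum.inl
    (y - (p.c * γ * (if sgn then (1 : ℝ) else -1) / L₂) • (‖w‖⁻¹ • w)))

open Classical in
/-- One iteration of NEON-MSGD with tolerances `ε`, `γ`, from the point `x`. -/
def neonMSGDIter (v : NeonVariant) {d : ℕ} {Ξ : Type u} (p : MSGDParams) (L₁ L₂ ε γ : ℝ)
    (s : Seed d Ξ p) (x : Vec d) : IFOProg (Vec d) Ξ (Vec d ⊕ Vec d) := do
  let yz ← msgd L₁ s.1 x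
  let g ← evalBatch s.2.1 yz.1
  if ‖g.2‖ ≤ ε then ncStep v p L₂ γ s.2.2.1 s.2.2.2.1 s.2.2.2.2 yz.1
  else pure (Sum.inl yz.2)

/-- The first `n` iterations of NEON-MSGD from `x₁`: `Sum.inl x` if the algorithm is still running,
at the point `x`, and `Sum.inr y` if it has returned `y` (and then nothing more is executed). -/
def neonMSGD (v : NeonVariant) {d : ℕ} {Ξ : Type u} (p : MSGDParams) (L₁ L₂ ε γ : ℝ) (x₁ : Vec d)
    (ω : ℕ → Seed d Ξ p) : ℕ → IFOProg (Vec d) Ξ (Vec d ⊕ Vec d)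
  | 0 => pure (Sum.inl x₁)
  | n + 1 => do
      let s ← neonMSGD v p L₁ L₂ ε γ x₁ ω n
      match s with
      | Sum.inl x => neonMSGDIter v p L₁ L₂ ε γ (ω n) x
      | Sum.inr y => pure (Sum.inr y)

/-! ### The law of the randomness -/

/-- The uniform distribution on the closed unit ball of `ℝᵈ`. -/
def unitBallLaw (d : ℕ) : Measure (Vec d) :=
  ProbabilityTheory.cond volume (Metric.closedBall (0 : Vec d) 1)

instance (d : ℕ) : IsProbabilityMeasure (unitBallLaw d) :=
  cond_isProbabilityMeasure_of_finite
    (Metric.measure_closedBall_pos volume (0 : Vec d) one_pos).ne'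
    measure_closedBall_lt_top.ne

/-- The fair coin. -/
def fairCoin : Measure Bool := (PMF.uniformOfFintype Bool).toMeasure

instance : IsProbabilityMeasure fairCoin := by unfold fairCoin; infer_instance

/-- The law of the randomness of one iteration: all samples are drawn from `μ`, and everything is
independent. -/
def seedLaw {Ξ : Type u} [MeasurableSpace Ξ] (μ : Measure Ξ) (d : ℕ) (p : MSGDParams) :
    Measure (Seed d Ξ p) :=
  (Measure.pi fun _ => μ).prod ((Measure.pi fun _ => μ).prod ((Measure.pi fun _ => μ).prod
    ((unitBallLaw d).prod fairCoin)))

instance {Ξ : Type u} [MeasurableSpace Ξ] (μ : Measure Ξ) [IsProbabilityMeasure μ] (d : ℕ)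
    (p : MSGDParams) : IsProbabilityMeasure (seedLaw μ d p) := by
  unfold seedLaw; infer_instance

/-- The law of the randomness of all iterations, which are independent. -/
def runLaw {Ξ : Type u} [MeasurableSpace Ξ] (μ : Measure Ξ) (d : ℕ) (p : MSGDParams) :
    Measure (ℕ → Seed d Ξ p) :=
  Measure.infinitePi fun _ => seedLaw μ d p

instance {Ξ : Type u} [MeasurableSpace Ξ] (μ : Measure Ξ) [IsProbabilityMeasure μ] (d : ℕ)
    (p : MSGDParams) : IsProbabilityMeasure (runLaw μ d p) := by
  unfold runLaw; infer_instance

/-! ### Rates -/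

/-- The factor `(1 + log(d / (ε γ δ)))ᴷ`, of which a constant multiple is hidden in `Õ`. -/
def polylog (K d : ℕ) (ε γ δ : ℝ) : ℝ := (1 + Real.log (d / (ε * γ * δ))) ^ K

/-- The rate of the negative-curvature procedure: `γ⁻³` for NEON and `γ^(-5/2)` for NEON⁺. -/
def neonRate : NeonVariant → ℝ → ℝ
  | .neon, γ => 1 / γ ^ 3
  | .neonPlus, γ => 1 / (γ ^ 2 * √γ)

end

/-! The objective, shifted to be nonnegative, serves as a potential along a Markov chain driven by
independent seeds. An iteration is good if, for both values of the fair sign, it returns a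
second-order stationary point, or else makes the potential descend (`IsGoodStep`, `PairDescent`). A
gradient step surely gains order ε². An escaping step of length σ = κ/(4L₂), along a direction of
curvature at most -κ, gains κ₃ = κσ²/4 on average over the sign and deviates from its average by at
most A = σε + κ₃. Here κ is γ up to a squared logarithm, so κ₃ is of order γ³ up to logarithms.

Two families of functions of potential and time decrease on average under good steps
(`measure_not_terminated_le`). With gain κm of order min(ε², γ³) per step, the linear one bounds the
probability of not having succeeded after N steps by Δ/(Nκm), the exponential one by exp(s(Δ - Nκm))
with s = κ₃/A². Each bound carries an additional N times the probability of a bad iteration. Since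
A²/κ₃ is at most a multiple of ε²/κ plus a constant, the better of the two choices of N produces the
factor 1 + min(1/δ, ε²/γ) (`exists_iterations`).

A bad iteration has probability at most Y⁻²⁰, where Y is a constant times d/(εγδ). Gradient averages
concentrate independently of the dimension, through the moment generating function of cosh of the
norm (`measure_norm_sum_ge_le`). Hessian averages concentrate by the moment method for traces
(`measure_quadraticForm_sum_ge_le`). Negative curvature is missed only if the noise falls into a
thin slab of the ball (`unitBallLaw_slab_le`).

NEON is the momentum-free case of the recursion behind NEON⁺, so one analysis covers both. Unless a
certificate of negative curvature shows up, an energy is dissipated, and an iterate that has moved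
far has a small function value (`ghat_agdSeq_le`). Noise along an eigenvector of negative curvature
grows geometrically and forces the iterates out of a small ball after about log Y/γ steps, or log
Y/√γ with momentum (`exists_norm_gt_gd`, `exists_norm_gt_agd`). All radii are high powers of 1/Y,
which makes the Taylor errors negligible. With batches of size about γ⁻² this gives the rates γ⁻³
and γ^(-5/2). -/

/-! ### Functions with Lipschitz gradient and Hessian -/

/-- A twice differentiable function with `L₁`-Lipschitz gradient and `L₂`-Lipschitz Hessian. -/
structure IsSmooth {d : ℕ} (g : Vec d → ℝ) (L₁ L₂ : ℝ) : Prop where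
  differentiable : Differentiable ℝ g
  differentiable_gradient : Differentiable ℝ (gradient g)
  lipschitz_gradient : ∀ x y, ‖gradient g x - gradient g y‖ ≤ L₁ * ‖x - y‖
  lipschitz_hessian : ∀ x y, ‖hess g x - hess g y‖ ≤ L₂ * ‖x - y‖

namespace IsSmooth

variable {d : ℕ} {g : Vec d → ℝ} {L₁ L₂ : ℝ}

theorem hasFDerivAt_gradient (hg : IsSmooth g L₁ L₂) (x : Vec d) :
    HasFDerivAt (gradient g) (hess g x) x :=
  (hg.differentiable_gradient x).hasFDerivAt

theorem continuous_gradient (hg : IsSmooth g L₁ L₂) : Continuous (gradient g) :=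
  hg.differentiable_gradient.continuous

theorem continuous_hess (hg : IsSmooth g L₁ L₂) : Continuous (hess g) := by
  have : LipschitzWith (Real.toNNReal L₂) (hess g) := by
    refine LipschitzWith.of_dist_le_mul fun x y => ?_
    rw [dist_eq_norm, dist_eq_norm]
    exact (hg.lipschitz_hessian x y).trans
      (mul_le_mul_of_nonneg_right (Real.le_coe_toNNReal L₂) (norm_nonneg _))
  exact this.continuous

theorem norm_hess_le (hg : IsSmooth g L₁ L₂) (hL : 0 ≤ L₁) (x : Vec d) : ‖hess g x‖ ≤ L₁ := by
  have : LipschitzWith (Real.toNNReal L₁) (gradient g) := by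
    refine LipschitzWith.of_dist_le_mul fun x y => ?_
    rw [dist_eq_norm, dist_eq_norm, Real.coe_toNNReal L₁ hL]
    exact hg.lipschitz_gradient x y
  simpa [Real.coe_toNNReal L₁ hL, hess] using norm_fderiv_le_of_lipschitz ℝ (x₀ := x) this

theorem hess_symm (hg : IsSmooth g L₁ L₂) (x v w : Vec d) :
    ⟪hess g x v, w⟫ = ⟪v, hess g x w⟫ := by
  have h1 : ∀ y, HasFDerivAt g (InnerProductSpace.toDual ℝ (Vec d) (gradient g y)) y := fun y =>
    hasGradientAt_iff_hasFDerivAt.1 (hg.differentiable y).hasGradientAt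
  have h2 : HasFDerivAt (fun y => InnerProductSpace.toDual ℝ (Vec d) (gradient g y))
      ((InnerProductSpace.toDual ℝ (Vec d)).toContinuousLinearEquiv.toContinuousLinearMap.comp
        (hess g x)) x :=
    ((InnerProductSpace.toDual ℝ (Vec d)).toContinuousLinearEquiv.toContinuousLinearMap.hasFDerivAt).comp
      x (hg.hasFDerivAt_gradient x)
  have h := second_derivative_symmetric h1 h2 v w
  have e : ∀ a b : Vec d, ⟪hess g x a, b⟫ = ⟪hess g x b, a⟫ → ⟪hess g x a, b⟫ = ⟪a, hess g x b⟫ :=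
    fun a b h => by rw [h, real_inner_comm]
  exact e v w (by simpa using h)

theorem hasDerivAt_line (hg : IsSmooth g L₁ L₂) (x v : Vec d) (t : ℝ) :
    HasDerivAt (fun s : ℝ => g (x + s • v)) ⟪gradient g (x + t • v), v⟫ t := by
  have h1 := hasGradientAt_iff_hasFDerivAt.1 (hg.differentiable (x + t • v)).hasGradientAt
  have h2 : HasDerivAt (fun s : ℝ => x + s • v) v t := by
    simpa using ((hasDerivAt_id t).smul_const v).const_add x
  exact h1.comp_hasDerivAt t h2

/-- The descent inequality. -/
theorem le_quadratic (hg : IsSmooth g L₁ L₂) (x v : Vec d) :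
    g (x + v) ≤ g x + ⟪gradient g x, v⟫ + L₁ / 2 * ‖v‖ ^ 2 := by
  let φ : ℝ → ℝ := fun s => g (x + s • v) - s * ⟪gradient g x, v⟫ - L₁ / 2 * ‖v‖ ^ 2 * s ^ 2
  have hd : ∀ t, HasDerivAt φ (⟪gradient g (x + t • v), v⟫ - ⟪gradient g x, v⟫
      - L₁ / 2 * ‖v‖ ^ 2 * (2 * t)) t := fun t => by
    have h1 := (hg.hasDerivAt_line x v t).sub ((hasDerivAt_id t).mul_const ⟪gradient g x, v⟫)
    rw [one_mul] at h1
    have h2 := h1.sub ((hasDerivAt_pow 2 t).const_mul (L₁ / 2 * ‖v‖ ^ 2))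
    exact h2.congr_deriv (by norm_num)
  have hanti : AntitoneOn φ (Set.Icc 0 1) := by
    refine antitoneOn_of_deriv_nonpos (convex_Icc 0 1)
      (fun t _ => (hd t).continuousAt.continuousWithinAt)
      (fun t _ => (hd t).differentiableAt.differentiableWithinAt) fun t ht => ?_
    rw [interior_Icc] at ht
    rw [(hd t).deriv, ← inner_sub_left]
    have h1 := real_inner_le_norm (gradient g (x + t • v) - gradient g x) v
    have h2 := hg.lipschitz_gradient (x + t • v) x
    rw [add_sub_cancel_left, norm_smul, Real.norm_of_nonneg ht.1.le] at h2
    nlinarith [norm_nonneg v]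
  have := hanti (Set.left_mem_Icc.2 zero_le_one) (Set.right_mem_Icc.2 zero_le_one) zero_le_one
  simp only [φ, one_smul, zero_smul, add_zero] at this
  linarith

/-- The mean value inequality on the ball of radius `‖v‖`. It loses a factor 2 against the sharp
constant; the cubic estimate below is similarly generous, as only the order of the errors matters.
-/
theorem gradient_sub_le (hg : IsSmooth g L₁ L₂) (hL : 0 ≤ L₂) (x v : Vec d) :
    ‖gradient g (x + v) - gradient g x - hess g x v‖ ≤ L₂ * ‖v‖ ^ 2 := by
  have h := (convex_closedBall x ‖v‖).norm_image_sub_le_of_norm_hasFDerivWithin_le'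
    (f := gradient g) (f' := hess g) (φ := hess g x) (C := L₂ * ‖v‖) (x := x) (y := x + v)
    (fun z _ => (hg.hasFDerivAt_gradient z).hasFDerivWithinAt)
    (fun z hz => (hg.lipschitz_hessian z x).trans
      (mul_le_mul_of_nonneg_left (by simpa [dist_eq_norm] using hz) hL))
    (by simp) (by simp)
  rw [add_sub_cancel_left] at h
  linarith [h, sq ‖v‖]

theorem abs_sub_quadratic_le (hg : IsSmooth g L₁ L₂) (hL : 0 ≤ L₂) (x v : Vec d) :
    |g (x + v) - g x - ⟪gradient g x, v⟫ - ⟪v, hess g x v⟫ / 2| ≤ L₂ * ‖v‖ ^ 3 := by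
  let φ : ℝ → ℝ := fun s => g (x + s • v) - s * ⟪gradient g x, v⟫ - ⟪v, hess g x v⟫ / 2 * s ^ 2
  have hd : ∀ t, HasDerivAt φ (⟪gradient g (x + t • v), v⟫ - ⟪gradient g x, v⟫
      - ⟪v, hess g x v⟫ / 2 * (2 * t)) t := fun t => by
    have h1 := (hg.hasDerivAt_line x v t).sub ((hasDerivAt_id t).mul_const ⟪gradient g x, v⟫)
    rw [one_mul] at h1
    have h2 := h1.sub ((hasDerivAt_pow 2 t).const_mul (⟪v, hess g x v⟫ / 2))
    exact h2.congr_deriv (by norm_num)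
  have hb : ∀ t ∈ Set.Icc (0 : ℝ) 1, ‖⟪gradient g (x + t • v), v⟫ - ⟪gradient g x, v⟫
      - ⟪v, hess g x v⟫ / 2 * (2 * t)‖ ≤ L₂ * ‖v‖ ^ 3 := fun t ht => by
    have e : ⟪gradient g (x + t • v), v⟫ - ⟪gradient g x, v⟫ - ⟪v, hess g x v⟫ / 2 * (2 * t)
        = ⟪gradient g (x + t • v) - gradient g x - hess g x (t • v), v⟫ := by
      rw [inner_sub_left, inner_sub_left, map_smul, inner_smul_left, real_inner_comm (hess g x v) v]
      simp; ring
    rw [e]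
    refine (norm_inner_le_norm _ _).trans ?_
    have h := hg.gradient_sub_le hL x (t • v)
    rw [norm_smul, Real.norm_of_nonneg ht.1] at h
    have h3 : (t * ‖v‖) ^ 2 ≤ ‖v‖ ^ 2 := by
      rw [mul_pow]
      exact mul_le_of_le_one_left (sq_nonneg _) (pow_le_one₀ ht.1 ht.2)
    calc _ ≤ (L₂ * ‖v‖ ^ 2) * ‖v‖ := by
          gcongr
          exact h.trans (mul_le_mul_of_nonneg_left h3 hL)
      _ = _ := by ring
  have := (convex_Icc (0 : ℝ) 1).norm_image_sub_le_of_norm_hasDerivWithin_le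
    (fun t _ => (hd t).hasDerivWithinAt) hb
    (Set.left_mem_Icc.2 zero_le_one) (Set.right_mem_Icc.2 zero_le_one)
  simp only [φ, one_smul, zero_smul, add_zero, sub_zero, norm_one, mul_one] at this
  rw [Real.norm_eq_abs] at this
  convert this using 2
  ring

end IsSmooth

/-! ### Mini-batch averages -/

/-- The mini-batch average `F_S = m⁻¹ ∑ᵢ f(·; ξᵢ)`. -/
noncomputable def batchMean {d : ℕ} {Ξ : Type u} {m : ℕ} (f : Vec d → Ξ → ℝ) (S : Fin m → Ξ) : Vec d → ℝ :=
  fun x => (m : ℝ)⁻¹ * ∑ i, f x (S i)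

/-- The mini-batch gradient `∇F_S = m⁻¹ ∑ᵢ ∇f(·; ξᵢ)`. -/
noncomputable def batchGrad {d : ℕ} {Ξ : Type u} {m : ℕ} (f : Vec d → Ξ → ℝ) (S : Fin m → Ξ) (x : Vec d) : Vec d :=
  (m : ℝ)⁻¹ • ∑ i, sampleGrad f x (S i)

section Batch

variable {d : ℕ} {Ξ : Type u} {f : Vec d → Ξ → ℝ} {L₁ L₂ : ℝ}

theorem hasGradientAt_sampleGrad (hf : ∀ ξ, IsSmooth (fun x => f x ξ) L₁ L₂) (x : Vec d) (ξ : Ξ) :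
    HasGradientAt (fun y => f y ξ) (sampleGrad f x ξ) x :=
  ((hf ξ).differentiable x).hasGradientAt

theorem hasGradientAt_batchMean (hf : ∀ ξ, IsSmooth (fun x => f x ξ) L₁ L₂) {m : ℕ}
    (S : Fin m → Ξ) (x : Vec d) : HasGradientAt (batchMean f S) (batchGrad f S x) x := by
  rw [hasGradientAt_iff_hasFDerivAt]
  have h := (HasFDerivAt.fun_sum (u := Finset.univ) fun i _ =>
    hasGradientAt_iff_hasFDerivAt.1 (hasGradientAt_sampleGrad hf x (S i))).const_mul ((m : ℝ)⁻¹)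
  exact h.congr_fderiv (by simp only [batchGrad, map_smul, map_sum])

theorem gradient_batchMean (hf : ∀ ξ, IsSmooth (fun x => f x ξ) L₁ L₂) {m : ℕ}
    (S : Fin m → Ξ) : gradient (batchMean f S) = batchGrad f S :=
  funext fun x => (hasGradientAt_batchMean hf S x).gradient

theorem hess_batchMean (hf : ∀ ξ, IsSmooth (fun x => f x ξ) L₁ L₂) {m : ℕ}
    (S : Fin m → Ξ) (x : Vec d) :
    HasFDerivAt (gradient (batchMean f S))
      ((m : ℝ)⁻¹ • ∑ i, hess (fun y => f y (S i)) x) x := by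
  rw [gradient_batchMean hf]
  exact (HasFDerivAt.fun_sum (u := Finset.univ) fun i _ =>
    (hf (S i)).hasFDerivAt_gradient x).const_smul ((m : ℝ)⁻¹)

theorem norm_mean_sub_le {E : Type*} [NormedAddCommGroup E] [NormedSpace ℝ E] {m : ℕ} (hm : 0 < m)
    {c : ℝ} (a b : Fin m → E) (h : ∀ i, ‖a i - b i‖ ≤ c) :
    ‖(m : ℝ)⁻¹ • ∑ i, a i - (m : ℝ)⁻¹ • ∑ i, b i‖ ≤ c := by
  have hm' : (0 : ℝ) < m := by exact_mod_cast hm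
  rw [← smul_sub, ← Finset.sum_sub_distrib, norm_smul, Real.norm_of_nonneg (by positivity)]
  have : ‖∑ i, (a i - b i)‖ ≤ m * c := by
    simpa using norm_sum_le_of_le Finset.univ fun i _ => h i
  calc (m : ℝ)⁻¹ * _ ≤ (m : ℝ)⁻¹ * (m * c) := by gcongr
    _ = c := by field_simp

theorem IsSmooth.batchMean (hf : ∀ ξ, IsSmooth (fun x => f x ξ) L₁ L₂) {m : ℕ} (hm : 0 < m)
    (S : Fin m → Ξ) : IsSmooth (batchMean f S) L₁ L₂ where
  differentiable x := (hasGradientAt_batchMean hf S x).differentiableAt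
  differentiable_gradient x := (hess_batchMean hf S x).differentiableAt
  lipschitz_gradient x y := by
    rw [gradient_batchMean hf]
    exact norm_mean_sub_le hm _ _ fun i => (hf (S i)).lipschitz_gradient x y
  lipschitz_hessian x y := by
    rw [hess, hess, (hess_batchMean hf S x).fderiv, (hess_batchMean hf S y).fderiv]
    exact norm_mean_sub_le hm _ _ fun i => (hf (S i)).lipschitz_hessian x y

end Batch

/-! ### Differentiation under the expectation -/

theorem tendsto_inv_nat_nhdsNE :
    Filter.Tendsto (fun n : ℕ => ((n : ℝ) + 1)⁻¹) Filter.atTop (nhdsWithin 0 {0}ᶜ) := by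
  refine tendsto_nhdsWithin_iff.2 ⟨by simpa using tendsto_one_div_add_atTop_nhds_zero_nat (𝕜 := ℝ),
    Filter.Eventually.of_forall fun n => ?_⟩
  have : (0 : ℝ) < ((n : ℝ) + 1)⁻¹ := by positivity
  exact this.ne'

/-- The derivative along a fixed direction depends measurably on a parameter. -/
theorem measurable_of_hasDerivAt_param {Ξ E : Type*} [MeasurableSpace Ξ] [NormedAddCommGroup E]
    [NormedSpace ℝ E] [MeasurableSpace E] [BorelSpace E] [SecondCountableTopology E]
    {F : ℝ → Ξ → E} {F' : Ξ → E}
    (hF : ∀ t, Measurable (F t)) (h : ∀ ξ, HasDerivAt (fun t => F t ξ) (F' ξ) 0) :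
    Measurable F' := by
  refine measurable_of_tendsto_metrizable (f := fun (n : ℕ) ξ =>
    ((n : ℝ) + 1)⁻¹⁻¹ • (F (0 + ((n : ℝ) + 1)⁻¹) ξ - F 0 ξ)) (fun n => ?_) ?_
  · exact ((hF _).sub (hF _)).const_smul (((n : ℝ) + 1)⁻¹⁻¹)
  · exact tendsto_pi_nhds.2 fun ξ => (h ξ).tendsto_slope_zero.comp tendsto_inv_nat_nhdsNE

theorem eq_sum_inner_basis {d : ℕ} (v : Vec d) :
    v = ∑ i, ⟪EuclideanSpace.basisFun (Fin d) ℝ i, v⟫ • EuclideanSpace.basisFun (Fin d) ℝ i :=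
  ((EuclideanSpace.basisFun (Fin d) ℝ).sum_repr' v).symm

theorem measurable_vec_of_inner {d : ℕ} {Ξ : Type*} [MeasurableSpace Ξ] {F : Ξ → Vec d}
    (h : ∀ v, Measurable fun ξ => ⟪v, F ξ⟫) : Measurable F := by
  have : F = fun ξ => ∑ i, ⟪EuclideanSpace.basisFun (Fin d) ℝ i, F ξ⟫ •
      EuclideanSpace.basisFun (Fin d) ℝ i := funext fun ξ => eq_sum_inner_basis (F ξ)
  rw [this]
  exact Finset.measurable_sum _ fun i _ => (h _).smul_const _

/-- In finite dimension an operator is a finite sum of continuous images of its columns. Strong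
measurability is what the Bochner integral of the Hessian needs. -/
theorem stronglyMeasurable_clm_of_apply {d : ℕ} {Ξ : Type*} [MeasurableSpace Ξ]
    {F : Ξ → Vec d →L[ℝ] Vec d} (h : ∀ v, Measurable fun ξ => F ξ v) : StronglyMeasurable F := by
  let b := EuclideanSpace.basisFun (Fin d) ℝ
  have : F = fun ξ => ∑ i, ContinuousLinearMap.smulRightL ℝ (Vec d) (Vec d) (innerSL ℝ (b i))
      (F ξ (b i)) := by
    funext ξ
    ext1 v
    conv_lhs => rw [eq_sum_inner_basis v]
    simp [b]
  rw [this]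
  refine Finset.stronglyMeasurable_fun_sum _ fun i _ => ?_
  exact (ContinuousLinearMap.continuous _).comp_stronglyMeasurable (h (b i)).stronglyMeasurable

namespace StandingAssumptions

variable {d : ℕ} {Ξ : Type u} [MeasurableSpace Ξ] {μ : Measure Ξ}
  {f : Vec d → Ξ → ℝ} {x₁ : Vec d} {L₁ L₂ G V Δ : ℝ}

theorem isSmooth (h : StandingAssumptions μ f x₁ L₁ L₂ G V Δ) (ξ : Ξ) :
    IsSmooth (fun x => f x ξ) L₁ L₂ :=
  ⟨h.differentiable ξ, h.twice_differentiable ξ, h.lipschitz_gradient ξ, h.lipschitz_hessian ξ⟩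

theorem measurable_sampleGrad (h : StandingAssumptions μ f x₁ L₁ L₂ G V Δ) (x : Vec d) :
    Measurable (sampleGrad f x) := by
  refine measurable_vec_of_inner fun v => ?_
  refine measurable_of_hasDerivAt_param (F := fun t ξ => f (x + t • v) ξ)
    (fun t => h.measurable _) fun ξ => ?_
  have := (h.isSmooth ξ).hasDerivAt_line x v 0
  rwa [zero_smul, add_zero, real_inner_comm] at this

theorem measurable_hess_apply (h : StandingAssumptions μ f x₁ L₁ L₂ G V Δ) (x v : Vec d) :
    Measurable fun ξ => hess (fun y => f y ξ) x v := by
  refine measurable_of_hasDerivAt_param (F := fun t ξ => sampleGrad f (x + t • v) ξ)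
    (fun t => h.measurable_sampleGrad _) fun ξ => ?_
  have h2 : HasDerivAt (fun s : ℝ => x + s • v) v 0 := by
    simpa using ((hasDerivAt_id (0 : ℝ)).smul_const v).const_add x
  have h1 := (h.isSmooth ξ).hasFDerivAt_gradient (x + (0 : ℝ) • v)
  have := h1.comp_hasDerivAt (0 : ℝ) h2
  rw [zero_smul, add_zero] at this
  exact this

theorem stronglyMeasurable_hess (h : StandingAssumptions μ f x₁ L₁ L₂ G V Δ) (x : Vec d) :
    StronglyMeasurable fun ξ => hess (fun y => f y ξ) x :=
  stronglyMeasurable_clm_of_apply (h.measurable_hess_apply x)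

variable [IsProbabilityMeasure μ]

/-- The gradient of the objective enters only as a fixed vector at finite mean-square distance, so
there is no circularity: differentiability of the objective is deduced from this afterwards. -/
theorem integrable_sampleGrad (h : StandingAssumptions μ f x₁ L₁ L₂ G V Δ) (x : Vec d) :
    Integrable (sampleGrad f x) μ := by
  have hm := h.measurable_sampleGrad x
  have h1 : Integrable (fun ξ => ‖sampleGrad f x ξ - gradient (objective μ f) x‖ ^ 2) μ := by
    refine ⟨by fun_prop, ?_⟩
    rw [hasFiniteIntegral_iff_ofReal (Filter.Eventually.of_forall fun ξ => by positivity)]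
    exact (h.bounded_variance x).trans_lt ENNReal.ofReal_lt_top
  have h2 : Integrable (fun ξ => 1 + ‖gradient (objective μ f) x‖
      + ‖sampleGrad f x ξ - gradient (objective μ f) x‖ ^ 2) μ :=
    (integrable_const _).add h1
  refine h2.mono' hm.aestronglyMeasurable (Filter.Eventually.of_forall fun ξ => ?_)
  have := norm_add_le (sampleGrad f x ξ - gradient (objective μ f) x) (gradient (objective μ f) x)
  rw [sub_add_cancel] at this
  nlinarith [sq_nonneg (‖sampleGrad f x ξ - gradient (objective μ f) x‖ - 1)]

theorem hasGradientAt_objective (h : StandingAssumptions μ f x₁ L₁ L₂ G V Δ) (hL : 0 ≤ L₁)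
    (x : Vec d) : HasGradientAt (objective μ f) (∫ ξ, sampleGrad f x ξ ∂μ) x := by
  let D := (InnerProductSpace.toDual ℝ (Vec d)).toContinuousLinearEquiv.toContinuousLinearMap
  have hx := h.integrable_sampleGrad x
  have key := hasFDerivAt_integral_of_dominated_of_fderiv_le (𝕜 := ℝ) (μ := μ) (F := f) (x₀ := x)
    (F' := fun y ξ => D (sampleGrad f y ξ)) (bound := fun ξ => ‖sampleGrad f x ξ‖ + L₁ * 1)
    (Metric.closedBall_mem_nhds x one_pos)
    (Filter.Eventually.of_forall fun y => (h.measurable y).aestronglyMeasurable) (h.integrable x)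
    (D.integrable_comp hx).aestronglyMeasurable
    (Filter.Eventually.of_forall fun ξ y hy => by
      have e : ‖D (sampleGrad f y ξ)‖ = ‖sampleGrad f y ξ‖ :=
        (InnerProductSpace.toDual ℝ (Vec d)).norm_map _
      rw [e]
      have h1 := norm_add_le (sampleGrad f x ξ) (sampleGrad f y ξ - sampleGrad f x ξ)
      rw [add_sub_cancel] at h1
      have h2 := h.lipschitz_gradient ξ y x
      have h3 : ‖y - x‖ ≤ 1 := by simpa [dist_eq_norm] using hy
      exact h1.trans (by gcongr; exact h2.trans (by gcongr)))
    (hx.norm.add (integrable_const _))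
    (Filter.Eventually.of_forall fun ξ y _ =>
      hasGradientAt_iff_hasFDerivAt.1 (hasGradientAt_sampleGrad h.isSmooth y ξ))
  rw [hasGradientAt_iff_hasFDerivAt]
  exact key.congr_fderiv (D.integral_comp_comm hx)

theorem gradient_objective (h : StandingAssumptions μ f x₁ L₁ L₂ G V Δ) (hL : 0 ≤ L₁) :
    gradient (objective μ f) = fun x => ∫ ξ, sampleGrad f x ξ ∂μ :=
  gradient_eq (h.hasGradientAt_objective hL)

theorem integrable_hess (h : StandingAssumptions μ f x₁ L₁ L₂ G V Δ) (hL : 0 ≤ L₁) (x : Vec d) :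
    Integrable (fun ξ => hess (fun y => f y ξ) x) μ :=
  (integrable_const L₁).mono' (h.stronglyMeasurable_hess x).aestronglyMeasurable
    (Filter.Eventually.of_forall fun ξ => (h.isSmooth ξ).norm_hess_le hL x)

theorem hasFDerivAt_gradient_objective (h : StandingAssumptions μ f x₁ L₁ L₂ G V Δ) (hL : 0 ≤ L₁)
    (x : Vec d) : HasFDerivAt (gradient (objective μ f)) (∫ ξ, hess (fun y => f y ξ) x ∂μ) x := by
  rw [h.gradient_objective hL]
  exact hasFDerivAt_integral_of_dominated_of_fderiv_le (𝕜 := ℝ) (μ := μ) (F := sampleGrad f)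
    (x₀ := x) (F' := fun y ξ => hess (fun y => f y ξ) y) (bound := fun _ => L₁) Filter.univ_mem
    (Filter.Eventually.of_forall fun y => (h.measurable_sampleGrad y).aestronglyMeasurable)
    (h.integrable_sampleGrad x) (h.integrable_hess hL x).aestronglyMeasurable
    (Filter.Eventually.of_forall fun ξ y _ => (h.isSmooth ξ).norm_hess_le hL y)
    (integrable_const _)
    (Filter.Eventually.of_forall fun ξ y _ => (h.isSmooth ξ).hasFDerivAt_gradient y)

theorem hess_objective (h : StandingAssumptions μ f x₁ L₁ L₂ G V Δ) (hL : 0 ≤ L₁) (x : Vec d) :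
    hess (objective μ f) x = ∫ ξ, hess (fun y => f y ξ) x ∂μ :=
  (h.hasFDerivAt_gradient_objective hL x).fderiv

theorem isSmooth_objective (h : StandingAssumptions μ f x₁ L₁ L₂ G V Δ) (hL : 0 ≤ L₁) :
    IsSmooth (objective μ f) L₁ L₂ where
  differentiable x := (h.hasGradientAt_objective hL x).differentiableAt
  differentiable_gradient x := (h.hasFDerivAt_gradient_objective hL x).differentiableAt
  lipschitz_gradient x y := by
    rw [h.gradient_objective hL]
    simp only
    rw [← integral_sub (h.integrable_sampleGrad x) (h.integrable_sampleGrad y)]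
    simpa using norm_integral_le_of_norm_le_const (μ := μ)
      (Filter.Eventually.of_forall fun ξ => h.lipschitz_gradient ξ x y)
  lipschitz_hessian x y := by
    rw [h.hess_objective hL, h.hess_objective hL,
      ← integral_sub (h.integrable_hess hL x) (h.integrable_hess hL y)]
    simpa using norm_integral_le_of_norm_le_const (μ := μ)
      (Filter.Eventually.of_forall fun ξ => h.lipschitz_hessian ξ x y)

theorem integral_sampleGrad_sub (h : StandingAssumptions μ f x₁ L₁ L₂ G V Δ) (hL : 0 ≤ L₁)
    (x : Vec d) : ∫ ξ, (sampleGrad f x ξ - gradient (objective μ f) x) ∂μ = 0 := by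
  rw [integral_sub (h.integrable_sampleGrad x) (integrable_const _), h.gradient_objective hL]
  simp

end StandingAssumptions

/-! ### Concentration of sums of sub-Gaussian vectors -/

theorem lintegral_pi_fin_succ {Ξ : Type*} [MeasurableSpace Ξ] (μ : Measure Ξ)
    [SigmaFinite μ] {m : ℕ} {φ : (Fin (m + 1) → Ξ) → ENNReal} (hφ : Measurable φ) :
    ∫⁻ S, φ S ∂(Measure.pi fun _ => μ)
      = ∫⁻ ξ, ∫⁻ S, φ (Fin.cons ξ S) ∂(Measure.pi fun _ => μ) ∂μ := by
  have h := (measurePreserving_piFinSuccAbove (fun _ : Fin (m + 1) => μ) 0).symm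
  rw [← h.lintegral_comp hφ, lintegral_prod]
  · refine lintegral_congr fun ξ => lintegral_congr fun S => ?_
    simp [MeasurableEquiv.piFinSuccAbove, Fin.consEquiv]
  · exact (hφ.comp h.measurable).aemeasurable

/-- Convexity of `cosh ∘ √` in the angle between two vectors. -/
theorem cosh_norm_add_le {E : Type*} [NormedAddCommGroup E] [InnerProductSpace ℝ E] (a x : E) :
    Real.cosh ‖a + x‖ ≤ Real.cosh ‖a‖ * Real.cosh ‖x‖
      + ⟪a, x⟫ / (‖a‖ * ‖x‖) * (Real.sinh ‖a‖ * Real.sinh ‖x‖) := by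
  set c := ⟪a, x⟫ / (‖a‖ * ‖x‖) with hc
  have hc1 : |c| ≤ 1 := abs_real_inner_div_norm_mul_norm_le_one a x
  obtain ⟨hc2, hc3⟩ := abs_le.1 hc1
  have hin : ⟪a, x⟫ = c * (‖a‖ * ‖x‖) := by
    by_cases h0 : ‖a‖ * ‖x‖ = 0
    · have := abs_real_inner_le_norm a x
      rw [h0] at this ⊢
      simpa using this
    · rw [hc, div_mul_cancel₀ _ h0]
  -- The squared norm of the sum is a convex combination of the two extreme values, with weights
  -- given by the cosine `c`. The series of cosh has nonnegative coefficients in the square of its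
  -- argument, so convexity of powers applies term by term.
  have hr : ‖a + x‖ ^ 2 = (1 + c) / 2 * (‖a‖ + ‖x‖) ^ 2 + (1 - c) / 2 * (‖a‖ - ‖x‖) ^ 2 := by
    rw [norm_add_sq_real, hin]; ring
  have h1 := Real.hasSum_cosh ‖a + x‖
  have h2 := ((Real.hasSum_cosh (‖a‖ + ‖x‖)).mul_left ((1 + c) / 2)).add
    ((Real.hasSum_cosh (‖a‖ - ‖x‖)).mul_left ((1 - c) / 2))
  have h3 := hasSum_le (fun n => ?_) h1 h2
  · rw [Real.cosh_add, Real.cosh_sub] at h3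
    linarith
  · have hcv := (convexOn_pow n).2 (Set.mem_Ici.2 (sq_nonneg (‖a‖ + ‖x‖)))
      (Set.mem_Ici.2 (sq_nonneg (‖a‖ - ‖x‖))) (show 0 ≤ (1 + c) / 2 by linarith)
      (show 0 ≤ (1 - c) / 2 by linarith) (by ring)
    simp only [smul_eq_mul] at hcv
    rw [← hr] at hcv
    simp only [pow_mul]
    rw [← mul_div_assoc, ← mul_div_assoc, ← add_div]
    gcongr

theorem exp_sub_self_le {b : ℝ} (hb : 0 ≤ b) : Real.exp b - b ≤ Real.exp (b ^ 2) := by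
  rcases le_total b 1 with h | h
  · have h1 := Real.abs_exp_sub_one_sub_id_le (x := b) (by rwa [abs_of_nonneg hb])
    have h2 := Real.add_one_le_exp (b ^ 2)
    linarith [le_abs_self (Real.exp b - 1 - b)]
  · have : Real.exp b ≤ Real.exp (b ^ 2) := Real.exp_le_exp.2 (by nlinarith)
    linarith

theorem sq_le_four_mul_cosh {y : ℝ} (hy : 0 ≤ y) : y ^ 2 ≤ 4 * Real.cosh y := by
  have h1 := Real.quadratic_le_exp_of_nonneg hy
  have h2 := Real.add_one_le_exp (-y)
  rw [Real.cosh_eq]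
  linarith

/-- This isolates a term linear in `x`, which vanishes on averaging over a centred vector. Replacing
`sinh ‖x‖` by `‖x‖` in the angular term costs at most `cosh ‖a‖ * (sinh ‖x‖ - ‖x‖)`, and the
remaining `exp ‖x‖ - ‖x‖` is at most `exp (‖x‖ ^ 2)`. -/
theorem cosh_norm_add_le_linear {E : Type*} [NormedAddCommGroup E] [InnerProductSpace ℝ E]
    (a x : E) : Real.cosh ‖a + x‖ ≤ Real.cosh ‖a‖ * Real.exp (‖x‖ ^ 2)
      + Real.sinh ‖a‖ / ‖a‖ * ⟪a, x⟫ := by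
  have h := cosh_norm_add_le a x
  set c := ⟪a, x⟫ / (‖a‖ * ‖x‖) with hc
  have hc3 : c ≤ 1 := (abs_le.1 (abs_real_inner_div_norm_mul_norm_le_one a x)).2
  have hlin : Real.sinh ‖a‖ / ‖a‖ * ⟪a, x⟫ = c * (Real.sinh ‖a‖ * ‖x‖) := by
    rcases eq_or_ne a 0 with rfl | ha
    · simp
    rcases eq_or_ne x 0 with rfl | hx
    · simp
    have := norm_ne_zero_iff.2 ha
    have := norm_ne_zero_iff.2 hx
    rw [hc]; field_simp
  have hs : ‖x‖ ≤ Real.sinh ‖x‖ := Real.self_le_sinh_iff.2 (norm_nonneg x)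
  have hs0 : 0 ≤ Real.sinh ‖a‖ := Real.sinh_nonneg_iff.2 (norm_nonneg a)
  have h1 : c * (Real.sinh ‖a‖ * (Real.sinh ‖x‖ - ‖x‖))
      ≤ Real.cosh ‖a‖ * (Real.sinh ‖x‖ - ‖x‖) := by
    have h2 : Real.sinh ‖a‖ * (Real.sinh ‖x‖ - ‖x‖) ≤ Real.cosh ‖a‖ * (Real.sinh ‖x‖ - ‖x‖) :=
      mul_le_mul_of_nonneg_right (Real.sinh_lt_cosh _).le (by linarith)
    have h3 : 0 ≤ Real.sinh ‖a‖ * (Real.sinh ‖x‖ - ‖x‖) := mul_nonneg hs0 (by linarith)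
    nlinarith
  have h4 := mul_le_mul_of_nonneg_left (exp_sub_self_le (norm_nonneg x)) (Real.cosh_pos ‖a‖).le
  rw [← Real.cosh_add_sinh] at h4
  rw [hlin]
  linarith

section Concentration

variable {d : ℕ} {Ξ : Type*} [MeasurableSpace Ξ] {μ : Measure Ξ} [IsProbabilityMeasure μ]
  {X : Ξ → Vec d} {σ : ℝ}

/-- With q = (lσ)² ≤ 1, convexity of exp between 0 and ‖X‖²/σ² bounds exp(‖lX‖²) by 1 - q + q
exp(‖X‖²/σ²). Its mean is at most 1 - q + qe ≤ 1 + 2q ≤ exp(2q). No dimension enters. -/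
theorem lintegral_cosh_add_le (hX : Measurable X) (hXi : Integrable X μ) (h0 : ∫ ξ, X ξ ∂μ = 0)
    (hσ : 0 < σ) (hsub : ∫⁻ ξ, ENNReal.ofReal (Real.exp (‖X ξ‖ ^ 2 / σ ^ 2)) ∂μ
      ≤ ENNReal.ofReal (Real.exp 1)) {l : ℝ} (hl : 0 ≤ l) (hlσ : l * σ ≤ 1) (a : Vec d) :
    ∫⁻ ξ, ENNReal.ofReal (Real.cosh ‖a + l • X ξ‖) ∂μ
      ≤ ENNReal.ofReal (Real.cosh ‖a‖ * Real.exp (2 * (l * σ) ^ 2)) := by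
  set q := (l * σ) ^ 2 with hq
  have hq0 : 0 ≤ q := sq_nonneg _
  have hq1 : q ≤ 1 := pow_le_one₀ (by positivity) hlσ
  have hexp_int : Integrable (fun ξ => Real.exp (‖X ξ‖ ^ 2 / σ ^ 2)) μ := by
    refine ⟨by fun_prop, ?_⟩
    rw [hasFiniteIntegral_iff_ofReal (Filter.Eventually.of_forall fun ξ => by positivity)]
    exact hsub.trans_lt ENNReal.ofReal_lt_top
  have hexp : ∫ ξ, Real.exp (‖X ξ‖ ^ 2 / σ ^ 2) ∂μ ≤ Real.exp 1 := by
    rw [integral_eq_lintegral_of_nonneg_ae (Filter.Eventually.of_forall fun ξ => by positivity)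
      hexp_int.aestronglyMeasurable]
    exact ENNReal.toReal_le_of_le_ofReal (by positivity) hsub
  have hpt : ∀ ξ, Real.cosh ‖a + l • X ξ‖ ≤ Real.cosh ‖a‖ * ((1 - q) + q *
      Real.exp (‖X ξ‖ ^ 2 / σ ^ 2)) + Real.sinh ‖a‖ / ‖a‖ * l * ⟪a, X ξ⟫ := fun ξ => by
    have h := cosh_norm_add_le_linear a (l • X ξ)
    rw [inner_smul_right, norm_smul, Real.norm_of_nonneg hl] at h
    have h2 := convexOn_exp.2 (Set.mem_univ (0 : ℝ)) (Set.mem_univ (‖X ξ‖ ^ 2 / σ ^ 2))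
      (show 0 ≤ 1 - q by linarith) hq0 (by ring)
    simp only [smul_eq_mul, mul_zero, zero_add, Real.exp_zero, mul_one] at h2
    have e : q * (‖X ξ‖ ^ 2 / σ ^ 2) = (l * ‖X ξ‖) ^ 2 := by
      rw [hq]; field_simp
    rw [e] at h2
    have := mul_le_mul_of_nonneg_left h2 (Real.cosh_pos ‖a‖).le
    linarith
  have hint : Integrable (fun ξ => Real.cosh ‖a‖ * ((1 - q) + q *
      Real.exp (‖X ξ‖ ^ 2 / σ ^ 2)) + Real.sinh ‖a‖ / ‖a‖ * l * ⟪a, X ξ⟫) μ :=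
    (((integrable_const _).add (hexp_int.const_mul q)).const_mul _).add
      ((hXi.const_inner a).const_mul _)
  calc ∫⁻ ξ, ENNReal.ofReal (Real.cosh ‖a + l • X ξ‖) ∂μ
      ≤ ∫⁻ ξ, ENNReal.ofReal (Real.cosh ‖a‖ * ((1 - q) + q *
      Real.exp (‖X ξ‖ ^ 2 / σ ^ 2)) + Real.sinh ‖a‖ / ‖a‖ * l * ⟪a, X ξ⟫) ∂μ :=
        lintegral_mono fun ξ => ENNReal.ofReal_le_ofReal (hpt ξ)
    _ = ENNReal.ofReal (∫ ξ, (Real.cosh ‖a‖ * ((1 - q) + q *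
      Real.exp (‖X ξ‖ ^ 2 / σ ^ 2)) + Real.sinh ‖a‖ / ‖a‖ * l * ⟪a, X ξ⟫) ∂μ) :=
        (ofReal_integral_eq_lintegral_ofReal hint (Filter.Eventually.of_forall fun ξ =>
          (Real.cosh_pos _).le.trans (hpt ξ))).symm
    _ ≤ _ := by
        refine ENNReal.ofReal_le_ofReal ?_
        have e1 : ∫ ξ, ((1 - q) + q * Real.exp (‖X ξ‖ ^ 2 / σ ^ 2)) ∂μ
            = (1 - q) + q * ∫ ξ, Real.exp (‖X ξ‖ ^ 2 / σ ^ 2) ∂μ := by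
          rw [integral_add (integrable_const _) (hexp_int.const_mul q), integral_const_mul]
          simp
        have e2 : ∫ ξ, (Real.cosh ‖a‖ * ((1 - q) + q * Real.exp (‖X ξ‖ ^ 2 / σ ^ 2))
            + Real.sinh ‖a‖ / ‖a‖ * l * ⟪a, X ξ⟫) ∂μ
            = Real.cosh ‖a‖ * ((1 - q) + q * ∫ ξ, Real.exp (‖X ξ‖ ^ 2 / σ ^ 2) ∂μ) := by
          rw [integral_add (f := fun ξ => Real.cosh ‖a‖ * ((1 - q) + q *
              Real.exp (‖X ξ‖ ^ 2 / σ ^ 2))) (g := fun ξ => Real.sinh ‖a‖ / ‖a‖ * l * ⟪a, X ξ⟫)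
            (((integrable_const _).add (hexp_int.const_mul q)).const_mul _)
            ((hXi.const_inner a).const_mul _), integral_const_mul, integral_const_mul, e1,
            integral_inner hXi, h0]
          simp
        rw [e2]
        gcongr
        have h3 := Real.add_one_le_exp (2 * q)
        have h4 := Real.exp_one_lt_d9
        nlinarith

theorem lintegral_cosh_sum_le (hX : Measurable X) (hXi : Integrable X μ) (h0 : ∫ ξ, X ξ ∂μ = 0)
    (hσ : 0 < σ) (hsub : ∫⁻ ξ, ENNReal.ofReal (Real.exp (‖X ξ‖ ^ 2 / σ ^ 2)) ∂μ
      ≤ ENNReal.ofReal (Real.exp 1)) {l : ℝ} (hl : 0 ≤ l) (hlσ : l * σ ≤ 1) (m : ℕ) (a : Vec d) :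
    ∫⁻ S : Fin m → Ξ, ENNReal.ofReal (Real.cosh ‖a + l • ∑ i, X (S i)‖) ∂(Measure.pi fun _ => μ)
      ≤ ENNReal.ofReal (Real.cosh ‖a‖ * Real.exp (2 * (l * σ) ^ 2 * m)) := by
  induction m generalizing a with
  | zero => simp
  | succ m ih =>
    rw [lintegral_pi_fin_succ μ (by fun_prop)]
    calc _ ≤ ∫⁻ ξ, ENNReal.ofReal (Real.exp (2 * (l * σ) ^ 2 * m)) *
          ENNReal.ofReal (Real.cosh ‖a + l • X ξ‖) ∂μ := by
          refine lintegral_mono fun ξ => ?_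
          rw [← ENNReal.ofReal_mul (by positivity), mul_comm]
          refine le_trans (le_of_eq ?_) (ih (a + l • X ξ))
          refine lintegral_congr fun S => ?_
          simp [Fin.sum_univ_succ, smul_add, add_assoc]
      _ ≤ ENNReal.ofReal (Real.exp (2 * (l * σ) ^ 2 * m)) *
          ENNReal.ofReal (Real.cosh ‖a‖ * Real.exp (2 * (l * σ) ^ 2)) := by
          rw [lintegral_const_mul _ (by fun_prop)]
          gcongr
          exact lintegral_cosh_add_le hX hXi h0 hσ hsub hl hlσ a
      _ = _ := by
          rw [← ENNReal.ofReal_mul (by positivity)]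
          congr 1
          push_cast
          rw [mul_add, Real.exp_add, mul_one]
          ring

theorem measure_norm_sum_ge_le (hX : Measurable X) (hXi : Integrable X μ) (h0 : ∫ ξ, X ξ ∂μ = 0)
    (hσ : 0 < σ) (hsub : ∫⁻ ξ, ENNReal.ofReal (Real.exp (‖X ξ‖ ^ 2 / σ ^ 2)) ∂μ
      ≤ ENNReal.ofReal (Real.exp 1)) {τ : ℝ} (hτ : 0 ≤ τ) (hτσ : τ ≤ 4 * σ) (m : ℕ) :
    (Measure.pi fun _ : Fin m => μ) {S | m * τ ≤ ‖∑ i, X (S i)‖}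
      ≤ ENNReal.ofReal (2 * Real.exp (-(m * τ ^ 2 / (8 * σ ^ 2)))) := by
  -- The minimizer of the exponent 2(lσ)²m - lmτ in Markov's inequality; the factor 2 in the bound
  -- comes from cosh t ≥ exp(t)/2.
  obtain ⟨l, hl⟩ : ∃ l, l = τ / (4 * σ ^ 2) := ⟨_, rfl⟩
  have hl0 : 0 ≤ l := by rw [hl]; positivity
  have hlσ : l * σ ≤ 1 := by
    rw [hl, div_mul_eq_mul_div, div_le_one (by positivity)]; nlinarith
  have h := lintegral_cosh_sum_le hX hXi h0 hσ hsub hl0 hlσ m 0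
  simp only [zero_add, norm_zero, Real.cosh_zero, one_mul] at h
  set c := Real.exp (l * (m * τ)) / 2 with hcdef
  have hc : 0 < c := by positivity
  have hsubset : {S : Fin m → Ξ | m * τ ≤ ‖∑ i, X (S i)‖}
      ⊆ {S | ENNReal.ofReal c ≤ ENNReal.ofReal (Real.cosh ‖l • ∑ i, X (S i)‖)} := fun S hS => by
    refine ENNReal.ofReal_le_ofReal ?_
    rw [norm_smul, Real.norm_of_nonneg hl0, Real.cosh_eq, hcdef]
    have : l * (m * τ) ≤ l * ‖∑ i, X (S i)‖ := mul_le_mul_of_nonneg_left hS hl0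
    have := Real.exp_le_exp.2 this
    have := Real.exp_pos (-(l * ‖∑ i, X (S i)‖))
    linarith
  refine (measure_mono hsubset).trans ?_
  have hmeas : Measurable fun S : Fin m → Ξ => ENNReal.ofReal (Real.cosh ‖l • ∑ i, X (S i)‖) := by
    fun_prop
  refine (meas_ge_le_lintegral_div hmeas.aemeasurable (by simpa using hc)
    ENNReal.ofReal_ne_top).trans ?_
  refine (ENNReal.div_le_div_right h _).trans ?_
  rw [← ENNReal.ofReal_div_of_pos hc]
  refine ENNReal.ofReal_le_ofReal (le_of_eq ?_)
  rw [hcdef, div_div_eq_mul_div, div_eq_iff (by positivity), mul_assoc (2 : ℝ) (Real.exp _),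
    ← Real.exp_add, mul_comm]
  congr 2
  rw [hl]; field_simp; ring

theorem lintegral_norm_sum_sq_le (hX : Measurable X) (hXi : Integrable X μ)
    (h0 : ∫ ξ, X ξ ∂μ = 0) (hσ : 0 < σ)
    (hsub : ∫⁻ ξ, ENNReal.ofReal (Real.exp (‖X ξ‖ ^ 2 / σ ^ 2)) ∂μ ≤ ENNReal.ofReal (Real.exp 1))
    {m : ℕ} (hm : 0 < m) :
    ∫⁻ S : Fin m → Ξ, ENNReal.ofReal (‖∑ i, X (S i)‖ ^ 2) ∂(Measure.pi fun _ => μ)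
      ≤ ENNReal.ofReal (32 * σ ^ 2 * m) := by
  have hm' : (1 : ℝ) ≤ m := by exact_mod_cast hm
  -- This scaling makes the exponent 2(lσ)²m equal to 2, so the second moment can be read off from
  -- y² ≤ 4 cosh y and e² ≤ 8.
  obtain ⟨l, hl⟩ : ∃ l, l = 1 / (σ * √m) := ⟨_, rfl⟩
  have hs : 1 ≤ √(m : ℝ) := Real.one_le_sqrt.2 hm'
  have hsq : √(m : ℝ) ^ 2 = m := Real.sq_sqrt (by positivity)
  have hl0 : 0 ≤ l := by rw [hl]; positivity
  have hlσ : l * σ = 1 / √m := by rw [hl]; field_simp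
  have hlsq : l ^ 2 = 1 / (σ ^ 2 * m) := by rw [hl, div_pow, mul_pow, hsq, one_pow]
  have h := lintegral_cosh_sum_le hX hXi h0 hσ hsub hl0
    (by rw [hlσ, div_le_one (by positivity)]; exact hs) m 0
  simp only [zero_add, norm_zero, Real.cosh_zero, one_mul] at h
  have e : 2 * (l * σ) ^ 2 * m = 2 := by rw [hlσ, div_pow, hsq]; field_simp
  rw [e] at h
  have hpt : ∀ S : Fin m → Ξ, ENNReal.ofReal (‖∑ i, X (S i)‖ ^ 2) ≤
      ENNReal.ofReal (4 * σ ^ 2 * m) * ENNReal.ofReal (Real.cosh ‖l • ∑ i, X (S i)‖) := fun S => by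
    rw [← ENNReal.ofReal_mul (by positivity)]
    refine ENNReal.ofReal_le_ofReal ?_
    have h1 := sq_le_four_mul_cosh (norm_nonneg (l • ∑ i, X (S i)))
    have e : ‖l • ∑ i, X (S i)‖ ^ 2 = 1 / (σ ^ 2 * m) * ‖∑ i, X (S i)‖ ^ 2 := by
      rw [norm_smul, mul_pow, Real.norm_of_nonneg hl0, hlsq]
    rw [e] at h1
    have h2 : ‖∑ i, X (S i)‖ ^ 2 = 4 * σ ^ 2 * m * (1 / (σ ^ 2 * m) * ‖∑ i, X (S i)‖ ^ 2 / 4) := by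
      field_simp
    rw [h2]
    gcongr
    linarith
  refine (lintegral_mono hpt).trans ?_
  rw [lintegral_const_mul _ (by fun_prop)]
  refine (mul_le_mul_right h _).trans ?_
  rw [← ENNReal.ofReal_mul (by positivity)]
  refine ENNReal.ofReal_le_ofReal ?_
  have h4 : Real.exp 2 ≤ 8 := by
    have := Real.exp_one_lt_d9
    have e2 : Real.exp 2 = Real.exp 1 * Real.exp 1 := by rw [← Real.exp_add]; norm_num
    have := Real.exp_pos 1
    rw [e2]; nlinarith
  have : 0 ≤ 4 * σ ^ 2 * m := by positivity
  nlinarith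

end Concentration

/-! ### Trace inequalities for symmetric matrices -/

/-- The first-order Taylor remainders Rₙ of the powers satisfy Rₙ₊₁ = a Rₙ + (n + 2)(a - b)² bⁿ⁺¹,
which gives the bound by induction. -/
theorem abs_pow_sub_pow_sub_le {a b M : ℝ} (ha : |a| ≤ M) (hb : |b| ≤ M) (n : ℕ) :
    |a ^ (n + 2) - b ^ (n + 2) - (n + 2) * (a - b) * b ^ (n + 1)|
      ≤ (n + 2) ^ 2 * (a - b) ^ 2 * M ^ n := by
  have hM : 0 ≤ M := (abs_nonneg a).trans ha
  induction n with
  | zero =>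
    have e : a ^ 2 - b ^ 2 - 2 * (a - b) * b = (a - b) ^ 2 := by ring
    simp only [Nat.cast_zero, zero_add, pow_one, pow_zero, mul_one]
    rw [e, abs_of_nonneg (sq_nonneg _)]
    nlinarith [sq_nonneg (a - b)]
  | succ n ih =>
    have e : a ^ (n + 1 + 2) - b ^ (n + 1 + 2) - ((n + 1 : ℕ) + 2) * (a - b) * b ^ (n + 1 + 1)
        = a * (a ^ (n + 2) - b ^ (n + 2) - (n + 2) * (a - b) * b ^ (n + 1))
          + (n + 2) * (a - b) ^ 2 * b ^ (n + 1) := by push_cast; ring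
    rw [e]
    refine (abs_add_le _ _).trans ?_
    rw [abs_mul, abs_mul, abs_pow, abs_of_nonneg (show (0 : ℝ) ≤ (n + 2) * (a - b) ^ 2 by positivity)]
    calc _ ≤ M * ((n + 2) ^ 2 * (a - b) ^ 2 * M ^ n) + (n + 2) * (a - b) ^ 2 * M ^ (n + 1) := by
          gcongr
      _ = ((n + 2) ^ 2 + (n + 2)) * ((a - b) ^ 2 * M ^ (n + 1)) := by ring
      _ ≤ ((n + 1 : ℕ) + 2) ^ 2 * ((a - b) ^ 2 * M ^ (n + 1)) := by
          gcongr
          push_cast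
          nlinarith
      _ = _ := by ring

/-- For even `n` the power of max(|a|, |b|) is at most `a ^ n + b ^ n`. This separated form can be
turned into traces. -/
theorem pow_sub_pow_sub_le {n : ℕ} (hn : Even n) (a b : ℝ) :
    a ^ (n + 2) - b ^ (n + 2) - (n + 2) * (a - b) * b ^ (n + 1)
      ≤ (n + 2) ^ 2 * (a - b) ^ 2 * (a ^ n + b ^ n) := by
  refine (le_abs_self _).trans ((abs_pow_sub_pow_sub_le (le_max_left |a| |b|)
    (le_max_right |a| |b|) n).trans ?_)
  gcongr
  rcases max_choice |a| |b| with h | h <;> rw [h, hn.pow_abs]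
  · linarith [hn.pow_nonneg b]
  · linarith [hn.pow_nonneg a]

open Matrix

namespace Matrix.IsHermitian

variable {d : ℕ} {A B : Matrix (Fin d) (Fin d) ℝ}

theorem exists_orthogonal_diagonal (hA : A.IsHermitian) :
    ∃ (U : Matrix (Fin d) (Fin d) ℝ) (a : Fin d → ℝ), U * Uᵀ = 1 ∧ Uᵀ * U = 1 ∧
      ∀ k : ℕ, A ^ k = U * diagonal (fun i => a i ^ k) * Uᵀ := by
  have h1 : (hA.eigenvectorUnitary : Matrix (Fin d) (Fin d) ℝ)
      * (hA.eigenvectorUnitary : Matrix (Fin d) (Fin d) ℝ)ᵀ = 1 := by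
    simpa [star_eq_conjTranspose] using Unitary.coe_mul_star_self hA.eigenvectorUnitary
  have h2 : (hA.eigenvectorUnitary : Matrix (Fin d) (Fin d) ℝ)ᵀ
      * (hA.eigenvectorUnitary : Matrix (Fin d) (Fin d) ℝ) = 1 := by
    simpa [star_eq_conjTranspose] using Unitary.coe_star_mul_self hA.eigenvectorUnitary
  refine ⟨hA.eigenvectorUnitary, hA.eigenvalues, h1, h2, fun k => ?_⟩
  have hs : A = (hA.eigenvectorUnitary : Matrix (Fin d) (Fin d) ℝ) * diagonal hA.eigenvalues
      * (hA.eigenvectorUnitary : Matrix (Fin d) (Fin d) ℝ)ᵀ := by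
    conv_lhs => rw [hA.spectral_theorem, Unitary.conjStarAlgAut_apply]
    simp [star_eq_conjTranspose]
  generalize (hA.eigenvectorUnitary : Matrix (Fin d) (Fin d) ℝ) = U at *
  generalize hA.eigenvalues = a at *
  induction k with
  | zero => simp [h1]
  | succ k ih =>
    rw [pow_succ, ih, hs]
    calc U * diagonal (fun i => a i ^ k) * Uᵀ * (U * diagonal a * Uᵀ)
        = U * diagonal (fun i => a i ^ k) * (Uᵀ * U) * diagonal a * Uᵀ := by
          simp only [Matrix.mul_assoc]
      _ = _ := by
          rw [h2, Matrix.mul_one, Matrix.mul_assoc U, diagonal_mul_diagonal]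
          simp only [pow_succ]

/-- A joint spectral representation of the traces of products of powers of two matrices. -/
theorem exists_trace_pow_mul_pow (hA : A.IsHermitian) (hB : B.IsHermitian) :
    ∃ (a b : Fin d → ℝ) (w : Fin d → Fin d → ℝ), (∀ i j, 0 ≤ w i j) ∧
      ∀ k l : ℕ, (A ^ k * B ^ l).trace = ∑ i, ∑ j, w i j * (a i ^ k * b j ^ l) := by
  obtain ⟨U, a, -, -, hU⟩ := hA.exists_orthogonal_diagonal
  obtain ⟨W, b, -, -, hW⟩ := hB.exists_orthogonal_diagonal
  -- The weights are the squared inner products of the two eigenbases. Scalar inequalities between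
  -- eigenvalues thereby pass to traces although the matrices need not commute.
  refine ⟨a, b, fun i j => (Uᵀ * W) i j ^ 2, fun i j => sq_nonneg _, fun k l => ?_⟩
  rw [hU, hW]
  calc (U * diagonal (fun i => a i ^ k) * Uᵀ * (W * diagonal (fun i => b i ^ l) * Wᵀ)).trace
      = (diagonal (fun i => a i ^ k) * (Uᵀ * W) * (diagonal (fun i => b i ^ l) * (Uᵀ * W)ᵀ)).trace := by
        rw [Matrix.mul_assoc U, Matrix.mul_assoc U, trace_mul_comm U, transpose_mul,
          transpose_transpose]
        simp only [Matrix.mul_assoc]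
    _ = _ := by
        simp only [trace, diag_apply, Matrix.mul_apply (M := diagonal (fun i => a i ^ k) * (Uᵀ * W)),
          diagonal_mul, transpose_apply]
        refine Finset.sum_congr rfl fun i _ => Finset.sum_congr rfl fun j _ => ?_
        ring

/-- Jensen's inequality for the squared coordinates of `v` in an eigenbasis, which are weights of
total mass one and hence each at most one. -/
theorem dotProduct_mulVec_pow_le (hA : A.IsHermitian) {n : ℕ} (hn : Even n) (v : Fin d → ℝ)
    (hv : v ⬝ᵥ v = 1) : (v ⬝ᵥ A *ᵥ v) ^ n ≤ (A ^ n).trace := by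
  obtain ⟨U, a, hU1, hU2, hU⟩ := hA.exists_orthogonal_diagonal
  have hq : ∀ k : ℕ, v ⬝ᵥ (U * diagonal (fun i => a i ^ k) * Uᵀ) *ᵥ v
      = ∑ i, (Uᵀ *ᵥ v) i ^ 2 * a i ^ k := fun k => by
    rw [← mulVec_mulVec, ← mulVec_mulVec, dotProduct_mulVec, ← mulVec_transpose]
    simp only [dotProduct, mulVec_diagonal]
    exact Finset.sum_congr rfl fun i _ => by ring
  have h1 : ∑ i, (Uᵀ *ᵥ v) i ^ 2 = 1 := by
    have := hq 0
    simp only [pow_zero, diagonal_one, hU1, one_mulVec, hv, mul_one] at this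
    exact this.symm
  have h2 : (A ^ n).trace = ∑ i, a i ^ n := by
    rw [hU, trace_mul_comm, ← Matrix.mul_assoc, hU2, Matrix.one_mul]
    simp [trace]
  have h3 : v ⬝ᵥ A *ᵥ v = ∑ i, (Uᵀ *ᵥ v) i ^ 2 * a i := by
    have h := hq 1
    rw [← hU 1] at h
    simpa using h
  rw [h3, h2]
  refine (Real.pow_arith_mean_le_arith_mean_pow_of_even Finset.univ _ _
    (fun i _ => sq_nonneg _) h1 hn).trans (Finset.sum_le_sum fun i _ => ?_)
  refine mul_le_of_le_one_left (hn.pow_nonneg _) ?_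
  rw [← h1]
  exact Finset.single_le_sum (f := fun i => (Uᵀ *ᵥ v) i ^ 2) (fun i _ => sq_nonneg _)
    (Finset.mem_univ i)

theorem trace_pow_nonneg (hA : A.IsHermitian) {n : ℕ} (hn : Even n) : 0 ≤ (A ^ n).trace := by
  obtain ⟨U, a, -, hU2, hU⟩ := hA.exists_orthogonal_diagonal
  rw [hU, trace_mul_comm, ← Matrix.mul_assoc, hU2, Matrix.one_mul]
  simp only [trace, diag_apply, diagonal_apply_eq]
  exact Finset.sum_nonneg fun i _ => hn.pow_nonneg _

/-- For n = 2q the left side is the squared Frobenius norm of D A^q, and D is bounded column by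
column. -/
theorem trace_sq_mul_pow_le {D : Matrix (Fin d) (Fin d) ℝ} (hD : D.IsHermitian)
    (hA : A.IsHermitian) {K : ℝ} (hK : ∀ v, (D *ᵥ v) ⬝ᵥ (D *ᵥ v) ≤ K ^ 2 * (v ⬝ᵥ v)) {n : ℕ}
    (hn : Even n) : (D * D * A ^ n).trace ≤ K ^ 2 * (A ^ n).trace := by
  obtain ⟨q, rfl⟩ := hn
  have hAq : (A ^ q)ᵀ = A ^ q := by simpa [conjTranspose] using (hA.pow q).eq
  have hDt : Dᵀ = D := by simpa [conjTranspose] using hD.eq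
  have key : ∀ C : Matrix (Fin d) (Fin d) ℝ, (Cᵀ * C).trace = ∑ j, (C.col j) ⬝ᵥ (C.col j) := fun C => by
    simp [trace, Matrix.mul_apply, dotProduct]
  have e1 : (D * D * A ^ (q + q)).trace = ((D * A ^ q)ᵀ * (D * A ^ q)).trace := by
    rw [transpose_mul, hAq, hDt, pow_add, ← Matrix.mul_assoc, trace_mul_comm]
    simp only [Matrix.mul_assoc]
  have e2 : (A ^ (q + q)).trace = ((A ^ q)ᵀ * (A ^ q)).trace := by rw [hAq, pow_add]
  rw [e1, e2, key, key, Finset.mul_sum]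
  refine Finset.sum_le_sum fun j _ => ?_
  exact hK ((A ^ q).col j)

/-- The scalar remainder estimate, summed over pairs of eigenvalues with the joint spectral weights.
When A is B plus a centred random matrix independent of B, the term with `(A - B) * B ^ (n + 1)` has
mean zero, which is what the moment recursion needs. -/
theorem trace_pow_le_linear (hA : A.IsHermitian) (hB : B.IsHermitian) {K : ℝ}
    (hK : ∀ v, ((A - B) *ᵥ v) ⬝ᵥ ((A - B) *ᵥ v) ≤ K ^ 2 * (v ⬝ᵥ v)) {n : ℕ} (hn : Even n) :
    (A ^ (n + 2)).trace ≤ (B ^ (n + 2)).trace + (n + 2) * ((A - B) * B ^ (n + 1)).trace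
      + (n + 2) ^ 2 * K ^ 2 * ((A ^ n).trace + (B ^ n).trace) := by
  obtain ⟨a, b, w, hw, h⟩ := hA.exists_trace_pow_mul_pow hB
  have hAk : ∀ k, (A ^ k).trace = ∑ i, ∑ j, w i j * a i ^ k := fun k => by
    simpa using h k 0
  have hBk : ∀ k, (B ^ k).trace = ∑ i, ∑ j, w i j * b j ^ k := fun k => by
    simpa using h 0 k
  have h1 : ((A - B) * (A - B) * A ^ n).trace = ∑ i, ∑ j, w i j * ((a i - b j) ^ 2 * a i ^ n) := by
    have e : ((A - B) * (A - B) * A ^ n).trace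
        = (A ^ (n + 2)).trace - 2 * (A ^ (n + 1) * B ^ 1).trace + (A ^ n * B ^ 2).trace := by
      have e1 : (A - B) * (A - B) * A ^ n
          = A ^ (n + 2) - A * (B * A ^ n) - B * A ^ (n + 1) + B ^ 2 * A ^ n := by
        rw [pow_succ' A (n + 1), pow_succ' A n]
        noncomm_ring
      rw [e1, trace_add, trace_sub, trace_sub, trace_mul_comm A (B * A ^ n), Matrix.mul_assoc,
        ← pow_succ, trace_mul_comm B, trace_mul_comm (B ^ 2), pow_one]
      ring
    rw [e, hAk, h, h, Finset.mul_sum, ← Finset.sum_sub_distrib, ← Finset.sum_add_distrib]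
    refine Finset.sum_congr rfl fun i _ => ?_
    rw [Finset.mul_sum, ← Finset.sum_sub_distrib, ← Finset.sum_add_distrib]
    exact Finset.sum_congr rfl fun j _ => by ring
  have h2 : ((A - B) * (A - B) * B ^ n).trace = ∑ i, ∑ j, w i j * ((a i - b j) ^ 2 * b j ^ n) := by
    have e : ((A - B) * (A - B) * B ^ n).trace
        = (A ^ 2 * B ^ n).trace - 2 * (A ^ 1 * B ^ (n + 1)).trace + (B ^ (n + 2)).trace := by
      have e1 : (A - B) * (A - B) * B ^ n
          = A ^ 2 * B ^ n - A * B ^ (n + 1) - B * (A * B ^ n) + B ^ (n + 2) := by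
        rw [pow_succ' B (n + 1), pow_succ' B n]
        noncomm_ring
      rw [e1, trace_add, trace_sub, trace_sub, trace_mul_comm B (A * B ^ n), Matrix.mul_assoc,
        ← pow_succ, pow_one]
      ring
    rw [e, hBk, h, h, Finset.mul_sum, ← Finset.sum_sub_distrib, ← Finset.sum_add_distrib]
    refine Finset.sum_congr rfl fun i _ => ?_
    rw [Finset.mul_sum, ← Finset.sum_sub_distrib, ← Finset.sum_add_distrib]
    exact Finset.sum_congr rfl fun j _ => by ring
  have h3 : ((A - B) * B ^ (n + 1)).trace = ∑ i, ∑ j, w i j * ((a i - b j) * b j ^ (n + 1)) := by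
    rw [Matrix.sub_mul, trace_sub, ← pow_succ', hBk]
    have := h 1 (n + 1)
    rw [pow_one] at this
    rw [this, ← Finset.sum_sub_distrib]
    refine Finset.sum_congr rfl fun i _ => ?_
    rw [← Finset.sum_sub_distrib]
    exact Finset.sum_congr rfl fun j _ => by ring
  have hAA := (hA.sub hB).trace_sq_mul_pow_le hA hK hn
  have hBB := (hA.sub hB).trace_sq_mul_pow_le hB hK hn
  have h4 : (A ^ (n + 2)).trace - (B ^ (n + 2)).trace - (n + 2) * ((A - B) * B ^ (n + 1)).trace
      ≤ (n + 2) ^ 2 * (((A - B) * (A - B) * A ^ n).trace + ((A - B) * (A - B) * B ^ n).trace) := by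
    rw [h1, h2, h3, hAk, hBk]
    simp only [Finset.mul_sum, ← Finset.sum_sub_distrib, ← Finset.sum_add_distrib]
    refine Finset.sum_le_sum fun i _ => Finset.sum_le_sum fun j _ => ?_
    have := mul_le_mul_of_nonneg_left (pow_sub_pow_sub_le hn (a i) (b j)) (hw i j)
    linarith
  have h5 : (n + 2 : ℝ) ^ 2 * (((A - B) * (A - B) * A ^ n).trace + ((A - B) * (A - B) * B ^ n).trace)
      ≤ (n + 2) ^ 2 * (K ^ 2 * (A ^ n).trace + K ^ 2 * (B ^ n).trace) := by gcongr
  linarith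

end Matrix.IsHermitian

/-! ### Concentration of sums of random symmetric matrices -/

/-- Measurable and bounded real functions. -/
def IsBddMeasurable {Ω : Type*} [MeasurableSpace Ω] (φ : Ω → ℝ) : Prop :=
  Measurable φ ∧ ∃ c, ∀ ω, |φ ω| ≤ c

namespace IsBddMeasurable

variable {Ω : Type*} [MeasurableSpace Ω] {φ ψ : Ω → ℝ}

theorem const (c : ℝ) : IsBddMeasurable fun _ : Ω => c :=
  ⟨measurable_const, |c|, fun _ => le_rfl⟩

theorem add (h : IsBddMeasurable φ) (h' : IsBddMeasurable ψ) :
    IsBddMeasurable fun ω => φ ω + ψ ω := by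
  obtain ⟨h, c, hc⟩ := h
  obtain ⟨h', c', hc'⟩ := h'
  exact ⟨h.add h', c + c', fun ω => (abs_add_le _ _).trans (add_le_add (hc ω) (hc' ω))⟩

theorem mul (h : IsBddMeasurable φ) (h' : IsBddMeasurable ψ) :
    IsBddMeasurable fun ω => φ ω * ψ ω := by
  obtain ⟨h, c, hc⟩ := h
  obtain ⟨h', c', hc'⟩ := h'
  refine ⟨h.mul h', c * c', fun ω => ?_⟩
  rw [abs_mul]
  exact mul_le_mul (hc ω) (hc' ω) (abs_nonneg _) ((abs_nonneg _).trans (hc ω))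

theorem sum {ι : Type*} (s : Finset ι) {φ : ι → Ω → ℝ} (h : ∀ i ∈ s, IsBddMeasurable (φ i)) :
    IsBddMeasurable fun ω => ∑ i ∈ s, φ i ω := by
  classical
  induction s using Finset.induction_on with
  | empty => simpa using const (Ω := Ω) 0
  | insert i s hi ih =>
    simp only [Finset.sum_insert hi]
    exact (h i (Finset.mem_insert_self i s)).add
      (ih fun j hj => h j (Finset.mem_insert_of_mem hj))

theorem integrable (h : IsBddMeasurable φ) (P : Measure Ω) [IsFiniteMeasure P] :
    Integrable φ P := by
  obtain ⟨h, c, hc⟩ := h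
  exact (integrable_const c).mono' h.aestronglyMeasurable (Filter.Eventually.of_forall hc)

theorem comp {Ω' : Type*} [MeasurableSpace Ω'] (h : IsBddMeasurable φ) {g : Ω' → Ω}
    (hg : Measurable g) : IsBddMeasurable fun ω => φ (g ω) :=
  ⟨h.1.comp hg, h.2.imp fun _ hc ω => hc (g ω)⟩

theorem matrix_mul {d : ℕ} {A B : Ω → Matrix (Fin d) (Fin d) ℝ}
    (hA : ∀ i j, IsBddMeasurable fun ω => A ω i j) (hB : ∀ i j, IsBddMeasurable fun ω => B ω i j)
    (i j : Fin d) : IsBddMeasurable fun ω => (A ω * B ω) i j := by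
  simp only [Matrix.mul_apply]
  exact sum _ fun k _ => (hA i k).mul (hB k j)

theorem matrix_pow {d : ℕ} {A : Ω → Matrix (Fin d) (Fin d) ℝ}
    (hA : ∀ i j, IsBddMeasurable fun ω => A ω i j) (n : ℕ)
    (i j : Fin d) : IsBddMeasurable fun ω => (A ω ^ n) i j := by
  induction n generalizing i j with
  | zero => simpa using const (Ω := Ω) _
  | succ n ih =>
    simp only [pow_succ]
    exact matrix_mul ih hA i j

theorem trace {d : ℕ} {A : Ω → Matrix (Fin d) (Fin d) ℝ}
    (hA : ∀ i j, IsBddMeasurable fun ω => A ω i j) : IsBddMeasurable fun ω => (A ω).trace := by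
  simp only [Matrix.trace]
  exact sum _ fun i _ => hA i i

end IsBddMeasurable

open Matrix

theorem integral_pi_fin_succ {Ξ : Type*} [MeasurableSpace Ξ] (μ : Measure Ξ)
    [SigmaFinite μ] {m : ℕ} (φ : (Fin (m + 1) → Ξ) → ℝ) :
    ∫ S, φ S ∂(Measure.pi fun _ => μ)
      = ∫ q : Ξ × (Fin m → Ξ), φ (Fin.cons q.1 q.2) ∂(μ.prod (Measure.pi fun _ => μ)) := by
  have h := (measurePreserving_piFinSuccAbove (fun _ : Fin (m + 1) => μ) 0).symm
  rw [← h.integral_comp']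
  refine integral_congr_ae (Filter.Eventually.of_forall fun q => ?_)
  simp [MeasurableEquiv.piFinSuccAbove, Fin.consEquiv]

theorem integral_linear_combination {Ω : Type*} [MeasurableSpace Ω] {P : Measure Ω}
    {f g h k : Ω → ℝ} (hf : Integrable f P) (hg : Integrable g P) (hh : Integrable h P)
    (hk : Integrable k P) (a b : ℝ) :
    ∫ x, (f x + a * g x + b * (h x + k x)) ∂P
      = ∫ x, f x ∂P + a * ∫ x, g x ∂P + b * (∫ x, h x ∂P + ∫ x, k x ∂P) := by
  rw [integral_add (f := fun x => f x + a * g x) (g := fun x => b * (h x + k x))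
    (hf.add (hg.const_mul a)) ((hh.add hk).const_mul b), integral_add hf (hg.const_mul a),
    integral_const_mul, integral_const_mul, integral_add hh hk]

section

variable {d : ℕ} {Ξ : Type*} [MeasurableSpace Ξ] {μ : Measure Ξ} [IsProbabilityMeasure μ]
  {X : Ξ → Matrix (Fin d) (Fin d) ℝ} {K : ℝ}

/-- Induction on the exponent and, inside it, on the number of samples. Adding a sample contributes
no linear term on average, and the quadratic remainder is controlled by the moments with exponent
lower by two. The bound `P` on all exponents keeps the constant fixed throughout the induction. -/
theorem integral_trace_sum_pow_le (hX : ∀ i j, IsBddMeasurable fun ξ => X ξ i j)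
    (hsymm : ∀ ξ, (X ξ).IsHermitian) (h0 : ∀ i j, ∫ ξ, X ξ i j ∂μ = 0)
    (hK : ∀ ξ v, (X ξ *ᵥ v) ⬝ᵥ (X ξ *ᵥ v) ≤ K ^ 2 * (v ⬝ᵥ v)) {P : ℕ} (p : ℕ) (hp : p ≤ P) (m : ℕ) :
    ∫ S : Fin m → Ξ, ((∑ i, X (S i)) ^ (2 * p)).trace ∂(Measure.pi fun _ => μ)
      ≤ d * (8 * P ^ 2 * K ^ 2 * m) ^ p := by
  have hS : ∀ (m : ℕ) (i j : Fin d), IsBddMeasurable fun S : Fin m → Ξ => (∑ i, X (S i)) i j :=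
    fun m i j => by
      simp only [Matrix.sum_apply]
      exact IsBddMeasurable.sum _ fun k _ => (hX i j).comp (measurable_pi_apply k)
  have hsum : ∀ {m : ℕ} (S : Fin m → Ξ), (∑ i, X (S i)).IsHermitian := fun S =>
    isSelfAdjoint_sum _ fun i _ => hsymm (S i)
  induction p generalizing m with
  | zero => simp
  | succ p ih =>
    induction m with
    | zero => simp
    | succ m ihm =>
      have hmain := integral_pi_fin_succ μ fun S : Fin (m + 1) → Ξ =>
        ((∑ i, X (S i)) ^ (2 * (p + 1))).trace
      have hmain' := integral_pi_fin_succ μ fun S : Fin (m + 1) → Ξ =>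
        ((∑ i, X (S i)) ^ (2 * p)).trace
      simp only [Fin.sum_univ_succ, Fin.cons_zero, Fin.cons_succ] at hmain hmain'
      set ν := μ.prod (Measure.pi fun _ : Fin m => μ) with hν
      let Z : Ξ × (Fin m → Ξ) → Matrix (Fin d) (Fin d) ℝ := fun q => ∑ i, X (q.2 i)
      have hZ : ∀ i j, IsBddMeasurable fun q => Z q i j := fun i j =>
        (hS m i j).comp measurable_snd
      have hX1 : ∀ i j, IsBddMeasurable fun q : Ξ × (Fin m → Ξ) => X q.1 i j := fun i j =>
        (hX i j).comp measurable_fst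
      have hXZ : ∀ i j, IsBddMeasurable fun q : Ξ × (Fin m → Ξ) => (X q.1 + Z q) i j := fun i j =>
        (hX1 i j).add (hZ i j)
      have i1 : ∀ n, Integrable (fun q => ((X q.1 + Z q) ^ n).trace) ν := fun n =>
        (IsBddMeasurable.trace (IsBddMeasurable.matrix_pow hXZ n)).integrable ν
      have i2 : ∀ n, Integrable (fun q => (Z q ^ n).trace) ν := fun n =>
        (IsBddMeasurable.trace (IsBddMeasurable.matrix_pow hZ n)).integrable ν
      have i3 : Integrable (fun q => (X q.1 * Z q ^ (2 * p + 1)).trace) ν :=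
        (IsBddMeasurable.trace (IsBddMeasurable.matrix_mul hX1
          (IsBddMeasurable.matrix_pow hZ _))).integrable ν
      have e3 : ∫ q, (X q.1 * Z q ^ (2 * p + 1)).trace ∂ν = 0 := by
        simp only [Matrix.trace, Matrix.diag_apply, Matrix.mul_apply]
        have hbm : ∀ i j, IsBddMeasurable fun q : Ξ × (Fin m → Ξ) =>
            X q.1 i j * (Z q ^ (2 * p + 1)) j i := fun i j =>
          (hX1 i j).mul (IsBddMeasurable.matrix_pow hZ _ j i)
        rw [integral_finsetSum _ fun i _ => (IsBddMeasurable.sum _ fun j _ => hbm i j).integrable ν]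
        refine Finset.sum_eq_zero fun i _ => ?_
        rw [integral_finsetSum _ fun j _ => (hbm i j).integrable ν]
        refine Finset.sum_eq_zero fun j _ => ?_
        rw [hν, integral_prod_mul (fun ξ => X ξ i j)
          (fun S : Fin m → Ξ => ((∑ i, X (S i)) ^ (2 * p + 1)) j i), h0, zero_mul]
      have e2 : ∀ n, ∫ q, (Z q ^ n).trace ∂ν
          = ∫ S : Fin m → Ξ, ((∑ i, X (S i)) ^ n).trace ∂(Measure.pi fun _ => μ) := fun n => by
        have := integral_prod_mul (μ := μ) (ν := Measure.pi fun _ : Fin m => μ)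
          (fun _ => (1 : ℝ)) (fun S : Fin m → Ξ => ((∑ i, X (S i)) ^ n).trace)
        simpa [hν, Z] using this
      have hpt : ∀ q, ((X q.1 + Z q) ^ (2 * p + 2)).trace ≤ (Z q ^ (2 * p + 2)).trace
          + (2 * p + 2) * (X q.1 * Z q ^ (2 * p + 1)).trace + (2 * p + 2) ^ 2 * K ^ 2 *
            (((X q.1 + Z q) ^ (2 * p)).trace + (Z q ^ (2 * p)).trace) := fun q => by
        have := Matrix.IsHermitian.trace_pow_le_linear ((hsymm q.1).add (hsum q.2)) (hsum q.2)
          (K := K) (by simpa using hK q.1) (even_two_mul p)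
        simpa [Z] using this
      have hint := (integral_mono (μ := ν) (i1 (2 * p + 2))
        (((i2 (2 * p + 2)).add (i3.const_mul (2 * p + 2))).add
          (((i1 (2 * p)).add (i2 (2 * p))).const_mul ((2 * p + 2) ^ 2 * K ^ 2))) hpt).trans_eq
        (integral_linear_combination (i2 (2 * p + 2)) i3 (i1 (2 * p)) (i2 (2 * p)) _ _)
      rw [e3, e2, e2, mul_zero, add_zero] at hint
      have ih1 := ih (by omega) (m + 1)
      simp only [Fin.sum_univ_succ] at ih1
      rw [hmain'] at ih1
      have ih2 := ih (by omega) m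
      have e4 : 2 * (p + 1) = 2 * p + 2 := by ring
      rw [e4] at ihm hmain ⊢
      simp only [Fin.sum_univ_succ]
      rw [hmain]
      refine hint.trans ?_
      set a : ℝ := 8 * P ^ 2 * K ^ 2 with ha
      have ha0 : 0 ≤ a := by positivity
      have hpP : ((p : ℝ) + 1) ≤ P := by exact_mod_cast hp
      -- The factor 8 in `a` is 2 · 4: the squared coefficient 2(p + 1) contributes 4, and two
      -- traces of lower order have to be paid for.
      have hcoef : (2 * (p : ℝ) + 2) ^ 2 * K ^ 2 ≤ a / 2 := by
        rw [ha]
        have : ((p : ℝ) + 1) ^ 2 ≤ (P : ℝ) ^ 2 := by gcongr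
        nlinarith [sq_nonneg K, mul_le_mul_of_nonneg_right this (sq_nonneg K)]
      have hm1 : (a * m) ^ p ≤ (a * (m + 1)) ^ p := by gcongr; linarith
      push_cast at ih1
      have hd : (0 : ℝ) ≤ d := by positivity
      have h5 : (2 * (p : ℝ) + 2) ^ 2 * K ^ 2 *
          (∫ q, ((X q.1 + Z q) ^ (2 * p)).trace ∂ν +
            ∫ S : Fin m → Ξ, ((∑ i, X (S i)) ^ (2 * p)).trace ∂(Measure.pi fun _ => μ))
          ≤ a / 2 * (2 * (d * (a * (m + 1)) ^ p)) := by
        have hb : (∫ q, ((X q.1 + Z q) ^ (2 * p)).trace ∂ν +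
            ∫ S : Fin m → Ξ, ((∑ i, X (S i)) ^ (2 * p)).trace ∂(Measure.pi fun _ => μ))
            ≤ 2 * (d * (a * (m + 1)) ^ p) := by
          have := mul_le_mul_of_nonneg_left hm1 hd
          linarith
        calc _ ≤ (2 * (p : ℝ) + 2) ^ 2 * K ^ 2 * (2 * (d * (a * (m + 1)) ^ p)) := by gcongr
          _ ≤ _ := by gcongr
      calc _ ≤ d * (a * m) ^ (p + 1) + a / 2 * (2 * (d * (a * (m + 1)) ^ p)) := add_le_add ihm h5
        _ = d * ((a * m) * (a * m) ^ p + a * (a * (m + 1)) ^ p) := by ring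
        _ ≤ d * ((a * m) * (a * (m + 1)) ^ p + a * (a * (m + 1)) ^ p) := by gcongr
        _ = _ := by push_cast; ring

/-- Markov's inequality for the trace of the power `2 * P`. This one quantity dominates the
quadratic forms at all unit vectors at once, so no net over the sphere is needed. -/
theorem measure_quadraticForm_sum_ge_le (hX : ∀ i j, IsBddMeasurable fun ξ => X ξ i j)
    (hsymm : ∀ ξ, (X ξ).IsHermitian) (h0 : ∀ i j, ∫ ξ, X ξ i j ∂μ = 0)
    (hK : ∀ ξ v, (X ξ *ᵥ v) ⬝ᵥ (X ξ *ᵥ v) ≤ K ^ 2 * (v ⬝ᵥ v)) (P : ℕ) {m : ℕ} (hm : 0 < m)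
    {κ : ℝ} (hκ : 0 < κ) :
    (Measure.pi fun _ : Fin m => μ) {S | ∃ v : Fin d → ℝ, v ⬝ᵥ v = 1 ∧
        m * κ ≤ |v ⬝ᵥ (∑ i, X (S i)) *ᵥ v|}
      ≤ ENNReal.ofReal (d * (8 * P ^ 2 * K ^ 2 / (m * κ ^ 2)) ^ P) := by
  have hm' : (0 : ℝ) < m := by exact_mod_cast hm
  have hsum : ∀ S : Fin m → Ξ, (∑ i, X (S i)).IsHermitian := fun S =>
    isSelfAdjoint_sum _ fun i _ => hsymm (S i)
  have hbm : IsBddMeasurable fun S : Fin m → Ξ => ((∑ i, X (S i)) ^ (2 * P)).trace := by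
    refine IsBddMeasurable.trace (IsBddMeasurable.matrix_pow (fun i j => ?_) _)
    simp only [Matrix.sum_apply]
    exact IsBddMeasurable.sum _ fun k _ => (hX i j).comp (measurable_pi_apply k)
  have hle := integral_trace_sum_pow_le (P := P) hX hsymm h0 hK P le_rfl m
  have hc : 0 < (m * κ) ^ (2 * P) := by positivity
  calc _ ≤ (Measure.pi fun _ : Fin m => μ) {S | ENNReal.ofReal ((m * κ) ^ (2 * P))
        ≤ ENNReal.ofReal ((∑ i, X (S i)) ^ (2 * P)).trace} := by
        refine measure_mono fun S hS => ?_
        obtain ⟨v, hv, h⟩ := hS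
        refine ENNReal.ofReal_le_ofReal ?_
        refine le_trans ?_ ((hsum S).dotProduct_mulVec_pow_le (even_two_mul P) v hv)
        rw [← (even_two_mul P).pow_abs (v ⬝ᵥ (∑ i, X (S i)) *ᵥ v)]
        gcongr
    _ ≤ (∫⁻ S : Fin m → Ξ, ENNReal.ofReal ((∑ i, X (S i)) ^ (2 * P)).trace
        ∂(Measure.pi fun _ => μ)) / ENNReal.ofReal ((m * κ) ^ (2 * P)) :=
        meas_ge_le_lintegral_div hbm.1.ennreal_ofReal.aemeasurable (by simpa using hc)
          ENNReal.ofReal_ne_top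
    _ ≤ ENNReal.ofReal (d * (8 * P ^ 2 * K ^ 2 * m) ^ P) / ENNReal.ofReal ((m * κ) ^ (2 * P)) := by
        gcongr
        rw [← ofReal_integral_eq_lintegral_ofReal (hbm.integrable _)
          (Filter.Eventually.of_forall fun S => (hsum S).trace_pow_nonneg (even_two_mul P))]
        exact ENNReal.ofReal_le_ofReal hle
    _ = _ := by
        rw [← ENNReal.ofReal_div_of_pos hc, pow_mul, mul_div_assoc, ← div_pow]
        congr 3
        field_simp

end

/-! ### Concentration of the Hessian of a mini-batch average -/

section

open Matrix

variable {d : ℕ}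

theorem inner_eq_dotProduct_toEuclideanCLM_symm (T : Vec d →L[ℝ] Vec d) (v w : Vec d) :
    ⟪v, T w⟫ = v.ofLp ⬝ᵥ ((toEuclideanCLM (n := Fin d) (𝕜 := ℝ)).symm T) *ᵥ w.ofLp := by
  obtain ⟨A, rfl⟩ : ∃ A, toEuclideanCLM (n := Fin d) (𝕜 := ℝ) A = T :=
    ⟨_, StarAlgEquiv.apply_symm_apply _ T⟩
  rw [inner_toEuclideanCLM]
  simp

theorem toEuclideanCLM_symm_apply (T : Vec d →L[ℝ] Vec d) (i j : Fin d) :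
    (toEuclideanCLM (n := Fin d) (𝕜 := ℝ)).symm T i j
      = ⟪EuclideanSpace.single i (1 : ℝ), T (EuclideanSpace.single j (1 : ℝ))⟫ := by
  rw [inner_eq_dotProduct_toEuclideanCLM_symm]
  simp

theorem dotProduct_self_toEuclideanCLM_symm_le (T : Vec d →L[ℝ] Vec d) {K : ℝ} (hT : ‖T‖ ≤ K)
    (v : Fin d → ℝ) : (((toEuclideanCLM (n := Fin d) (𝕜 := ℝ)).symm T) *ᵥ v) ⬝ᵥ
      (((toEuclideanCLM (n := Fin d) (𝕜 := ℝ)).symm T) *ᵥ v) ≤ K ^ 2 * (v ⬝ᵥ v) := by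
  obtain ⟨A, rfl⟩ : ∃ A, toEuclideanCLM (n := Fin d) (𝕜 := ℝ) A = T :=
    ⟨_, StarAlgEquiv.apply_symm_apply _ T⟩
  have h1 : ∀ w : Vec d, w.ofLp ⬝ᵥ w.ofLp = ‖w‖ ^ 2 := fun w => by
    rw [EuclideanSpace.real_norm_sq_eq]
    simp [dotProduct, sq]
  have h2 := (toEuclideanCLM (n := Fin d) (𝕜 := ℝ) A).le_of_opNorm_le hT (WithLp.toLp 2 v)
  have h3 := h1 (toEuclideanCLM (n := Fin d) (𝕜 := ℝ) A (WithLp.toLp 2 v))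
  rw [ofLp_toEuclideanCLM] at h3
  have h4 := h1 (WithLp.toLp 2 v)
  simp only at h3 h4
  simp only [StarAlgEquiv.symm_apply_apply]
  rw [h3, h4, ← mul_pow]
  gcongr

theorem StandingAssumptions.measure_hess_batchMean_le {Ξ : Type u} [MeasurableSpace Ξ]
    {μ : Measure Ξ} [IsProbabilityMeasure μ] {f : Vec d → Ξ → ℝ} {x₁ : Vec d} {L₁ L₂ G V Δ : ℝ}
    (h : StandingAssumptions μ f x₁ L₁ L₂ G V Δ) (hL : 0 ≤ L₁) (x : Vec d) (P : ℕ) {m : ℕ}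
    (hm : 0 < m) {κ : ℝ} (hκ : 0 < κ) :
    (Measure.pi fun _ : Fin m => μ) {S | ¬ ∀ v : Vec d,
        |⟪v, hess (batchMean f S) x v⟫ - ⟪v, hess (objective μ f) x v⟫| ≤ κ * ‖v‖ ^ 2}
      ≤ ENNReal.ofReal (d * (32 * P ^ 2 * L₁ ^ 2 / (m * κ ^ 2)) ^ P) := by
  let T : Ξ → Vec d →L[ℝ] Vec d := fun ξ =>
    hess (fun y => f y ξ) x - hess (objective μ f) x
  let X : Ξ → Matrix (Fin d) (Fin d) ℝ := fun ξ => (toEuclideanCLM (n := Fin d) (𝕜 := ℝ)).symm (T ξ)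
  have hF := h.isSmooth_objective hL
  have hTn : ∀ ξ, ‖T ξ‖ ≤ 2 * L₁ := fun ξ => (norm_sub_le _ _).trans
    (by linarith [(h.isSmooth ξ).norm_hess_le hL x, hF.norm_hess_le hL x])
  have hTi : Integrable T μ := (h.integrable_hess hL x).sub (integrable_const _)
  have hT0 : ∫ ξ, T ξ ∂μ = 0 := by
    rw [integral_sub (h.integrable_hess hL x) (integrable_const _), h.hess_objective hL]
    simp
  have hXe : ∀ ξ i j, X ξ i j
      = ⟪EuclideanSpace.single i (1 : ℝ), T ξ (EuclideanSpace.single j (1 : ℝ))⟫ :=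
    fun ξ i j => toEuclideanCLM_symm_apply (T ξ) i j
  have hsymm : ∀ ξ, (X ξ).IsHermitian := fun ξ => by
    ext i j
    rw [conjTranspose_apply, hXe, hXe, star_trivial, real_inner_comm]
    simp only [T, _root_.sub_apply, inner_sub_left, inner_sub_right,
      (h.isSmooth ξ).hess_symm, hF.hess_symm]
  have hX : ∀ i j, IsBddMeasurable fun ξ => X ξ i j := fun i j => by
    simp only [hXe]
    refine ⟨?_, 2 * L₁, fun ξ => ?_⟩
    · exact Measurable.const_inner ((h.measurable_hess_apply x _).sub measurable_const)
    · refine (abs_real_inner_le_norm _ _).trans ?_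
      have := (T ξ).le_of_opNorm_le (hTn ξ) (EuclideanSpace.single j (1 : ℝ))
      simpa using this
  have h0 : ∀ i j, ∫ ξ, X ξ i j ∂μ = 0 := fun i j => by
    simp only [hXe]
    rw [integral_inner (hTi.apply_continuousLinearMap _),
      ← ContinuousLinearMap.integral_apply hTi, hT0]
    simp
  -- Both Hessians have norm at most `L₁`, so their difference is bounded by `2 * L₁`; this turns
  -- the constant 8 into 32.
  have key := measure_quadraticForm_sum_ge_le (K := 2 * L₁) hX hsymm h0
    (fun ξ v => dotProduct_self_toEuclideanCLM_symm_le (T ξ) (hTn ξ) v) P hm hκ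
  have e : (8 * (P : ℝ) ^ 2 * (2 * L₁) ^ 2) = 32 * P ^ 2 * L₁ ^ 2 := by ring
  rw [e] at key
  refine le_trans (measure_mono fun S hS => ?_) key
  have hm' : (0 : ℝ) < m := by exact_mod_cast hm
  simp only [Set.mem_ofPred_eq, not_forall, not_le] at hS ⊢
  obtain ⟨v, hv⟩ := hS
  have hv0 : 0 < ‖v‖ := by
    refine norm_pos_iff.2 fun h0 => ?_
    simp [h0] at hv
  refine ⟨(‖v‖⁻¹ • v).ofLp, ?_, ?_⟩
  · have : (‖v‖⁻¹ • v).ofLp ⬝ᵥ (‖v‖⁻¹ • v).ofLp = ‖(‖v‖⁻¹ • v)‖ ^ 2 := by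
      rw [EuclideanSpace.real_norm_sq_eq]
      simp [dotProduct, sq]
    rw [this, norm_smul, norm_inv, norm_norm, inv_mul_cancel₀ hv0.ne', one_pow]
  · have e1 : ∑ i, X (S i) = (toEuclideanCLM (n := Fin d) (𝕜 := ℝ)).symm (∑ i, T (S i)) := by
      rw [map_sum]
    have e2 : ∑ i, T (S i) = (m : ℝ) • (hess (batchMean f S) x - hess (objective μ f) x) := by
      have := (hess_batchMean h.isSmooth S x).fderiv
      rw [hess, this, smul_sub, smul_smul, mul_inv_cancel₀ hm'.ne', one_smul]
      simp only [T, Finset.sum_sub_distrib, Finset.sum_const, Finset.card_univ, Fintype.card_fin]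
      rw [Nat.cast_smul_eq_nsmul]
    rw [e1, ← inner_eq_dotProduct_toEuclideanCLM_symm, e2]
    rw [← inner_sub_right] at hv
    simp only [_root_.smul_apply, _root_.sub_apply, map_smul,
      inner_smul_left, inner_smul_right, abs_mul, conj_trivial, abs_inv, abs_norm, Nat.abs_cast]
    have e3 : ‖v‖⁻¹ * (κ * ‖v‖ ^ 2 * ‖v‖⁻¹) = κ := by field_simp
    calc m * κ = m * (‖v‖⁻¹ * (κ * ‖v‖ ^ 2 * ‖v‖⁻¹)) := by rw [e3]
      _ ≤ m * (‖v‖⁻¹ * (|⟪v, hess (batchMean f S) x v - hess (objective μ f) x v⟫| * ‖v‖⁻¹)) := by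
          gcongr
      _ = _ := by ring

end

/-! ### Accelerated gradient descent near a saddle point -/

/-- The shifted function `ĝ_x(u) = g(x + u) - g(x) - ∇g(x)ᵀu`. -/
noncomputable def ghat {d : ℕ} (g : Vec d → ℝ) (x u : Vec d) : ℝ :=
  g (x + u) - g x - ⟪gradient g x, u⟫

/-- The gradient of `ĝ_x`. -/
noncomputable def ghatGrad {d : ℕ} (g : Vec d → ℝ) (x u : Vec d) : Vec d :=
  gradient g (x + u) - gradient g x

/-- The iterates `(y_k, u_k)` of Nesterov's method on `ĝ_x`; with momentum `ζ = 0` this is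
gradient descent. -/
noncomputable def agdSeq {d : ℕ} (g : Vec d → ℝ) (x : Vec d) (η ζ : ℝ) (u₀ : Vec d) : ℕ → Vec d × Vec d
  | 0 => (u₀, u₀)
  | k + 1 =>
      let s := agdSeq g x η ζ u₀ k
      let y' := s.2 - η • ghatGrad g x s.2
      (y', y' + ζ • (y' - s.1))

/-- The negative-curvature certificate of NEON⁺ at `(y, u)`. -/
def IsCertificate {d : ℕ} (g : Vec d → ℝ) (x : Vec d) (γ : ℝ) (p : Vec d × Vec d) : Prop :=
  ghat g x p.1 - ghat g x p.2 - ⟪ghatGrad g x p.2, p.1 - p.2⟫ < -(γ / 2) * ‖p.1 - p.2‖ ^ 2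

namespace IsSmooth

variable {d : ℕ} {g : Vec d → ℝ} {L₁ L₂ : ℝ}

theorem norm_ghatGrad_le (hg : IsSmooth g L₁ L₂) (x u : Vec d) :
    ‖ghatGrad g x u‖ ≤ L₁ * ‖u‖ := by
  simpa [ghatGrad] using hg.lipschitz_gradient (x + u) x

theorem ghat_add_le (hg : IsSmooth g L₁ L₂) (x u v : Vec d) :
    ghat g x (u + v) ≤ ghat g x u + ⟪ghatGrad g x u, v⟫ + L₁ / 2 * ‖v‖ ^ 2 := by
  have := hg.le_quadratic (x + u) v
  simp only [ghat, ghatGrad, inner_add_right, inner_sub_left, ← add_assoc]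
  linarith

theorem ghat_le (hg : IsSmooth g L₁ L₂) (x u : Vec d) : ghat g x u ≤ L₁ / 2 * ‖u‖ ^ 2 := by
  have := hg.le_quadratic x u
  simp only [ghat]
  linarith

theorem inner_hess_le_ghat (hg : IsSmooth g L₁ L₂) (hL : 0 ≤ L₂) (x u : Vec d) :
    ⟪u, hess g x u⟫ ≤ 2 * ghat g x u + 2 * L₂ * ‖u‖ ^ 3 := by
  have := (abs_le.1 (hg.abs_sub_quadratic_le hL x u)).1
  simp only [ghat]
  linarith

/-- Taylor expansion at `x + u` turns the certificate into negative curvature there; moving the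
Hessian back to `x` costs `L₂ * ‖u‖`. -/
theorem inner_hess_le_of_isCertificate (hg : IsSmooth g L₁ L₂) (hL : 0 ≤ L₂) {x : Vec d} {γ : ℝ}
    {p : Vec d × Vec d} (h : IsCertificate g x γ p) :
    ⟪p.1 - p.2, hess g x (p.1 - p.2)⟫
      ≤ (-γ + L₂ * ‖p.2‖ + 2 * L₂ * ‖p.1 - p.2‖) * ‖p.1 - p.2‖ ^ 2 := by
  obtain ⟨y, u⟩ := p
  simp only [IsCertificate] at h
  set w := y - u with hw
  have hy : y = u + w := by rw [hw]; abel
  have h1 := (abs_le.1 (hg.abs_sub_quadratic_le hL (x + u) w)).1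
  have h2 : ⟪w, hess g x w⟫ ≤ ⟪w, hess g (x + u) w⟫ + L₂ * ‖u‖ * ‖w‖ ^ 2 := by
    have e : ⟪w, hess g x w⟫ - ⟪w, hess g (x + u) w⟫ = ⟪w, (hess g x - hess g (x + u)) w⟫ := by
      simp [inner_sub_right]
    have h3 := hg.lipschitz_hessian x (x + u)
    rw [sub_add_cancel_left, norm_neg] at h3
    have h4 := (hess g x - hess g (x + u)).le_of_opNorm_le h3 w
    have h5 := real_inner_le_norm w ((hess g x - hess g (x + u)) w)
    have h6 := mul_le_mul_of_nonneg_left h4 (norm_nonneg w)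
    nlinarith
  rw [hy, ghat, ghat, ghatGrad, inner_add_right, inner_sub_left, ← add_assoc] at h
  nlinarith

theorem not_isCertificate_self (x : Vec d) (γ : ℝ) (u : Vec d) : ¬ IsCertificate g x γ (u, u) := by
  simp [IsCertificate]

/-- The absence of a certificate is a weak convexity inequality between `y` and `u`. Added to the
descent inequality at `u`, it cancels the inner products in the expansion of the squared step, and
`η * L₁ ≤ 1` takes care of the squared gradient. -/
theorem energy_step (hg : IsSmooth g L₁ L₂) {η γ : ℝ} (hη : 0 < η) (hηL : η * L₁ ≤ 1) {x : Vec d}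
    {p : Vec d × Vec d} (h : ¬ IsCertificate g x γ p) :
    2 * η * ghat g x (p.2 - η • ghatGrad g x p.2) + ‖p.2 - η • ghatGrad g x p.2 - p.1‖ ^ 2
      ≤ 2 * η * ghat g x p.1 + (1 + η * γ) * ‖p.1 - p.2‖ ^ 2 := by
  obtain ⟨y, u⟩ := p
  simp only [IsCertificate, not_lt] at h ⊢
  set D := ghatGrad g x u
  have h1 := hg.ghat_add_le x u (-(η • D))
  rw [← sub_eq_add_neg, inner_neg_right, inner_smul_right, real_inner_self_eq_norm_sq, norm_neg,
    norm_smul, Real.norm_of_nonneg hη.le] at h1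
  have e : ‖u - η • D - y‖ ^ 2 = ‖y - u‖ ^ 2 + 2 * η * ⟪D, y - u⟫ + η ^ 2 * ‖D‖ ^ 2 := by
    have : u - η • D - y = -((y - u) + η • D) := by abel
    rw [this, norm_neg, norm_add_sq_real, inner_smul_right, norm_smul, Real.norm_of_nonneg hη.le,
      real_inner_comm]
    ring
  have h2 : L₁ / 2 * (η * ‖D‖) ^ 2 ≤ η / 2 * ‖D‖ ^ 2 := by
    have := mul_le_mul_of_nonneg_right hηL (show 0 ≤ η / 2 * ‖D‖ ^ 2 by positivity)
    nlinarith
  rw [e]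
  nlinarith

end IsSmooth

section AGD

variable {d : ℕ} {g : Vec d → ℝ} {L₁ L₂ : ℝ} {x : Vec d} {η ζ : ℝ} {u₀ : Vec d}

theorem agdSeq_succ_fst (k : ℕ) : (agdSeq g x η ζ u₀ (k + 1)).1
    = (agdSeq g x η ζ u₀ k).2 - η • ghatGrad g x (agdSeq g x η ζ u₀ k).2 := rfl

theorem agdSeq_snd (k : ℕ) : (agdSeq g x η ζ u₀ k).2 = (agdSeq g x η ζ u₀ k).1
    + ζ • ((agdSeq g x η ζ u₀ k).1 - (agdSeq g x η ζ u₀ (k - 1)).1) := by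
  cases k with
  | zero => simp [agdSeq]
  | succ k => rfl

theorem norm_agdSeq_sub (hζ : 0 ≤ ζ) (k : ℕ) :
    ‖(agdSeq g x η ζ u₀ k).1 - (agdSeq g x η ζ u₀ k).2‖
      = ζ * ‖(agdSeq g x η ζ u₀ k).1 - (agdSeq g x η ζ u₀ (k - 1)).1‖ := by
  rw [agdSeq_snd k, sub_add_cancel_left, norm_neg, norm_smul, Real.norm_of_nonneg hζ]

theorem norm_agdSeq_succ_le (hg : IsSmooth g L₁ L₂) (hη : 0 < η) (hηL : η * L₁ ≤ 1) (k : ℕ) :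
    ‖(agdSeq g x η ζ u₀ (k + 1)).1‖ ≤ 2 * ‖(agdSeq g x η ζ u₀ k).2‖ := by
  rw [agdSeq_succ_fst]
  refine (norm_sub_le _ _).trans ?_
  rw [norm_smul, Real.norm_of_nonneg hη.le]
  have h1 := mul_le_mul_of_nonneg_left (hg.norm_ghatGrad_le x (agdSeq g x η ζ u₀ k).2) hη.le
  have h2 := mul_le_mul_of_nonneg_right hηL (norm_nonneg (agdSeq g x η ζ u₀ k).2)
  linarith

/-- Momentum makes `‖y - u‖` equal to `ζ` times the previous step, so each iteration dissipates at
least `θ` times the square of that step. At index 0 truncated subtraction makes the previous step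
zero, in accordance with `u₀ = y₀`. -/
theorem agdSeq_energy (hg : IsSmooth g L₁ L₂) (hη : 0 < η) (hηL : η * L₁ ≤ 1) (hζ : 0 ≤ ζ)
    {γ θ : ℝ} (hθ : ζ ^ 2 * (1 + η * γ) ≤ 1 - θ) (k : ℕ)
    (h : ∀ i < k, ¬ IsCertificate g x γ (agdSeq g x η ζ u₀ i)) :
    2 * η * ghat g x (agdSeq g x η ζ u₀ k).1
      + ‖(agdSeq g x η ζ u₀ k).1 - (agdSeq g x η ζ u₀ (k - 1)).1‖ ^ 2
      + θ * ∑ i ∈ Finset.range k,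
        ‖(agdSeq g x η ζ u₀ i).1 - (agdSeq g x η ζ u₀ (i - 1)).1‖ ^ 2
      ≤ 2 * η * ghat g x u₀ := by
  induction k with
  | zero => simp [agdSeq]
  | succ k ih =>
    have h1 := ih fun i hi => h i (by omega)
    have h2 := hg.energy_step hη hηL (h k (by omega))
    rw [norm_agdSeq_sub hζ, ← agdSeq_succ_fst] at h2
    have h3 := mul_le_mul_of_nonneg_right hθ
      (sq_nonneg ‖(agdSeq g x η ζ u₀ k).1 - (agdSeq g x η ζ u₀ (k - 1)).1‖)
    rw [Finset.sum_range_succ, Nat.add_sub_cancel]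
    nlinarith

theorem agdSeq_dist_sq_le (k : ℕ) : ‖(agdSeq g x η ζ u₀ k).1 - u₀‖ ^ 2
    ≤ k * ∑ i ∈ Finset.range (k + 1),
      ‖(agdSeq g x η ζ u₀ i).1 - (agdSeq g x η ζ u₀ (i - 1)).1‖ ^ 2 := by
  have e : (agdSeq g x η ζ u₀ k).1 - u₀ = ∑ i ∈ Finset.range k,
      ((agdSeq g x η ζ u₀ (i + 1)).1 - (agdSeq g x η ζ u₀ i).1) := by
    rw [Finset.sum_range_sub fun i => (agdSeq g x η ζ u₀ i).1]
    rfl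
  rw [Finset.sum_range_succ', e]
  have h1 := norm_sum_le (Finset.range k) fun i =>
    ((agdSeq g x η ζ u₀ (i + 1)).1 - (agdSeq g x η ζ u₀ i).1)
  have h2 := sq_sum_le_card_mul_sum_sq (s := Finset.range k) (f := fun i =>
    ‖(agdSeq g x η ζ u₀ (i + 1)).1 - (agdSeq g x η ζ u₀ i).1‖)
  rw [Finset.card_range] at h2
  simpa using (pow_le_pow_left₀ (norm_nonneg _) h1 2).trans h2

/-- Improve or localize: an iterate that has moved far has a small value of `ĝ`. -/
theorem ghat_agdSeq_le (hg : IsSmooth g L₁ L₂) (hη : 0 < η) (hηL : η * L₁ ≤ 1) (hζ : 0 ≤ ζ)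
    {γ θ : ℝ} (hθ : ζ ^ 2 * (1 + η * γ) ≤ 1 - θ) (hθ0 : 0 ≤ θ) (hθ1 : θ ≤ 1) {k T : ℕ} (hkT : k ≤ T)
    (h : ∀ i < k, ¬ IsCertificate g x γ (agdSeq g x η ζ u₀ i)) {ρ F : ℝ} (hρ : 0 < ρ)
    (hu : ‖u₀‖ ≤ ρ / 2) (hk : ρ ≤ ‖(agdSeq g x η ζ u₀ k).1‖) (hL : L₁ * ‖u₀‖ ^ 2 ≤ 2 * F)
    (hF : 28 * η * F * T ≤ θ * ρ ^ 2) : ghat g x (agdSeq g x η ζ u₀ k).1 ≤ -(5 / 2 * F) := by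
  have h1 := agdSeq_energy hg hη hηL hζ hθ k h
  have h2 := agdSeq_dist_sq_le (g := g) (x := x) (η := η) (ζ := ζ) (u₀ := u₀) k
  rw [Finset.sum_range_succ] at h2
  have hS0 : 0 ≤ ∑ i ∈ Finset.range k,
      ‖(agdSeq g x η ζ u₀ i).1 - (agdSeq g x η ζ u₀ (i - 1)).1‖ ^ 2 :=
    Finset.sum_nonneg fun i _ => by positivity
  have hD0 : 0 ≤ ‖(agdSeq g x η ζ u₀ k).1 - (agdSeq g x η ζ u₀ (k - 1)).1‖ ^ 2 := by positivity
  have h3 : ρ / 2 ≤ ‖(agdSeq g x η ζ u₀ k).1 - u₀‖ := by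
    have := norm_sub_norm_le (agdSeq g x η ζ u₀ k).1 u₀
    linarith
  have h5 := hg.ghat_le x u₀
  generalize ∑ i ∈ Finset.range k,
    ‖(agdSeq g x η ζ u₀ i).1 - (agdSeq g x η ζ u₀ (i - 1)).1‖ ^ 2 = S at h1 h2 hS0
  generalize ‖(agdSeq g x η ζ u₀ k).1 - (agdSeq g x η ζ u₀ (k - 1)).1‖ ^ 2 = D at h1 h2 hD0
  generalize ‖(agdSeq g x η ζ u₀ k).1 - u₀‖ = N at h2 h3
  generalize ghat g x (agdSeq g x η ζ u₀ k).1 = y at h1 ⊢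
  have h4 : (ρ / 2) ^ 2 ≤ T * (S + D) := by
    refine (pow_le_pow_left₀ (by positivity) h3 2).trans (h2.trans ?_)
    have : (k : ℝ) ≤ T := by exact_mod_cast hkT
    gcongr
  have hT : (0 : ℝ) < T := by
    rcases Nat.eq_zero_or_pos T with h0 | h0
    · rw [h0, Nat.cast_zero, zero_mul] at h4
      nlinarith
    · exact_mod_cast h0
  -- The displacement ρ/2 explains 28 = 4 · 7. The energy starts at most at 2ηF, and 7 - 2 = 5
  -- leaves 2ηĝ ≤ -5ηF.
  have h6 : 7 * η * F ≤ θ * (S + D) := by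
    have : 7 * η * F * T ≤ θ * (S + D) * T := by
      have := mul_le_mul_of_nonneg_left h4 hθ0
      nlinarith
    exact le_of_mul_le_mul_right this hT
  have h7 : θ * D ≤ D := mul_le_of_le_one_left hD0 hθ1
  have h8 : 2 * η * y ≤ 2 * η * (-(5 / 2 * F)) := by
    have := mul_le_mul_of_nonneg_left h5 (show 0 ≤ 2 * η by positivity)
    have := mul_le_mul_of_nonneg_left hL (show 0 ≤ η by positivity)
    nlinarith
  exact le_of_mul_le_mul_left h8 (by positivity)

end AGD

/-! ### Escaping along an eigenvector -/

theorem linear_growth {a : ℕ → ℝ} {α φ ψ q : ℝ} {T : ℕ} (hα : 0 < α) (h0 : α ≤ a 0) (hψ : 0 ≤ ψ)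
    (hφ : ψ ≤ φ) (hq : q ≤ ψ * α / 2)
    (ha : ∀ k < T, (1 + φ) * a k - q ≤ a (k + 1)) {k : ℕ} (hk : k ≤ T) :
    (1 + ψ / 2) ^ k * α ≤ a k := by
  induction k with
  | zero => simpa using h0
  | succ k ih =>
    have h1 := ih (by omega)
    have h2 := ha k (by omega)
    have h3 : α ≤ a k := le_trans (le_mul_of_one_le_left hα.le (one_le_pow₀ (by linarith))) h1
    have h4 : (1 + ψ / 2) * a k ≤ (1 + φ) * a k - q := by nlinarith
    calc (1 + ψ / 2) ^ (k + 1) * α = (1 + ψ / 2) * ((1 + ψ / 2) ^ k * α) := by ring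
      _ ≤ (1 + ψ / 2) * a k := by gcongr
      _ ≤ _ := h4.trans h2

/-- The potential is the momentum b - a plus 3θ times the position a. Its new value is (1 + 2θ)(aₖ₊₁
- aₖ) + 3θaₖ, and aₖ₊₁ - aₖ is at least bₖ - aₖ + (ψ/2)aₖ. The gain 3θ²a required for growth by 1 +
θ is covered by `6 * θ ^ 2 ≤ ψ`, so the rate is of order √ψ instead of ψ. -/
theorem accelerated_growth {a b : ℕ → ℝ} {α φ ψ θ q : ℝ} {T : ℕ} (hα : 0 < α) (h0 : α ≤ a 0)
    (hb0 : b 0 = a 0) (hφ : ψ ≤ φ) (hq : q ≤ ψ * α / 2) (hθ : 0 < θ) (hθ1 : θ ≤ 1)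
    (hθψ : 6 * θ ^ 2 ≤ ψ) (ha : ∀ k < T, (1 + φ) * b k - q ≤ a (k + 1))
    (hb : ∀ k < T, b (k + 1) = a (k + 1) + (1 - θ) * (a (k + 1) - a k)) {k : ℕ} (hk : k ≤ T) :
    (1 + θ) ^ k * (3 * θ * α) ≤ b k - a k + 3 * θ * a k := by
  have hψ : 0 ≤ ψ := le_trans (by positivity) hθψ
  suffices α ≤ a k ∧ a k ≤ b k ∧ (1 + θ) ^ k * (3 * θ * α) ≤ b k - a k + 3 * θ * a k from this.2.2
  induction k with
  | zero =>
    refine ⟨h0, hb0.ge, ?_⟩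
    rw [hb0, pow_zero, one_mul, sub_self, zero_add]
    gcongr
  | succ k ih =>
    obtain ⟨h1, h2, h3⟩ := ih (by omega)
    have h4 := ha k (by omega)
    have h5 := hb k (by omega)
    have h6 : b k - a k + ψ / 2 * a k ≤ a (k + 1) - a k := by nlinarith
    have h7 : 0 ≤ ψ / 2 * a k := mul_nonneg (by linarith) (by linarith)
    refine ⟨by linarith, ?_, ?_⟩
    · rw [h5]
      have : 0 ≤ (1 - θ) * (a (k + 1) - a k) := mul_nonneg (by linarith) (by linarith)
      linarith
    · have h8 : (1 + 2 * θ) * (b k - a k + ψ / 2 * a k) ≤ (1 + 2 * θ) * (a (k + 1) - a k) :=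
        mul_le_mul_of_nonneg_left h6 (by linarith)
      have h9 : (1 + θ) * (b k - a k) ≤ (1 + 2 * θ) * (b k - a k) :=
        mul_le_mul_of_nonneg_right (by linarith) (by linarith)
      have h10 : 3 * θ ^ 2 * a k ≤ (1 + 2 * θ) * (ψ / 2 * a k) := by
        have : 3 * θ ^ 2 * a k ≤ ψ / 2 * a k := mul_le_mul_of_nonneg_right (by linarith) (by linarith)
        nlinarith
      calc (1 + θ) ^ (k + 1) * (3 * θ * α) = (1 + θ) * ((1 + θ) ^ k * (3 * θ * α)) := by ring
        _ ≤ (1 + θ) * (b k - a k + 3 * θ * a k) := by gcongr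
        _ ≤ _ := by rw [h5]; linarith

section Escape

variable {d : ℕ} {g : Vec d → ℝ} {L₁ L₂ : ℝ} {x : Vec d} {η ζ : ℝ} {u₀ : Vec d}

theorem norm_agdSeq_snd_le (hζ0 : 0 ≤ ζ) (hζ1 : ζ ≤ 1) {ρ : ℝ} {k : ℕ}
    (h : ∀ i ≤ k, ‖(agdSeq g x η ζ u₀ i).1‖ ≤ ρ) : ‖(agdSeq g x η ζ u₀ k).2‖ ≤ 3 * ρ := by
  rw [agdSeq_snd]
  refine (norm_add_le _ _).trans ?_
  rw [norm_smul, Real.norm_of_nonneg hζ0]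
  have h1 := norm_sub_le (agdSeq g x η ζ u₀ k).1 (agdSeq g x η ζ u₀ (k - 1)).1
  have h2 := h k le_rfl
  have h3 := h (k - 1) (by omega)
  have h4 : ζ * ‖(agdSeq g x η ζ u₀ k).1 - (agdSeq g x η ζ u₀ (k - 1)).1‖ ≤ 1 * (2 * ρ) :=
    mul_le_mul hζ1 (by linarith) (norm_nonneg _) zero_le_one
  linarith

/-- Along the eigenvector the linearized gradient step multiplies by `1 + η * lam`. The Taylor error
of the gradient at distance at most 3ρ gives the 9. -/
theorem inner_agdSeq_succ_ge (hg : IsSmooth g L₁ L₂) (hL : 0 ≤ L₂) (hη : 0 < η) {e : Vec d}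
    (he : ‖e‖ = 1) {lam : ℝ} (hlam : hess g x e = (-lam) • e) {ρ : ℝ} {k : ℕ}
    (hu : ‖(agdSeq g x η ζ u₀ k).2‖ ≤ 3 * ρ) :
    (1 + η * lam) * ⟪e, (agdSeq g x η ζ u₀ k).2⟫ - η * (9 * L₂ * ρ ^ 2)
      ≤ ⟪e, (agdSeq g x η ζ u₀ (k + 1)).1⟫ := by
  rw [agdSeq_succ_fst, inner_sub_right, inner_smul_right]
  set u := (agdSeq g x η ζ u₀ k).2
  have h1 := hg.gradient_sub_le hL x u
  have h2 := real_inner_le_norm e (ghatGrad g x u - hess g x u)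
  rw [he, one_mul, inner_sub_right, ← hg.hess_symm, hlam, inner_smul_left] at h2
  simp only [conj_trivial] at h2
  have h3 : ‖u‖ ^ 2 ≤ (3 * ρ) ^ 2 := by gcongr
  have h4 := mul_le_mul_of_nonneg_left h3 hL
  have h5 : ⟪e, ghatGrad g x u⟫ ≤ -lam * ⟪e, u⟫ + 9 * L₂ * ρ ^ 2 := by
    have : ‖ghatGrad g x u - hess g x u‖ ≤ L₂ * ‖u‖ ^ 2 := h1
    linarith
  have h6 := mul_le_mul_of_nonneg_left h5 hη.le
  linarith

/-- A unit eigenvector for the eigenvalue `-lam`, along which the noise is at least `α`. -/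
structure IsEscapeDirection (g : Vec d → ℝ) (x u₀ e : Vec d) (lam α : ℝ) : Prop where
  norm_eq : ‖e‖ = 1
  hess_eq : hess g x e = (-lam) • e
  le_inner : α ≤ ⟪e, u₀⟫

theorem exists_norm_gt_gd (hg : IsSmooth g L₁ L₂) (hL : 0 ≤ L₂) (hη : 0 < η) {e : Vec d}
    {lam α γ ρ : ℝ} (he : IsEscapeDirection g x u₀ e lam α) (hγ : 0 ≤ γ) (hγlam : γ ≤ lam)
    (hα : 0 < α) (hρ : 18 * L₂ * ρ ^ 2 ≤ γ * α) {T : ℕ}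
    (hT : ρ < (1 + η * γ / 2) ^ T * α) : ∃ k ≤ T, ρ < ‖(agdSeq g x η 0 u₀ k).1‖ := by
  by_contra! hcon
  have hsnd : ∀ k, (agdSeq g x η 0 u₀ k).2 = (agdSeq g x η 0 u₀ k).1 := fun k => by
    rw [agdSeq_snd k, zero_smul, add_zero]
  have := linear_growth (a := fun k => ⟪e, (agdSeq g x η 0 u₀ k).1⟫) (T := T)
    (q := η * (9 * L₂ * ρ ^ 2)) (φ := η * lam) (ψ := η * γ) hα he.le_inner (by positivity)
    (by gcongr) (by nlinarith) (fun k hk => by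
      have := inner_agdSeq_succ_ge (ζ := 0) (u₀ := u₀) hg hL hη he.norm_eq he.hess_eq (k := k)
        (norm_agdSeq_snd_le le_rfl zero_le_one fun i hi => hcon i (by omega))
      rwa [hsnd] at this) le_rfl
  have h2 := real_inner_le_norm e (agdSeq g x η 0 u₀ T).1
  rw [he.norm_eq, one_mul] at h2
  linarith [hcon T le_rfl]

/-- If all iterates stayed in the ball of radius ρ, the Taylor errors would be at most half of the
growth, by `hρ`. The growth potential would then exceed 3ρ, while confinement bounds its momentum
part by 2ρ and, as `θ ≤ 1 / 3`, its position part by ρ. -/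
theorem exists_norm_gt_agd (hg : IsSmooth g L₁ L₂) (hL : 0 ≤ L₂) (hη : 0 < η) {e : Vec d}
    {lam α γ ρ θ : ℝ} (he : IsEscapeDirection g x u₀ e lam α) (hγlam : γ ≤ lam)
    (hα : 0 < α) (hρ : 18 * L₂ * ρ ^ 2 ≤ γ * α) (hθ : 0 < θ) (hθ1 : θ ≤ 1 / 3)
    (hθγ : 6 * θ ^ 2 ≤ η * γ) {T : ℕ} (hT : ρ < (1 + θ) ^ T * (θ * α)) :
    ∃ k ≤ T, ρ < ‖(agdSeq g x η (1 - θ) u₀ k).1‖ := by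
  by_contra! hcon
  have hinner : ∀ v : Vec d, ⟪e, v⟫ ≤ ‖v‖ := fun v => by
    simpa [he.norm_eq] using real_inner_le_norm e v
  have := accelerated_growth (a := fun k => ⟪e, (agdSeq g x η (1 - θ) u₀ k).1⟫)
    (b := fun k => ⟪e, (agdSeq g x η (1 - θ) u₀ k).2⟫) (T := T)
    (q := η * (9 * L₂ * ρ ^ 2)) (φ := η * lam) (ψ := η * γ) hα he.le_inner rfl
    (by gcongr) (by nlinarith) hθ (by linarith) hθγ (fun k hk =>
      inner_agdSeq_succ_ge hg hL hη he.norm_eq he.hess_eq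
        (norm_agdSeq_snd_le (by linarith) (by linarith) fun i hi => hcon i (by omega)))
    (fun k hk => by
      rw [agdSeq_snd (k + 1), Nat.add_sub_cancel, inner_add_right, inner_smul_right,
        inner_sub_right]) le_rfl
  have h1 := hcon T le_rfl
  have h2 := hcon (T - 1) (by omega)
  have h3 : ⟪e, (agdSeq g x η (1 - θ) u₀ T).2⟫ - ⟪e, (agdSeq g x η (1 - θ) u₀ T).1⟫ ≤ 2 * ρ := by
    rw [← inner_sub_right, agdSeq_snd T, add_sub_cancel_left]
    refine (hinner _).trans ?_
    rw [norm_smul, Real.norm_of_nonneg (by linarith)]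
    have := norm_sub_le (agdSeq g x η (1 - θ) u₀ T).1 (agdSeq g x η (1 - θ) u₀ (T - 1)).1
    nlinarith [norm_nonneg ((agdSeq g x η (1 - θ) u₀ T).1 - (agdSeq g x η (1 - θ) u₀ (T - 1)).1)]
  have h4 := hinner (agdSeq g x η (1 - θ) u₀ T).1
  have h5 : 3 * θ * ⟪e, (agdSeq g x η (1 - θ) u₀ T).1⟫ ≤ ρ := by
    have h0 := norm_nonneg (agdSeq g x η (1 - θ) u₀ T).1
    nlinarith
  linarith

end Escape

/-! ### Results and costs of programs -/

namespace IFOProg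

variable {d : ℕ} {Ξ : Type u} {α β : Type} (f : Vec d → Ξ → ℝ)

theorem run_bind (P : IFOProg (Vec d) Ξ α) (k : α → IFOProg (Vec d) Ξ β) :
    (P >>= k).run f = (((k (P.result f)).result f), P.cost f + (k (P.result f)).cost f) := by
  induction P with
  | done a => simp [Bind.bind, IFOProg.bind, result, cost, run]
  | query x ξ next ih =>
    have := ih (f x ξ, sampleGrad f x ξ)
    simp only [Bind.bind] at this
    simp only [Bind.bind, IFOProg.bind, run, this, result, cost]
    rw [Nat.add_right_comm]

@[simp] theorem result_bind (P : IFOProg (Vec d) Ξ α) (k : α → IFOProg (Vec d) Ξ β) :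
    (P >>= k).result f = (k (P.result f)).result f := by
  rw [result, run_bind]

@[simp] theorem cost_bind (P : IFOProg (Vec d) Ξ α) (k : α → IFOProg (Vec d) Ξ β) :
    (P >>= k).cost f = P.cost f + (k (P.result f)).cost f := by
  rw [cost, run_bind]

@[simp] theorem result_pure (a : α) : (pure a : IFOProg (Vec d) Ξ α).result f = a := rfl

@[simp] theorem cost_pure (a : α) : (pure a : IFOProg (Vec d) Ξ α).cost f = 0 := rfl

@[simp] theorem result_query (x : Vec d) (ξ : Ξ) (next : ℝ × Vec d → IFOProg (Vec d) Ξ α) :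
    (query x ξ next).result f = (next (f x ξ, sampleGrad f x ξ)).result f := rfl

@[simp] theorem cost_query (x : Vec d) (ξ : Ξ) (next : ℝ × Vec d → IFOProg (Vec d) Ξ α) :
    (query x ξ next).cost f = (next (f x ξ, sampleGrad f x ξ)).cost f + 1 := rfl

end IFOProg

section Programs

variable {d : ℕ} {Ξ : Type u} (f : Vec d → Ξ → ℝ)

theorem batchSum_result (x : Vec d) (l : List Ξ) : (batchSum x l).result f
    = ((l.map (f x)).sum, (l.map (sampleGrad f x)).sum) := by
  induction l with
  | nil => simp [batchSum]
  | cons ξ l ih => simp [batchSum, ih]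

theorem batchSum_cost (x : Vec d) (l : List Ξ) : (batchSum x l).cost f = l.length := by
  induction l with
  | nil => simp [batchSum]
  | cons ξ l ih => simp [batchSum, ih]

@[simp] theorem evalBatch_result {m : ℕ} (S : Fin m → Ξ) (x : Vec d) :
    (evalBatch S x).result f = (batchMean f S x, batchGrad f S x) := by
  simp [evalBatch, batchSum_result, batchMean, batchGrad, List.map_ofFn, List.sum_ofFn]

@[simp] theorem evalBatch_cost {m : ℕ} (S : Fin m → Ξ) (x : Vec d) :
    (evalBatch S x).cost f = m := by
  simp [evalBatch, batchSum_cost]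

@[simp] theorem evalHat_cost {m : ℕ} (S : Fin m → Ξ) (x : Vec d) (base : ℝ × Vec d) (u : Vec d) :
    (evalHat S x base u).cost f = m := by
  simp [evalHat]

theorem neonLoop_cost {m : ℕ} (S : Fin m → Ξ) (x : Vec d) (base : ℝ × Vec d) (η : ℝ) (k : ℕ)
    (u : Vec d) : (neonLoop S x base η k u).cost f = (k + 1) * m := by
  induction k generalizing u with
  | zero => simp [neonLoop]
  | succ k ih => simp [neonLoop, ih]; ring

theorem neonPlusLoop_cost {m : ℕ} (q : NeonParams) (γ : ℝ) (S : Fin m → Ξ) (x : Vec d)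
    (base : ℝ × Vec d) (k : ℕ) (hist : List ((Vec d × Vec d) × ℝ)) (y u : Vec d) :
    (neonPlusLoop q γ S x base k hist y u).cost f ≤ (2 * k + 1) * m := by
  induction k generalizing hist y u with
  | zero => simp [neonPlusLoop]
  | succ k ih =>
    simp only [neonPlusLoop, IFOProg.cost_bind, evalHat_cost]
    split_ifs
    · simp only [IFOProg.cost_pure]
      nlinarith
    · have := ih (hist ++ [((y, u), ((evalHat S x base y).result f).1)])
        (u - q.η • ((evalHat S x base u).result f).2)
        (u - q.η • ((evalHat S x base u).result f).2
          + q.ζ • (u - q.η • ((evalHat S x base u).result f).2 - y))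
      nlinarith

theorem neonProc_cost_le (v : NeonVariant) {m : ℕ} (q : NeonParams) (γ : ℝ) (S : Fin m → Ξ)
    (x u₀ : Vec d) : (neonProc v q γ S x u₀).cost f ≤ (2 * q.t + 4) * m := by
  cases v with
  | neon =>
    simp only [neonProc, neonGD, IFOProg.cost_bind, evalBatch_cost, neonLoop_cost,
      IFOProg.cost_pure]
    nlinarith [Nat.zero_le (q.t * m)]
  | neonPlus =>
    simp only [neonProc, neonAGD, IFOProg.cost_bind, evalBatch_cost]
    -- There are two evaluations in each of `q.t + 1` rounds, one at the end and one at the base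
    -- point.
    have := neonPlusLoop_cost f q γ S x ((evalBatch S x).result f) (q.t + 1) [] u₀ u₀
    nlinarith

theorem ncStep_cost_le (v : NeonVariant) (p : MSGDParams) (L₂ γ : ℝ) (S₂ : Fin p.m₂ → Ξ)
    (e : Vec d) (sgn : Bool) (y : Vec d) :
    (ncStep v p L₂ γ S₂ e sgn y).cost f ≤ (2 * p.nc.t + 4) * p.m₂ := by
  simp only [ncStep, IFOProg.cost_bind]
  refine le_trans (le_of_eq ?_) (neonProc_cost_le f v p.nc γ S₂ y (p.nc.r • e))
  split_ifs <;> simp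

@[simp] theorem msgd_result {m : ℕ} (L₁ : ℝ) (S₁ : Fin m → Ξ) (x : Vec d) :
    (msgd L₁ S₁ x).result f = (x, x - L₁⁻¹ • batchGrad f S₁ x) := by
  simp [msgd]

@[simp] theorem msgd_cost {m : ℕ} (L₁ : ℝ) (S₁ : Fin m → Ξ) (x : Vec d) :
    (msgd L₁ S₁ x).cost f = m := by
  simp [msgd]

theorem neonMSGDIter_cost_le (v : NeonVariant) (p : MSGDParams) (L₁ L₂ ε γ : ℝ)
    (s : Seed d Ξ p) (x : Vec d) : (neonMSGDIter v p L₁ L₂ ε γ s x).cost f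
      ≤ p.m₁ + p.mc + (2 * p.nc.t + 4) * p.m₂ := by
  simp only [neonMSGDIter, IFOProg.cost_bind, msgd_cost, msgd_result, evalBatch_cost]
  split_ifs
  · have := ncStep_cost_le f v p L₂ γ s.2.2.1 s.2.2.2.1 s.2.2.2.2 x
    omega
  · simp only [IFOProg.cost_pure]
    omega

theorem neonMSGD_cost_le (v : NeonVariant) (p : MSGDParams) (L₁ L₂ ε γ : ℝ) (x₁ : Vec d)
    (ω : ℕ → Seed d Ξ p) (n : ℕ) : (neonMSGD v p L₁ L₂ ε γ x₁ ω n).cost f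
      ≤ n * (p.m₁ + p.mc + (2 * p.nc.t + 4) * p.m₂) := by
  induction n with
  | zero => simp [neonMSGD]
  | succ n ih =>
    simp only [neonMSGD, IFOProg.cost_bind]
    rw [add_mul, one_mul]
    refine add_le_add ih ?_
    split
    · exact neonMSGDIter_cost_le f v p L₁ L₂ ε γ (ω n) _
    · simp

end Programs

/-! ### The selection of a direction of negative curvature -/

theorem selectNC_spec {d : ℕ} {U θ : ℝ} {l : List (Vec d × ℝ)} (h : selectNC U θ l ≠ 0) :
    ∃ p ∈ l, p.1 = selectNC U θ l ∧ ‖p.1‖ ≤ U ∧ p.2 ≤ -θ := by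
  classical
  unfold selectNC at h ⊢
  split at h
  · rename_i p hp
    split_ifs at h with hθ
    · have hmem := List.argmin_mem hp
      rw [List.mem_filter, decide_eq_true_eq] at hmem
      exact ⟨p, hmem.1, by simp only [if_pos hθ], hmem.2, hθ⟩
    · exact absurd rfl h
  · exact absurd rfl h

/-- Zero signals failure, so `h0` is needed to exclude that a successful candidate is itself the
zero vector. -/
theorem selectNC_ne_zero {d : ℕ} {U θ : ℝ} {l : List (Vec d × ℝ)} {p : Vec d × ℝ} (hp : p ∈ l)
    (hU : ‖p.1‖ ≤ U) (hθ : p.2 ≤ -θ) (h0 : ∀ p ∈ l, p.2 ≤ -θ → p.1 ≠ 0) :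
    selectNC U θ l ≠ 0 := by
  classical
  have hmem : p ∈ l.filter fun p => decide (‖p.1‖ ≤ U) := by
    rw [List.mem_filter, decide_eq_true_eq]
    exact ⟨hp, hU⟩
  unfold selectNC
  split
  · rename_i p' hp'
    have h1 := List.le_of_mem_argmin hmem hp'
    rw [if_pos (le_trans h1 hθ)]
    exact h0 p' (List.mem_filter.1 (List.argmin_mem hp')).1 (le_trans h1 hθ)
  · rename_i hnone
    rw [List.argmin_eq_none] at hnone
    rw [hnone] at hmem
    simp at hmem

/-! ### The results of NEON and NEON⁺ -/

section Results

variable {d : ℕ} {Ξ : Type u} {f : Vec d → Ξ → ℝ} {L₁ L₂ : ℝ}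

theorem evalHat_result (hf : ∀ ξ, IsSmooth (fun x => f x ξ) L₁ L₂) {m : ℕ} (S : Fin m → Ξ)
    (x u : Vec d) : (evalHat S x (batchMean f S x, batchGrad f S x) u).result f
      = (ghat (batchMean f S) x u, ghatGrad (batchMean f S) x u) := by
  simp [evalHat, ghat, ghatGrad, gradient_batchMean hf]

theorem neonLoop_result (hf : ∀ ξ, IsSmooth (fun x => f x ξ) L₁ L₂) {m : ℕ} (S : Fin m → Ξ)
    (x u₀ : Vec d) (η : ℝ) (k j : ℕ) :
    (neonLoop S x (batchMean f S x, batchGrad f S x) η k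
      (agdSeq (batchMean f S) x η 0 u₀ j).1).result f
      = (List.range' j (k + 1)).map fun i => ((agdSeq (batchMean f S) x η 0 u₀ i).1,
        ghat (batchMean f S) x (agdSeq (batchMean f S) x η 0 u₀ i).1) := by
  induction k generalizing j with
  | zero => simp [neonLoop, evalHat_result hf, List.range'_succ]
  | succ k ih =>
    have hsnd : (agdSeq (batchMean f S) x η 0 u₀ j).2 = (agdSeq (batchMean f S) x η 0 u₀ j).1 := by
      rw [agdSeq_snd j, zero_smul, add_zero]
    have h := ih (j + 1)
    rw [agdSeq_succ_fst, hsnd] at h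
    simp only [neonLoop, IFOProg.result_bind, evalHat_result hf, h, IFOProg.result_pure]
    rw [List.range'_succ (n := k + 1), List.map_cons]

theorem neonGD_result (hf : ∀ ξ, IsSmooth (fun x => f x ξ) L₁ L₂) {m : ℕ} (q : NeonParams)
    (S : Fin m → Ξ) (x u₀ : Vec d) : (neonGD q S x u₀).result f
      = selectNC q.U (5 / 2 * q.Fthr) ((List.range (q.t + 2)).map fun i =>
        ((agdSeq (batchMean f S) x q.η 0 u₀ i).1,
          ghat (batchMean f S) x (agdSeq (batchMean f S) x q.η 0 u₀ i).1)) := by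
  have h := neonLoop_result hf S x u₀ q.η (q.t + 1) 0
  rw [← List.range_eq_range'] at h
  simp only [neonGD, IFOProg.result_bind, evalBatch_result, IFOProg.result_pure]
  exact congrArg _ h

/-- The start at an arbitrary time `j` with the accumulated history is the form that the induction
on the remaining rounds requires. The alternative separates a stop at the first certificate from a
complete run. -/
theorem neonPlusLoop_result (hf : ∀ ξ, IsSmooth (fun x => f x ξ) L₁ L₂) {m : ℕ} (q : NeonParams)
    (γ : ℝ) (S : Fin m → Ξ) (x u₀ : Vec d) {s : ℕ → Vec d × Vec d}
    (hs : s = agdSeq (batchMean f S) x q.η q.ζ u₀) {w : Vec d} (k j : ℕ)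
    (hw : w = (neonPlusLoop q γ S x (batchMean f S x, batchGrad f S x) k
      ((List.range j).map fun i => (s i, ghat (batchMean f S) x (s i).1)) (s j).1 (s j).2).result f) :
    (∃ σ, j ≤ σ ∧ σ < j + k ∧ IsCertificate (batchMean f S) x γ (s σ) ∧
        (∀ i, j ≤ i → i < σ → ¬ IsCertificate (batchMean f S) x γ (s i)) ∧
        w = ncFind q ((List.range (σ + 1)).map s) (s σ).1 (s σ).2) ∨
      (∀ i, j ≤ i → i < j + k → ¬ IsCertificate (batchMean f S) x γ (s i)) ∧
        w = selectNC q.U (2 * q.Fthr)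
          ((List.range (j + k + 1)).map fun i => ((s i).1, ghat (batchMean f S) x (s i).1)) := by
  induction k generalizing j with
  | zero =>
    refine Or.inr ⟨fun i h1 h2 => by omega, ?_⟩
    rw [hw]
    simp only [neonPlusLoop, IFOProg.result_bind, evalHat_result hf, IFOProg.result_pure, add_zero,
      List.range_succ, List.map_append, List.map_map, List.map_cons, List.map_nil]
    rfl
  | succ k ih =>
    simp only [neonPlusLoop, IFOProg.result_bind, evalHat_result hf] at hw
    by_cases hc : IsCertificate (batchMean f S) x γ (s j)
    · rw [if_pos (by exact hc)] at hw
      refine Or.inl ⟨j, le_rfl, by omega, hc, fun i h1 h2 => by omega, ?_⟩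
      rw [hw]
      simp only [IFOProg.result_pure, List.range_succ, List.map_append, List.map_map, List.map_cons,
        List.map_nil]
      rfl
    · rw [if_neg (by exact hc)] at hw
      have h1 : (s (j + 1)).1 = (s j).2 - q.η • ghatGrad (batchMean f S) x (s j).2 := by
        rw [hs]; rfl
      have h2 : (s (j + 1)).2 = (s (j + 1)).1 + q.ζ • ((s (j + 1)).1 - (s j).1) := by
        rw [hs]; rfl
      have h3 : (List.map (fun i => (s i, ghat (batchMean f S) x (s i).1)) (List.range j))
          ++ [(((s j).1, (s j).2), ghat (batchMean f S) x (s j).1)]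
          = (List.range (j + 1)).map fun i => (s i, ghat (batchMean f S) x (s i).1) := by
        simp [List.range_succ]
      rw [h3, ← h1, ← h2] at hw
      rcases ih (j + 1) hw with ⟨σ, a1, a2, a3, a4, a5⟩ | ⟨a1, a2⟩
      · refine Or.inl ⟨σ, by omega, by omega, a3, fun i b1 b2 => ?_, a5⟩
        rcases Nat.eq_or_lt_of_le b1 with rfl | b3
        · exact hc
        · exact a4 i b3 b2
      · refine Or.inr ⟨fun i b1 b2 => ?_, ?_⟩
        · rcases Nat.eq_or_lt_of_le b1 with rfl | b3
          · exact hc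
          · exact a1 i b3 (by omega)
        · rw [a2, show j + 1 + k + 1 = j + (k + 1) + 1 by ring]

theorem neonAGD_result (hf : ∀ ξ, IsSmooth (fun x => f x ξ) L₁ L₂) {m : ℕ} (q : NeonParams)
    (γ : ℝ) (S : Fin m → Ξ) (x u₀ : Vec d) {s : ℕ → Vec d × Vec d}
    (hs : s = agdSeq (batchMean f S) x q.η q.ζ u₀) {w : Vec d}
    (hw : w = (neonAGD q γ S x u₀).result f) :
    (∃ σ ≤ q.t, IsCertificate (batchMean f S) x γ (s σ) ∧
        (∀ i < σ, ¬ IsCertificate (batchMean f S) x γ (s i)) ∧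
        w = ncFind q ((List.range (σ + 1)).map s) (s σ).1 (s σ).2) ∨
      (∀ i ≤ q.t, ¬ IsCertificate (batchMean f S) x γ (s i)) ∧
        w = selectNC q.U (2 * q.Fthr)
          ((List.range (q.t + 2)).map fun i => ((s i).1, ghat (batchMean f S) x (s i).1)) := by
  have h0 : s 0 = (u₀, u₀) := by rw [hs]; rfl
  have h := neonPlusLoop_result hf q γ S x u₀ hs (w := w) (q.t + 1) 0 (by
    rw [hw, h0]
    simp [neonAGD])
  rcases h with ⟨σ, -, a2, a3, a4, a5⟩ | ⟨a1, a2⟩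
  · exact Or.inl ⟨σ, by omega, a3, fun i hi => a4 i (Nat.zero_le i) hi, a5⟩
  · exact Or.inr ⟨fun i hi => a1 i (Nat.zero_le i) (by omega), by rw [a2]; simp [add_comm, add_left_comm]⟩

theorem ncFind_range {d : ℕ} (q : NeonParams) (s : ℕ → Vec d × Vec d) (n : ℕ) (y u : Vec d) :
    (∃ j < n, q.ζ * √(6 * q.η * q.Fthr) ≤ ‖(s j).1 - (s j).2‖ ∧
      (∀ i < j, ‖(s i).1 - (s i).2‖ < q.ζ * √(6 * q.η * q.Fthr)) ∧
      ncFind q ((List.range n).map s) y u = (s j).1) ∨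
    (∀ j < n, ‖(s j).1 - (s j).2‖ < q.ζ * √(6 * q.η * q.Fthr)) ∧
      ncFind q ((List.range n).map s) y u = y - u := by
  classical
  unfold ncFind
  rw [List.find?_map]
  cases h : List.find? ((fun e : Vec d × Vec d =>
    decide (q.ζ * √(6 * q.η * q.Fthr) ≤ ‖e.1 - e.2‖)) ∘ s) (List.range n) with
  | some j =>
    left
    rw [List.find?_range_eq_some] at h
    refine ⟨j, by simpa using h.2.1, by simpa using h.1, fun i hi => ?_, by simp⟩
    simpa using h.2.2 i hi
  | none =>
    right
    rw [List.find?_range_eq_none] at h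
    refine ⟨fun j hj => ?_, by simp⟩
    simpa using h j hj

end Results

/-! ### Guarantees for NEON and NEON⁺ -/

/-- Conditions under which the two procedures detect curvature `-γ` and return only directions of
curvature at most `-κ`: `ρ` is the localization radius, `α` a lower bound for the noise in the
escape direction, `R` a bound for the candidates. -/
structure NeonTuning (v : NeonVariant) (q : NeonParams) (L₁ L₂ γ ρ α θ κ R : ℝ) : Prop where
  η_pos : 0 < q.η
  η_le : q.η * L₁ ≤ 1
  γ_pos : 0 < γ
  ρ_pos : 0 < ρ
  α_pos : 0 < α
  F_pos : 0 < q.Fthr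
  r_nonneg : 0 ≤ q.r
  r_le : q.r ≤ ρ / 2
  r_sq_le : L₁ * q.r ^ 2 ≤ 2 * q.Fthr
  θ_pos : 0 < θ
  θ_le : θ ≤ 1
  F_le : 28 * q.η * q.Fthr * (q.t + 1 : ℕ) ≤ θ * ρ ^ 2
  U_eq : q.U = 6 * ρ
  U_le : q.U ≤ R
  ρ_sq_le : 18 * L₂ * ρ ^ 2 ≤ γ * α
  R_cube_le : L₂ * R ^ 3 ≤ q.Fthr
  κ_nonneg : 0 ≤ κ
  κ_mul_le : κ * R ^ 2 ≤ 2 * q.Fthr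
  R_le : 6 * L₂ * R ≤ γ
  κ_le : 2 * κ ≤ γ
  growth : match v with
    | .neon => θ = 1 ∧ ρ < (1 + q.η * γ / 2) ^ (q.t + 1) * α
    | .neonPlus => q.ζ = 1 - θ ∧ θ ≤ 1 / 3 ∧ 6 * θ ^ 2 ≤ q.η * γ ∧
        q.ζ ^ 2 * (1 + q.η * γ) ≤ 1 - θ ∧ ρ < (1 + θ) ^ (q.t + 1) * (θ * α) ∧
        2 * (q.r + (q.t + 2) * √(6 * q.η * q.Fthr)) ≤ R

section Guarantees

variable {d : ℕ} {g : Vec d → ℝ} {L₁ L₂ : ℝ} {x u₀ : Vec d} {v : NeonVariant} {q : NeonParams}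
  {γ ρ α θ κ R : ℝ}

/-- Write F for the threshold. Twice the value is at most -4F, the cubic Taylor error costs at most
2F, and the remaining -2F is at most -κR² by the choice of κ. -/
theorem NeonTuning.inner_hess_le_of_ghat_le (hq : NeonTuning v q L₁ L₂ γ ρ α θ κ R)
    (hg : IsSmooth g L₁ L₂) (hL : 0 ≤ L₂) {w : Vec d} (hw : ‖w‖ ≤ R)
    (hF : ghat g x w ≤ -(2 * q.Fthr)) : ⟪w, hess g x w⟫ ≤ -κ * ‖w‖ ^ 2 := by
  have h1 := hg.inner_hess_le_ghat hL x w
  have h2 : L₂ * ‖w‖ ^ 3 ≤ L₂ * R ^ 3 := by gcongr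
  have h3 : κ * ‖w‖ ^ 2 ≤ κ * R ^ 2 := by
    have := hq.κ_nonneg
    gcongr
  linarith [hq.R_cube_le, hq.κ_mul_le]

theorem ne_zero_of_ghat_neg {w : Vec d} (h : ghat g x w < 0) : w ≠ 0 := by
  rintro rfl
  simp [ghat] at h

theorem agdSeq_norm_le {η ζ D : ℝ} (k : ℕ) (h : ∀ i ≤ k,
    ‖(agdSeq g x η ζ u₀ i).1 - (agdSeq g x η ζ u₀ (i - 1)).1‖ ≤ D) :
    ‖(agdSeq g x η ζ u₀ k).1‖ ≤ ‖u₀‖ + k * D := by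
  induction k with
  | zero => simp [agdSeq]
  | succ k ih =>
    have h1 := ih fun i hi => h i (by omega)
    have h2 := h (k + 1) le_rfl
    rw [Nat.add_sub_cancel] at h2
    have h3 := norm_add_le ((agdSeq g x η ζ u₀ (k + 1)).1 - (agdSeq g x η ζ u₀ k).1)
      (agdSeq g x η ζ u₀ k).1
    rw [sub_add_cancel] at h3
    push_cast
    linarith

theorem agdSeq_snd_norm_le {η ζ D : ℝ} (hζ0 : 0 ≤ ζ) (hζ1 : ζ ≤ 1) (k : ℕ) (h : ∀ i ≤ k,
    ‖(agdSeq g x η ζ u₀ i).1 - (agdSeq g x η ζ u₀ (i - 1)).1‖ ≤ D) :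
    ‖(agdSeq g x η ζ u₀ k).2‖ ≤ ‖u₀‖ + (k + 1) * D := by
  rw [agdSeq_snd]
  refine (norm_add_le _ _).trans ?_
  rw [norm_smul, Real.norm_of_nonneg hζ0]
  have h1 := agdSeq_norm_le k h
  have h2 := mul_le_mul hζ1 (h k le_rfl) (norm_nonneg _) zero_le_one
  linarith

/-- If no certificate is found, the iterates leave the ball of radius `ρ` and one of them is a
candidate with a small value of `ĝ`. -/
theorem NeonTuning.exists_candidate (hq : NeonTuning v q L₁ L₂ γ ρ α θ κ R)
    (hg : IsSmooth g L₁ L₂) (hu : ‖u₀‖ ≤ q.r) (hL₁ : 0 ≤ L₁) {ζ : ℝ} (hζ0 : 0 ≤ ζ) (hζ1 : ζ ≤ 1)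
    (hζθ : ζ ^ 2 * (1 + q.η * γ) ≤ 1 - θ)
    (hesc : ∃ k ≤ q.t + 1, ρ < ‖(agdSeq g x q.η ζ u₀ k).1‖)
    (hcert : ∀ i ≤ q.t, ¬ IsCertificate g x γ (agdSeq g x q.η ζ u₀ i)) :
    ∃ k < q.t + 2, ‖(agdSeq g x q.η ζ u₀ k).1‖ ≤ q.U ∧
      ghat g x (agdSeq g x q.η ζ u₀ k).1 ≤ -(5 / 2 * q.Fthr) := by
  classical
  obtain ⟨hk1, hk2⟩ := Nat.find_spec hesc
  set k := Nat.find hesc with hk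
  have hmin : ∀ i < k, ‖(agdSeq g x q.η ζ u₀ i).1‖ ≤ ρ := fun i hi => by
    have := Nat.find_min hesc hi
    push Not at this
    exact this (by omega)
  refine ⟨k, by omega, ?_, ?_⟩
  -- At the first exit time all earlier iterates lie in the ball of radius ρ, so the momentum point
  -- has norm at most 3ρ and the next iterate at most 6ρ, the value of `q.U`. The exit time is
  -- positive because the noise is at most ρ/2.
  · have hr := hq.r_le
    have hρ := hq.ρ_pos
    obtain ⟨j, hj⟩ : ∃ j, k = j + 1 := by
      refine Nat.exists_eq_succ_of_ne_zero fun h0 => ?_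
      rw [h0] at hk2
      simp only [agdSeq] at hk2
      linarith
    rw [hj] at hmin ⊢
    have h1 := norm_agdSeq_succ_le (x := x) (ζ := ζ) (u₀ := u₀) hg hq.η_pos hq.η_le j
    have h2 := norm_agdSeq_snd_le (k := j) hζ0 hζ1 fun i hi => hmin i (by omega)
    rw [hq.U_eq]
    linarith
  · refine ghat_agdSeq_le hg hq.η_pos hq.η_le hζ0 hζθ hq.θ_pos.le hq.θ_le hk1
      (fun i hi => hcert i (by omega)) hq.ρ_pos (hu.trans hq.r_le) hk2.le ?_ hq.F_le
    exact le_trans (by gcongr) hq.r_sq_le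

variable {Ξ : Type u} {f : Vec d → Ξ → ℝ} {m : ℕ} {S : Fin m → Ξ}

/-- What a certificate at step `σ` of NEON⁺ leads to. -/
theorem NeonTuning.ncFind_spec (hq : NeonTuning .neonPlus q L₁ L₂ γ ρ α θ κ R)
    (hg : IsSmooth g L₁ L₂) (hL₁ : 0 ≤ L₁) (hL : 0 ≤ L₂) (hu : ‖u₀‖ ≤ q.r) (hζ : 0 < q.ζ) {σ : ℕ}
    (hσ : σ ≤ q.t) {s : ℕ → Vec d × Vec d} (hs : s = agdSeq g x q.η q.ζ u₀)
    (hc : IsCertificate g x γ (s σ))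
    (hnc : ∀ i < σ, ¬ IsCertificate g x γ (s i)) {w : Vec d}
    (hw : w = ncFind q ((List.range (σ + 1)).map s) (s σ).1 (s σ).2) :
    w ≠ 0 ∧ ⟪w, hess g x w⟫ ≤ -κ * ‖w‖ ^ 2 := by
  obtain ⟨hζθ, hθ3, hθγ, hζγ, -, hR⟩ := hq.growth
  have hζ1 : q.ζ ≤ 1 := by linarith [hq.θ_pos]
  have hFp := hq.F_pos
  have hηp := hq.η_pos
  set D := √(6 * q.η * q.Fthr) with hD
  have hD0 : 0 ≤ D := Real.sqrt_nonneg _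
  have hDp : 0 < D := Real.sqrt_pos.2 (by positivity)
  have hDsq : D ^ 2 = 6 * q.η * q.Fthr := Real.sq_sqrt (by positivity)
  have hstep : ∀ i, ‖(s i).1 - (s i).2‖ < q.ζ * D →
      ‖(agdSeq g x q.η q.ζ u₀ i).1 - (agdSeq g x q.η q.ζ u₀ (i - 1)).1‖ ≤ D := fun i hi => by
    rw [hs, norm_agdSeq_sub hζ.le] at hi
    exact (lt_of_mul_lt_mul_left hi hζ.le).le
  rcases ncFind_range q s (σ + 1) (s σ).1 (s σ).2 with ⟨j, hj, hj1, hj2, hj3⟩ | ⟨hj1, hj2⟩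
  · rw [hj3] at hw
    have hEn := agdSeq_energy hg hq.η_pos hq.η_le hζ.le hζγ (x := x) (u₀ := u₀) j
      (fun i hi => by
        have := hnc i (by omega)
        rwa [hs] at this)
    have hS0 : 0 ≤ ∑ i ∈ Finset.range j, ‖(agdSeq g x q.η q.ζ u₀ i).1
        - (agdSeq g x q.η q.ζ u₀ (i - 1)).1‖ ^ 2 := Finset.sum_nonneg fun i _ => by positivity
    have hΔ : D ≤ ‖(agdSeq g x q.η q.ζ u₀ j).1 - (agdSeq g x q.η q.ζ u₀ (j - 1)).1‖ := by
      rw [hs, norm_agdSeq_sub hζ.le] at hj1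
      exact le_of_mul_le_mul_left hj1 hζ
    -- The first step of length at least D carries D² = 6ηF of an energy that starts at most at 2ηF;
    -- what remains is 2ηĝ ≤ -4ηF.
    have hval : ghat g x w ≤ -(2 * q.Fthr) := by
      have h1 := pow_le_pow_left₀ hD0 hΔ 2
      have h2 := hg.ghat_le x u₀
      have h3 : L₁ * ‖u₀‖ ^ 2 ≤ 2 * q.Fthr := le_trans (by gcongr) hq.r_sq_le
      have h4 := mul_nonneg hq.θ_pos.le hS0
      rw [hDsq] at h1
      rw [hw, hs]
      refine le_of_mul_le_mul_left ?_ (show 0 < 2 * q.η by positivity)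
      have h5 : 2 * q.η * ghat g x u₀ ≤ 2 * q.η * q.Fthr := by gcongr; linarith
      linarith
    refine ⟨ne_zero_of_ghat_neg (by linarith : ghat g x w < 0),
      hq.inner_hess_le_of_ghat_le hg hL ?_ hval⟩
    -- Index 0 is impossible since its previous step is zero. All steps before `j` are shorter than
    -- D, which bounds the norm of the returned point by `R`.
    obtain ⟨i, rfl⟩ : ∃ i, j = i + 1 := by
      refine Nat.exists_eq_succ_of_ne_zero fun h0 => ?_
      rw [h0] at hΔ
      simp only [Nat.zero_sub, sub_self, norm_zero] at hΔ
      linarith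
    have h1 := norm_agdSeq_succ_le (x := x) (ζ := q.ζ) (u₀ := u₀) hg hq.η_pos hq.η_le i
    have h2 := agdSeq_snd_norm_le hζ.le hζ1 i fun l hl => hstep l (hj2 l (by omega))
    have h3 : ((i : ℝ) + 1) * D ≤ (q.t + 2) * D := by
      have : (i : ℝ) ≤ q.t := by exact_mod_cast (by omega : i ≤ q.t)
      (gcongr; linarith)
    rw [hw, hs]
    linarith
  -- All steps are short, so the momentum point and the difference have norm at most R/2. The errors
  -- in the curvature given by the certificate are then absorbed by `6 * L₂ * R ≤ γ`.
  · rw [hj2] at hw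
    have hne : w ≠ 0 := by
      intro h0
      rw [h0, eq_comm, sub_eq_zero] at hw
      have : s σ = ((s σ).2, (s σ).2) := Prod.ext hw rfl
      rw [this] at hc
      exact IsSmooth.not_isCertificate_self x γ _ hc
    refine ⟨hne, ?_⟩
    have h1 := hg.inner_hess_le_of_isCertificate hL hc
    rw [← hw] at h1
    have hσ' : (σ : ℝ) ≤ q.t := by exact_mod_cast hσ
    have h2 := agdSeq_snd_norm_le hζ.le hζ1 σ fun l hl => hstep l (hj1 l (by omega))
    rw [← hs] at h2
    have h3 : ((σ : ℝ) + 1) * D ≤ (q.t + 2) * D := by (gcongr; linarith)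
    have h4 : ‖w‖ ≤ R / 2 := by
      have h5 := hj1 σ (by omega)
      rw [← hw] at h5
      have h6 : q.ζ * D ≤ 1 * D := by gcongr
      have h7 : 1 * D ≤ (q.t + 2) * D := by
        have : (0 : ℝ) ≤ q.t := Nat.cast_nonneg _
        gcongr
        linarith
      linarith [hq.r_nonneg]
    have h5 : L₂ * ‖(s σ).2‖ ≤ L₂ * (R / 2) := by gcongr; linarith
    have h6 : L₂ * ‖w‖ ≤ L₂ * (R / 2) := by gcongr
    refine h1.trans (mul_le_mul_of_nonneg_right ?_ (sq_nonneg _))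
    linarith [hq.R_le, hq.κ_le, hq.γ_pos]

theorem NeonTuning.sound (hq : NeonTuning v q L₁ L₂ γ ρ α θ κ R)
    (hf : ∀ ξ, IsSmooth (fun x => f x ξ) L₁ L₂) (hm : 0 < m) (hL₁ : 0 ≤ L₁) (hL : 0 ≤ L₂)
    (hζ : 0 < q.ζ) (hu : ‖u₀‖ ≤ q.r) (hw : (neonProc v q γ S x u₀).result f ≠ 0) :
    ⟪(neonProc v q γ S x u₀).result f,
      hess (batchMean f S) x ((neonProc v q γ S x u₀).result f)⟫
        ≤ -κ * ‖(neonProc v q γ S x u₀).result f‖ ^ 2 := by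
  have hg := IsSmooth.batchMean hf hm S
  have hFp := hq.F_pos
  cases v with
  | neon =>
    simp only [neonProc, neonGD_result hf] at hw ⊢
    obtain ⟨p, hp, h1, h2, h3⟩ := selectNC_spec hw
    rw [← h1]
    obtain ⟨i, -, rfl⟩ := List.mem_map.1 hp
    exact hq.inner_hess_le_of_ghat_le hg hL (h2.trans hq.U_le) (by simp only at h3; linarith)
  | neonPlus =>
    simp only [neonProc] at hw ⊢
    rcases neonAGD_result hf q γ S x u₀ rfl rfl with ⟨σ, a1, a2, a3, a4⟩ | ⟨a1, a2⟩
    · exact (hq.ncFind_spec hg hL₁ hL hu hζ a1 rfl a2 a3 a4).2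
    · rw [a2] at hw ⊢
      obtain ⟨p, hp, h1, h2, h3⟩ := selectNC_spec hw
      rw [← h1]
      obtain ⟨i, -, rfl⟩ := List.mem_map.1 hp
      exact hq.inner_hess_le_of_ghat_le hg hL (h2.trans hq.U_le) h3

/-- Escape from the ball yields a candidate unless a certificate has stopped NEON⁺, and a
certificate always yields a nonzero vector. Only this half uses a lower bound on the noise;
soundness holds for every start of norm at most `q.r`. -/
theorem NeonTuning.complete (hq : NeonTuning v q L₁ L₂ γ ρ α θ κ R)
    (hf : ∀ ξ, IsSmooth (fun x => f x ξ) L₁ L₂) (hm : 0 < m) (hL₁ : 0 ≤ L₁) (hL : 0 ≤ L₂)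
    (hζ : 0 < q.ζ) (hu : ‖u₀‖ ≤ q.r) {e : Vec d} {lam : ℝ}
    (he : IsEscapeDirection (batchMean f S) x u₀ e lam α) (hlam : γ ≤ lam) :
    (neonProc v q γ S x u₀).result f ≠ 0 := by
  have hg := IsSmooth.batchMean hf hm S
  have hFp := hq.F_pos
  cases v with
  | neon =>
    obtain ⟨hθ, hgr⟩ := hq.growth
    simp only [neonProc, neonGD_result hf]
    have hsnd : ∀ k, (agdSeq (batchMean f S) x q.η 0 u₀ k).2
        = (agdSeq (batchMean f S) x q.η 0 u₀ k).1 := fun k => by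
      rw [agdSeq_snd k, zero_smul, add_zero]
    obtain ⟨k, hk, h1, h2⟩ := hq.exists_candidate hg hu hL₁ (ζ := 0) le_rfl zero_le_one
      (by rw [hθ]; simp)
      (exists_norm_gt_gd hg hL hq.η_pos he hq.γ_pos.le hlam hq.α_pos hq.ρ_sq_le hgr)
      -- Without momentum the two points of the pair coincide, and then no certificate can occur.
      (fun i _ => by
        rw [← Prod.mk.eta (p := agdSeq (batchMean f S) x q.η 0 u₀ i), hsnd]
        exact IsSmooth.not_isCertificate_self x γ _)
    refine selectNC_ne_zero (List.mem_map.2 ⟨k, List.mem_range.2 hk, rfl⟩) h1 h2 fun p hp hpF => ?_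
    obtain ⟨i, -, rfl⟩ := List.mem_map.1 hp
    exact ne_zero_of_ghat_neg (g := batchMean f S) (x := x) (by simp only at hpF; linarith)
  | neonPlus =>
    obtain ⟨hζθ, hθ3, hθγ, hζγ, hgr, -⟩ := hq.growth
    simp only [neonProc]
    rcases neonAGD_result hf q γ S x u₀ rfl rfl with ⟨σ, a1, a2, a3, a4⟩ | ⟨a1, a2⟩
    · exact (hq.ncFind_spec hg hL₁ hL hu hζ a1 rfl a2 a3 a4).1
    · rw [a2]
      obtain ⟨k, hk, h1, h2⟩ := hq.exists_candidate hg hu hL₁ hζ.le (by linarith [hq.θ_pos]) hζγ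
        (by
          rw [hζθ]
          exact exists_norm_gt_agd hg hL hq.η_pos he hlam hq.α_pos hq.ρ_sq_le hq.θ_pos hθ3 hθγ hgr)
        a1
      refine selectNC_ne_zero (List.mem_map.2 ⟨k, List.mem_range.2 hk, rfl⟩) h1
        (by simp only; linarith) fun p hp hpF => ?_
      obtain ⟨i, -, rfl⟩ := List.mem_map.1 hp
      exact ne_zero_of_ghat_neg (g := batchMean f S) (x := x) (by simp only at hpF; linarith)

end Guarantees

/-! ### Anti-concentration of the uniform distribution on the ball -/

theorem unitBallLaw_apply (d : ℕ) {A : Set (Vec d)} :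
    unitBallLaw d A = (volume (Metric.closedBall (0 : Vec d) 1))⁻¹
      * volume (Metric.closedBall (0 : Vec d) 1 ∩ A) := by
  rw [unitBallLaw, cond_apply Metric.isClosed_closedBall.measurableSet]

theorem ae_norm_le_one_unitBallLaw (d : ℕ) : ∀ᵐ e ∂unitBallLaw d, ‖e‖ ≤ 1 := by
  rw [ae_iff, unitBallLaw_apply]
  have : Metric.closedBall (0 : Vec d) 1 ∩ {e | ¬ ‖e‖ ≤ 1} = ∅ := by
    ext e
    simp
  rw [this, measure_empty, mul_zero]

/-- Translates of the slab by multiples of 2s along `v` are disjoint, and `N` of them fit into the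
concentric ball of radius 1 + 2sN, whose volume is known by scaling. -/
theorem card_mul_volume_slab_le {d : ℕ} {v : Vec d} (hv : ‖v‖ = 1) {s : ℝ} (hs : 0 < s) (N : ℕ) :
    N * volume (Metric.closedBall (0 : Vec d) 1 ∩ {e | |⟪v, e⟫| < s})
      ≤ ENNReal.ofReal ((1 + 2 * s * N) ^ d) * volume (Metric.closedBall (0 : Vec d) 1) := by
  set A := Metric.closedBall (0 : Vec d) 1 ∩ {e | |⟪v, e⟫| < s} with hA
  have hAm : MeasurableSet A := Metric.isClosed_closedBall.measurableSet.inter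
    (measurableSet_lt (by fun_prop) measurable_const)
  let B : ℕ → Set (Vec d) := fun k => (fun e => -(2 * k * s) • v + e) ⁻¹' A
  have hBvol : ∀ k, volume (B k) = volume A := fun k => measure_preimage_add _ _ _
  have hBm : ∀ k, MeasurableSet (B k) := fun k => hAm.preimage (by fun_prop)
  have hvv : ⟪v, v⟫ = 1 := by rw [real_inner_self_eq_norm_sq, hv, one_pow]
  have hBin : ∀ k e, e ∈ B k → |⟪v, e⟫ - 2 * k * s| < s := fun k e he => by
    have := he.2
    simp only [Set.mem_ofPred_eq, inner_add_right, inner_smul_right, hvv] at this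
    rwa [mul_one, neg_add_eq_sub] at this
  have hdisj : Pairwise (Function.onFun Disjoint B) := by
    have key : ∀ i j : ℕ, i < j → Disjoint (B i) (B j) := fun i j hij => by
      rw [Set.disjoint_left]
      intro e h1 h2
      have h3 := (abs_lt.1 (hBin i e h1)).2
      have h4 := (abs_lt.1 (hBin j e h2)).1
      have h5 : (i : ℝ) + 1 ≤ j := by exact_mod_cast hij
      nlinarith
    intro i j hij
    rcases lt_or_gt_of_ne hij with h | h
    · exact key i j h
    · exact (key j i h).symm
  have hsub : (⋃ k ∈ Finset.range N, B k) ⊆ Metric.closedBall (0 : Vec d) (1 + 2 * s * N) := by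
    intro e he
    simp only [Set.mem_iUnion, Finset.mem_range] at he
    obtain ⟨k, hk, he⟩ := he
    have h1 : ‖-(2 * k * s) • v + e‖ ≤ 1 := by simpa using he.1
    have h2 : ‖(2 * k * s) • v‖ = 2 * k * s := by
      rw [norm_smul, hv, mul_one, Real.norm_of_nonneg (by positivity)]
    have h3 := norm_add_le (-(2 * k * s) • v + e) ((2 * k * s) • v)
    rw [neg_smul, neg_add_eq_sub, sub_add_cancel] at h3
    rw [neg_smul, neg_add_eq_sub] at h1
    have h4 : (k : ℝ) ≤ N := by exact_mod_cast hk.le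
    rw [mem_closedBall_zero_iff]
    nlinarith
  calc N * volume A = ∑ k ∈ Finset.range N, volume (B k) := by simp [hBvol]
    _ = volume (⋃ k ∈ Finset.range N, B k) :=
      (measure_biUnion_finset (hdisj.set_pairwise _) fun k _ => hBm k).symm
    _ ≤ volume (Metric.closedBall (0 : Vec d) (1 + 2 * s * N)) := measure_mono hsub
    _ = _ := by
      rw [Measure.addHaar_closedBall _ _ (by positivity : 0 ≤ 1 + 2 * s * N),
        Measure.addHaar_closedBall _ _ zero_le_one, finrank_euclideanSpace_fin]
      simp

theorem unitBallLaw_slab_le {d : ℕ} (hd : 1 ≤ d) {v : Vec d} (hv : ‖v‖ = 1) {s : ℝ} (hs : 0 < s) :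
    unitBallLaw d {e | |⟪v, e⟫| < s} ≤ ENNReal.ofReal (12 * d * s) := by
  have hd' : (1 : ℝ) ≤ d := by exact_mod_cast hd
  by_cases hsd : 2 * s * d ≤ 1
  -- The largest `N` for which the enlarged radius stays below 1 + 1/d, so that the volume ratio is
  -- below e < 3. Since N ≥ 1, also N ≥ 1/(4sd), which gives 3/N ≤ 12ds.
  · set N := ⌊1 / (2 * s * d)⌋₊ with hN
    have h1 : (1 : ℝ) ≤ 1 / (2 * s * d) := by rw [le_div_iff₀ (by positivity)]; linarith
    have hN1 : 1 ≤ N := Nat.le_floor (by simpa using h1)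
    have hN1' : (1 : ℝ) ≤ N := by exact_mod_cast hN1
    have hN2 : (N : ℝ) ≤ 1 / (2 * s * d) := Nat.floor_le (by positivity)
    have hN3 : 1 / (2 * s * d) < N + 1 := Nat.lt_floor_add_one _
    have h2 : (1 + 2 * s * N) ^ d ≤ 3 := by
      have h3 : 2 * s * N ≤ 1 / d := by
        calc 2 * s * N ≤ 2 * s * (1 / (2 * s * d)) := by gcongr
          _ = 1 / d := by field_simp
      calc (1 + 2 * s * N) ^ d ≤ (Real.exp (1 / d)) ^ d := by
            gcongr
            have := Real.add_one_le_exp (1 / (d : ℝ))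
            linarith
        _ = Real.exp 1 := by rw [← Real.exp_nat_mul]; congr 1; field_simp
        _ ≤ 3 := Real.exp_one_lt_three.le
    have h4 := card_mul_volume_slab_le hv hs N
    rw [unitBallLaw_apply]
    set W := volume (Metric.closedBall (0 : Vec d) 1) with hW
    have hW0 : W ≠ 0 := (Metric.measure_closedBall_pos volume (0 : Vec d) one_pos).ne'
    have hWt : W ≠ ⊤ := measure_closedBall_lt_top.ne
    have h5 : (N : ENNReal) * (W⁻¹ * volume (Metric.closedBall (0 : Vec d) 1 ∩ {e | |⟪v, e⟫| < s}))
        ≤ N * ENNReal.ofReal (12 * d * s) := by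
      calc _ = W⁻¹ * (N * volume (Metric.closedBall (0 : Vec d) 1 ∩ {e | |⟪v, e⟫| < s})) := by ring
        _ ≤ W⁻¹ * (ENNReal.ofReal 3 * W) := by
            refine mul_le_mul_right (h4.trans ?_) _
            gcongr
        _ = ENNReal.ofReal 3 := by
            rw [mul_left_comm, ENNReal.inv_mul_cancel hW0 hWt, mul_one]
        _ ≤ ENNReal.ofReal (N * (12 * d * s)) := by
            refine ENNReal.ofReal_le_ofReal ?_
            have h6 : 1 < (N + 1) * (2 * s * d) := by
              rwa [div_lt_iff₀ (by positivity)] at hN3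
            have h7 : (N + 1) * (2 * s * d) ≤ (2 * N) * (2 * s * d) := by gcongr; linarith
            linarith
        _ = _ := by rw [ENNReal.ofReal_mul (by positivity), ENNReal.ofReal_natCast]
    exact (ENNReal.mul_le_mul_iff_right (by simpa using hN1.trans_lt' one_pos |>.ne')
      (ENNReal.natCast_ne_top N)).1 h5
  · refine prob_le_one.trans ?_
    rw [← ENNReal.ofReal_one]
    refine ENNReal.ofReal_le_ofReal ?_
    push Not at hsd
    linarith

/-! ### The negative-curvature procedures detect negative curvature -/

/-- The infimum of the Rayleigh quotient is an eigenvalue, and it is at most the quotient at `v`. -/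
theorem exists_eigenvector_le {d : ℕ} {H : Vec d →L[ℝ] Vec d} (hH : ∀ v w, ⟪H v, w⟫ = ⟪v, H w⟫)
    {γ : ℝ} {v : Vec d} (hv : ⟪v, H v⟫ < -γ * ‖v‖ ^ 2) :
    ∃ (e : Vec d) (lam : ℝ), ‖e‖ = 1 ∧ γ ≤ lam ∧ H e = (-lam) • e := by
  have hv0 : v ≠ 0 := by rintro rfl; simp at hv
  have : Nontrivial (Vec d) := ⟨v, 0, hv0⟩
  have hT : (H : Vec d →ₗ[ℝ] Vec d).IsSymmetric := fun a b => hH a b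
  have hev := hT.hasEigenvalue_iInf_of_finiteDimensional
  obtain ⟨w, hw⟩ := hev.exists_hasEigenvector
  set m : ℝ := ⨅ x : { x : Vec d // x ≠ 0 },
    RCLike.re ⟪(H : Vec d →ₗ[ℝ] Vec d) x, x⟫ / ‖(x : Vec d)‖ ^ 2 with hm
  have hle : m ≤ -γ := by
    have hb : BddBelow (Set.range fun x : { x : Vec d // x ≠ 0 } =>
        RCLike.re ⟪(H : Vec d →ₗ[ℝ] Vec d) x, x⟫ / ‖(x : Vec d)‖ ^ 2) := by
      refine ⟨-‖H‖, ?_⟩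
      rintro _ ⟨⟨x, hx⟩, rfl⟩
      have hx' : 0 < ‖x‖ := norm_pos_iff.2 hx
      simp only [ContinuousLinearMap.coe_coe, RCLike.re_to_real]
      rw [le_div_iff₀ (by positivity)]
      have h1 := abs_real_inner_le_norm (H x) x
      have h2 := H.le_opNorm x
      have h3 := neg_abs_le ⟪H x, x⟫
      nlinarith
    refine (ciInf_le hb ⟨v, hv0⟩).trans ?_
    have hv' : 0 < ‖v‖ := norm_pos_iff.2 hv0
    simp only [ContinuousLinearMap.coe_coe, RCLike.re_to_real]
    rw [div_le_iff₀ (by positivity), hH]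
    exact hv.le
  have hw0 : w ≠ 0 := hw.2
  refine ⟨‖w‖⁻¹ • w, -m, by simpa using norm_smul_inv_norm (𝕜 := ℝ) hw0, by linarith, ?_⟩
  have := hw.apply_eq_smul
  simp only [ContinuousLinearMap.coe_coe] at this
  rw [map_smul, this, neg_neg, smul_comm]
  rfl

theorem NeonTuning.unitBallLaw_eq_zero_le {d : ℕ} {Ξ : Type u} {f : Vec d → Ξ → ℝ} {L₁ L₂ : ℝ}
    {v : NeonVariant} {q : NeonParams} {γ ρ s θ κ R : ℝ} {m : ℕ} {S : Fin m → Ξ} {x : Vec d}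
    (hq : NeonTuning v q L₁ L₂ γ ρ (q.r * s) θ κ R) (hd : 1 ≤ d) (hs : 0 < s)
    (hf : ∀ ξ, IsSmooth (fun x => f x ξ) L₁ L₂) (hm : 0 < m) (hL₁ : 0 ≤ L₁) (hL : 0 ≤ L₂)
    (hζ : 0 < q.ζ) (hx : ¬ ∀ v, -γ * ‖v‖ ^ 2 ≤ ⟪v, hess (batchMean f S) x v⟫) :
    unitBallLaw d {e | (neonProc v q γ S x (q.r • e)).result f = 0}
      ≤ ENNReal.ofReal (12 * d * s) := by
  push Not at hx
  obtain ⟨w, hw⟩ := hx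
  have hg := IsSmooth.batchMean hf hm S
  obtain ⟨e₁, lam, he₁, hlam, hHe⟩ := exists_eigenvector_le (hg.hess_symm x) hw
  refine le_trans (measure_mono_ae ?_) (unitBallLaw_slab_le hd he₁ hs)
  filter_upwards [ae_norm_le_one_unitBallLaw d] with e he h0
  by_contra hcon
  have hcon' : s ≤ |⟪e₁, e⟫| := not_lt.1 hcon
  have hu : ‖q.r • e‖ ≤ q.r := by
    rw [norm_smul, Real.norm_of_nonneg hq.r_nonneg]
    exact mul_le_of_le_one_right hq.r_nonneg he
  have hr : 0 ≤ q.r := hq.r_nonneg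
  -- The opposite of an eigenvector is one too, so the noise may overlap with either sign, and
  -- failure confines it to a two-sided slab.
  rcases le_abs.1 hcon' with h | h
  · refine hq.complete hf hm hL₁ hL hζ hu (e := e₁) ⟨he₁, hHe, ?_⟩ hlam h0
    rw [inner_smul_right]
    gcongr
  · refine hq.complete hf hm hL₁ hL hζ hu (e := -e₁) ⟨by rwa [norm_neg], ?_, ?_⟩ hlam h0
    · rw [map_neg, hHe, smul_neg]
    · rw [inner_smul_right, inner_neg_left]
      gcongr

/-! ### Measurability of the algorithm -/

section SelectMeasurable

variable {d : ℕ} {Z : Type*} [MeasurableSpace Z]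

-- Induction from the right matches the recursion of `List.argmin`: the last entry replaces the
-- previous minimizer only if it is strictly smaller. The set `A` records where some candidate is
-- admissible.
open Classical in
theorem exists_measurable_argmin (U : ℝ) (l : List (Z → Vec d × ℝ)) (hl : ∀ h ∈ l, Measurable h) :
    ∃ (A : Set Z) (a : Z → Vec d × ℝ), MeasurableSet A ∧ Measurable a ∧ ∀ z,
      List.argmin (fun p : Vec d × ℝ => p.2)
        ((l.map fun h => h z).filter fun p => decide (‖p.1‖ ≤ U)) = if z ∈ A then some (a z) else none := by
  induction l using List.reverseRecOn with
  | nil => exact ⟨∅, fun _ => 0, MeasurableSet.empty, measurable_const, fun z => by simp⟩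
  | append_singleton l h ih =>
    obtain ⟨A, a, hA, ha, hAa⟩ := ih fun h' hh' => hl h' (by simp [hh'])
    have hh : Measurable h := hl h (by simp)
    have hB : MeasurableSet {z | ‖(h z).1‖ ≤ U} :=
      measurableSet_le (by fun_prop) measurable_const
    have hC : MeasurableSet {z | (h z).2 < (a z).2} := measurableSet_lt (by fun_prop) (by fun_prop)
    refine ⟨A ∪ {z | ‖(h z).1‖ ≤ U}, fun z => if ‖(h z).1‖ ≤ U ∧ (z ∉ A ∨ (h z).2 < (a z).2)
      then h z else a z, hA.union hB,
      Measurable.ite (hB.inter (hA.compl.union hC)) hh ha, fun z => ?_⟩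
    rw [List.map_append, List.filter_append]
    by_cases hz : ‖(h z).1‖ ≤ U
    · have : ([h].map fun h => h z).filter (fun p => decide (‖p.1‖ ≤ U)) = [h z] := by simp [hz]
      rw [this, List.argmin_concat, hAa z]
      by_cases hzA : z ∈ A
      · by_cases hlt : (h z).2 < (a z).2 <;> simp [hz, hzA, hlt]
      · simp [hz, hzA]
    · have : ([h].map fun h => h z).filter (fun p => decide (‖p.1‖ ≤ U)) = [] := by simp [hz]
      rw [this, List.append_nil, hAa z]
      by_cases hzA : z ∈ A <;> simp [hz, hzA]

theorem measurable_selectNC (U θ : ℝ) (l : List (Z → Vec d × ℝ)) (hl : ∀ h ∈ l, Measurable h) :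
    Measurable fun z => selectNC U θ (l.map fun h => h z) := by
  classical
  obtain ⟨A, a, hA, ha, hAa⟩ := exists_measurable_argmin U l hl
  have : (fun z => selectNC U θ (l.map fun h => h z))
      = fun z => if z ∈ A ∩ {z | (a z).2 ≤ -θ} then (a z).1 else 0 := by
    funext z
    unfold selectNC
    have h := hAa z
    split
    · rename_i p hp
      rw [hp] at h
      by_cases hz : z ∈ A
      · rw [if_pos hz, Option.some_inj] at h
        simp [hz, h]
      · simp [hz] at h
    · rename_i hp
      rw [hp] at h
      by_cases hz : z ∈ A
      · simp [hz] at h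
      · simp [hz]
  rw [this]
  exact Measurable.ite (hA.inter (measurableSet_le (by fun_prop) measurable_const)) (by fun_prop)
    measurable_const

theorem measurable_ncFind (q : NeonParams) (l : List (Z → Vec d × Vec d))
    (hl : ∀ h ∈ l, Measurable h) {y u : Z → Vec d} (hy : Measurable y) (hu : Measurable u) :
    Measurable fun z => ncFind q (l.map fun h => h z) (y z) (u z) := by
  classical
  induction l with
  | nil => simpa [ncFind] using (by fun_prop : Measurable fun z => y z - u z)
  | cons h l ih =>
    have hh : Measurable h := hl h (by simp)
    have hA : MeasurableSet {z | q.ζ * √(6 * q.η * q.Fthr) ≤ ‖(h z).1 - (h z).2‖} :=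
      measurableSet_le measurable_const (by fun_prop)
    have : (fun z => ncFind q ((h :: l).map fun h => h z) (y z) (u z))
        = fun z => if q.ζ * √(6 * q.η * q.Fthr) ≤ ‖(h z).1 - (h z).2‖ then (h z).1
          else ncFind q (l.map fun h => h z) (y z) (u z) := by
      funext z
      unfold ncFind
      rw [List.map_cons, List.find?_cons]
      by_cases hz : q.ζ * √(6 * q.η * q.Fthr) ≤ ‖(h z).1 - (h z).2‖ <;> simp [hz]
    rw [this]
    exact Measurable.ite hA (by fun_prop) (ih fun h' hh' => hl h' (by simp [hh']))

end SelectMeasurable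

namespace StandingAssumptions

variable {d : ℕ} {Ξ : Type u} [MeasurableSpace Ξ] {μ : Measure Ξ} {f : Vec d → Ξ → ℝ} {x₁ : Vec d}
  {L₁ L₂ G V Δ : ℝ} {Z : Type*} [MeasurableSpace Z]

theorem measurable_batchMean (h : StandingAssumptions μ f x₁ L₁ L₂ G V Δ) {m : ℕ}
    {S : Z → Fin m → Ξ} (hS : Measurable S) {x : Z → Vec d} (hx : Measurable x) :
    Measurable fun z => batchMean f (S z) (x z) := by
  have hf : Measurable (Function.uncurry f) := measurable_uncurry_of_continuous_of_measurable
    (fun ξ => (h.differentiable ξ).continuous) h.measurable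
  unfold batchMean
  refine Measurable.const_mul (Finset.measurable_sum _ fun i _ => ?_) _
  exact hf.comp (hx.prodMk ((measurable_pi_apply i).comp hS))

theorem measurable_batchGrad (h : StandingAssumptions μ f x₁ L₁ L₂ G V Δ) {m : ℕ}
    {S : Z → Fin m → Ξ} (hS : Measurable S) {x : Z → Vec d} (hx : Measurable x) :
    Measurable fun z => batchGrad f (S z) (x z) := by
  have hf : Measurable (Function.uncurry (sampleGrad f)) :=
    measurable_uncurry_of_continuous_of_measurable
    (fun ξ => (h.isSmooth ξ).continuous_gradient) h.measurable_sampleGrad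
  unfold batchGrad
  have : Measurable fun z => ∑ i, sampleGrad f (x z) (S z i) := Finset.measurable_sum _ fun i _ =>
    hf.comp (hx.prodMk ((measurable_pi_apply i).comp hS))
  fun_prop

theorem measurable_evalBatch (h : StandingAssumptions μ f x₁ L₁ L₂ G V Δ) {m : ℕ}
    {S : Z → Fin m → Ξ} (hS : Measurable S) {x : Z → Vec d} (hx : Measurable x) :
    Measurable fun z => (evalBatch (S z) (x z)).result f := by
  simp only [evalBatch_result]
  exact (h.measurable_batchMean hS hx).prodMk (h.measurable_batchGrad hS hx)

theorem measurable_evalHat (h : StandingAssumptions μ f x₁ L₁ L₂ G V Δ) {m : ℕ}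
    {S : Z → Fin m → Ξ} (hS : Measurable S) {x : Z → Vec d} (hx : Measurable x)
    {b : Z → ℝ × Vec d} (hb : Measurable b) {w : Z → Vec d} (hw : Measurable w) :
    Measurable fun z => (evalHat (S z) (x z) (b z) (w z)).result f := by
  have := h.measurable_evalBatch hS (x := fun z => x z + w z) (by fun_prop)
  simp only [evalHat, IFOProg.result_bind, IFOProg.result_pure]
  exact Measurable.prodMk (by fun_prop) (by fun_prop)

theorem exists_measurable_neonLoop (h : StandingAssumptions μ f x₁ L₁ L₂ G V Δ) {m : ℕ}
    {S : Z → Fin m → Ξ} (hS : Measurable S) {x : Z → Vec d} (hx : Measurable x)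
    {b : Z → ℝ × Vec d} (hb : Measurable b) (η : ℝ) (k : ℕ) {w : Z → Vec d} (hw : Measurable w) :
    ∃ l : List (Z → Vec d × ℝ), (∀ g ∈ l, Measurable g) ∧
      ∀ z, (neonLoop (S z) (x z) (b z) η k (w z)).result f = l.map fun g => g z := by
  induction k generalizing w with
  | zero =>
    have h1 := h.measurable_evalHat hS hx hb hw
    refine ⟨[fun z => (w z, ((evalHat (S z) (x z) (b z) (w z)).result f).1)], ?_, fun z => ?_⟩
    · simp only [List.mem_singleton, forall_eq]
      fun_prop
    · simp [neonLoop]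
  | succ k ih =>
    have h1 := h.measurable_evalHat hS hx hb hw
    obtain ⟨l, hl, hlz⟩ := ih (w := fun z => w z - η • ((evalHat (S z) (x z) (b z) (w z)).result f).2)
      (by fun_prop)
    refine ⟨(fun z => (w z, ((evalHat (S z) (x z) (b z) (w z)).result f).1)) :: l, ?_, fun z => ?_⟩
    · simp only [List.mem_cons, forall_eq_or_imp]
      exact ⟨by fun_prop, hl⟩
    · simp [neonLoop, hlz]

theorem measurable_neonPlusLoop (h : StandingAssumptions μ f x₁ L₁ L₂ G V Δ) {m : ℕ}
    {S : Z → Fin m → Ξ} (hS : Measurable S) {x : Z → Vec d} (hx : Measurable x)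
    {b : Z → ℝ × Vec d} (hb : Measurable b) (q : NeonParams) (γ : ℝ) (k : ℕ)
    (l : List (Z → (Vec d × Vec d) × ℝ)) (hl : ∀ g ∈ l, Measurable g) {y w : Z → Vec d}
    (hy : Measurable y) (hw : Measurable w) :
    Measurable fun z => (neonPlusLoop q γ (S z) (x z) (b z) k (l.map fun g => g z)
      (y z) (w z)).result f := by
  induction k generalizing l y w with
  | zero =>
    have h1 := h.measurable_evalHat hS hx hb hy
    have h2 := measurable_selectNC q.U (2 * q.Fthr)
      (l.map (fun g z => ((g z).1.1, (g z).2)) ++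
        [fun z => (y z, ((evalHat (S z) (x z) (b z) (y z)).result f).1)]) (by
        simp only [List.mem_append, List.mem_map, List.mem_singleton]
        rintro _ (⟨g, hg, rfl⟩ | rfl)
        · have := hl g hg
          fun_prop
        · fun_prop)
    simp only [neonPlusLoop, IFOProg.result_bind, IFOProg.result_pure, List.map_map]
    simpa [List.map_append, Function.comp_def] using h2
  | succ k ih =>
    have h1 := h.measurable_evalHat hS hx hb hy
    have h2 := h.measurable_evalHat hS hx hb hw
    simp only [neonPlusLoop, IFOProg.result_bind, apply_ite (IFOProg.result f),
      IFOProg.result_pure]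
    refine Measurable.ite (measurableSet_lt (by fun_prop) (by fun_prop)) ?_ ?_
    · have h3 := measurable_ncFind q (l.map (fun g z => (g z).1) ++ [fun z => (y z, w z)]) (by
        simp only [List.mem_append, List.mem_map, List.mem_singleton]
        rintro _ (⟨g, hg, rfl⟩ | rfl)
        · have := hl g hg
          fun_prop
        · fun_prop) hy hw
      simpa [List.map_append, Function.comp_def] using h3
    · have h3 := ih (l ++ [fun z => ((y z, w z), ((evalHat (S z) (x z) (b z) (y z)).result f).1)])
        (by
          simp only [List.mem_append, List.mem_singleton]
          rintro _ (hg | rfl)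
          · exact hl _ hg
          · fun_prop)
        (y := fun z => w z - q.η • ((evalHat (S z) (x z) (b z) (w z)).result f).2)
        (w := fun z => w z - q.η • ((evalHat (S z) (x z) (b z) (w z)).result f).2 +
          q.ζ • (w z - q.η • ((evalHat (S z) (x z) (b z) (w z)).result f).2 - y z))
        (by fun_prop) (by fun_prop)
      simpa [List.map_append] using h3

theorem measurable_neonProc (h : StandingAssumptions μ f x₁ L₁ L₂ G V Δ) (v : NeonVariant) {m : ℕ}
    {S : Z → Fin m → Ξ} (hS : Measurable S) {x : Z → Vec d} (hx : Measurable x) (q : NeonParams)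
    (γ : ℝ) {w : Z → Vec d} (hw : Measurable w) :
    Measurable fun z => (neonProc v q γ (S z) (x z) (w z)).result f := by
  have hb := h.measurable_evalBatch hS hx
  cases v with
  | neon =>
    obtain ⟨l, hl, hlz⟩ := h.exists_measurable_neonLoop hS hx hb q.η (q.t + 1) hw
    simp only [neonProc, neonGD, IFOProg.result_bind, IFOProg.result_pure, hlz]
    exact measurable_selectNC _ _ l hl
  | neonPlus =>
    simp only [neonProc, neonAGD, IFOProg.result_bind]
    exact h.measurable_neonPlusLoop hS hx hb q γ (q.t + 1) [] (by simp) hw hw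

theorem measurable_neonMSGDIter (h : StandingAssumptions μ f x₁ L₁ L₂ G V Δ) (v : NeonVariant)
    (p : MSGDParams) (ε γ : ℝ) : Measurable fun z : Seed d Ξ p × Vec d =>
      (neonMSGDIter v p L₁ L₂ ε γ z.1 z.2).result f := by
  have h1 := h.measurable_batchGrad (Z := Seed d Ξ p × Vec d) (S := fun z => z.1.1) (x := fun z => z.2)
    (by fun_prop) (by fun_prop)
  have h2 := h.measurable_batchGrad (Z := Seed d Ξ p × Vec d) (S := fun z => z.1.2.1)
    (x := fun z => z.2) (by fun_prop) (by fun_prop)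
  have h3 := h.measurable_neonProc (Z := Seed d Ξ p × Vec d) v (S := fun z => z.1.2.2.1)
    (x := fun z => z.2) (w := fun z => p.nc.r • z.1.2.2.2.1) (by fun_prop) (by fun_prop) p.nc γ
    (by fun_prop)
  have h4 : Measurable fun z : Seed d Ξ p × Vec d => if z.1.2.2.2.2 then (1 : ℝ) else -1 :=
    (measurable_from_top (f := fun b : Bool => if b then (1 : ℝ) else -1)).comp (by fun_prop)
  simp only [neonMSGDIter, ncStep, IFOProg.result_bind, apply_ite (IFOProg.result f),
    IFOProg.result_pure, msgd_result, evalBatch_result]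
  refine Measurable.ite (measurableSet_le h2.norm measurable_const) (Measurable.ite ?_ ?_ ?_) ?_
  · exact h3 (measurableSet_singleton 0)
  · exact measurable_inr.comp measurable_snd
  · refine measurable_inl.comp (measurable_snd.sub ?_)
    exact ((h4.const_mul _).div_const _).smul (h3.norm.inv.smul h3)
  · exact measurable_inl.comp (by fun_prop)

end StandingAssumptions

/-! ### Markov chains driven by independent seeds -/

section Chain

variable {S X : Type*} {step : S × X → X} {T : ℕ → (ℕ → S) → X} {x₀ : X}

theorem chain_congr (hT0 : ∀ ω, T 0 ω = x₀) (hT : ∀ n ω, T (n + 1) ω = step (ω n, T n ω)) (n : ℕ)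
    {ω ω' : ℕ → S} (h : ∀ i < n, ω i = ω' i) : T n ω = T n ω' := by
  induction n with
  | zero => rw [hT0, hT0]
  | succ n ih => rw [hT, hT, ih fun i hi => h i (by omega), h n (by omega)]

variable [MeasurableSpace S] [MeasurableSpace X] {ν : Measure S} [IsProbabilityMeasure ν]

theorem measurable_chain (hstep : Measurable step) (hT0 : ∀ ω, T 0 ω = x₀)
    (hT : ∀ n ω, T (n + 1) ω = step (ω n, T n ω)) (n : ℕ) : Measurable (T n) := by
  induction n with
  | zero => rw [funext hT0]; exact measurable_const
  | succ n ih =>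
    rw [funext (hT n)]
    fun_prop

/-- The state at time `n` depends only on the seeds before `n`. It is rewritten through `ext`, which
fills the remaining seeds with an arbitrary `s₀`, as a function of finitely many coordinates not
including `n`. -/
theorem indepFun_chain (hstep : Measurable step) (hT0 : ∀ ω, T 0 ω = x₀)
    (hT : ∀ n ω, T (n + 1) ω = step (ω n, T n ω)) (n : ℕ) :
    IndepFun (fun ω : ℕ → S => ω n) (T n) (Measure.infinitePi fun _ => ν) := by
  classical
  obtain ⟨s₀⟩ : Nonempty S := nonempty_of_isProbabilityMeasure ν
  have h1 := (iIndepFun_infinitePi (P := fun _ : ℕ => ν) (X := fun _ s => s)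
    (fun _ => measurable_id)).indepFun_finset {n} (Finset.range n) (by simp) (by fun_prop)
  let ext : (Finset.range n → S) → ℕ → S := fun g i =>
    if h : i ∈ Finset.range n then g ⟨i, h⟩ else s₀
  have hext : Measurable ext := measurable_pi_lambda _ fun i => by
    by_cases h : i ∈ Finset.range n
    · simpa only [ext, dif_pos h] using measurable_pi_apply _
    · simp only [ext, dif_neg h, measurable_const]
  have hev : Measurable fun g : (({n} : Finset ℕ) → S) => g ⟨n, Finset.mem_singleton_self n⟩ :=
    measurable_pi_apply _
  have h2 := h1.comp (ψ := fun g => T n (ext g)) hev ((measurable_chain hstep hT0 hT n).comp hext)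
  have e : T n = fun ω => T n (ext fun i => ω i) := funext fun ω =>
    chain_congr hT0 hT n fun i hi => by simp [ext, hi]
  rw [e]
  exact h2

/-- The supermartingale inequality for time-dependent functions of the state; independence reduces
each step to an integral over one seed. -/
theorem lintegral_chain_le (hstep : Measurable step) (hT0 : ∀ ω, T 0 ω = x₀)
    (hT : ∀ n ω, T (n + 1) ω = step (ω n, T n ω)) {Ψ : ℕ → X → ENNReal} (hΨ : ∀ n, Measurable (Ψ n))
    {N : ℕ} (h : ∀ n < N, ∀ x, ∫⁻ s, Ψ (n + 1) (step (s, x)) ∂ν ≤ Ψ n x) {n : ℕ} (hn : n ≤ N) :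
    ∫⁻ ω, Ψ n (T n ω) ∂(Measure.infinitePi fun _ => ν) ≤ Ψ 0 x₀ := by
  induction n with
  | zero => simp [hT0]
  | succ n ih =>
    refine le_trans ?_ (ih (by omega))
    have hTm := measurable_chain hstep hT0 hT n
    have hlaw := (indepFun_iff_map_prod_eq_prod_map_map (measurable_pi_apply n).aemeasurable
      hTm.aemeasurable).1 (indepFun_chain (ν := ν) hstep hT0 hT n)
    rw [(measurePreserving_eval_infinitePi (fun _ : ℕ => ν) n).map_eq] at hlaw
    have hm : IsProbabilityMeasure ((Measure.infinitePi fun _ : ℕ => ν).map (T n)) :=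
      Measure.isProbabilityMeasure_map hTm.aemeasurable
    have hF : Measurable fun z : S × X => Ψ (n + 1) (step z) := (hΨ _).comp hstep
    calc ∫⁻ ω, Ψ (n + 1) (T (n + 1) ω) ∂(Measure.infinitePi fun _ => ν)
        = ∫⁻ ω, Ψ (n + 1) (step (ω n, T n ω)) ∂(Measure.infinitePi fun _ => ν) := by simp only [hT]
      _ = ∫⁻ z, Ψ (n + 1) (step z) ∂((Measure.infinitePi fun _ => ν).map fun ω => (ω n, T n ω)) :=
          (lintegral_map hF ((measurable_pi_apply n).prodMk hTm)).symm
      _ = ∫⁻ x, ∫⁻ s, Ψ (n + 1) (step (s, x)) ∂ν ∂((Measure.infinitePi fun _ => ν).map (T n)) := by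
          rw [hlaw, lintegral_prod_symm _ hF.aemeasurable]
      _ ≤ ∫⁻ x, Ψ n x ∂((Measure.infinitePi fun _ => ν).map (T n)) :=
          lintegral_mono fun x => h n (by omega) x
      _ = _ := lintegral_map (hΨ n) hTm

end Chain

/-! ### Descent in pairs -/

/-- The values `b`, `c` of a function at two equally likely new points, compared with the value `a`
at the old point: either a sure decrease by `κ₁`, or an average decrease by `κ₃` with a deviation of
at most `A` from the average. -/
def PairDescent (κ₁ κ₃ A a b c : ℝ) : Prop :=
  (b = c ∧ b ≤ a - κ₁) ∨ (b + c ≤ 2 * a - 2 * κ₃ ∧ |b - c| ≤ 2 * A)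

theorem PairDescent.add_le {κ₁ κ₃ A a b c κ : ℝ} (h : PairDescent κ₁ κ₃ A a b c) (h1 : κ ≤ κ₁)
    (h3 : κ ≤ κ₃) : b + c ≤ 2 * (a - κ) := by
  rcases h with ⟨rfl, h⟩ | ⟨h, -⟩ <;> linarith

/-- The average of the two exponentials is the exponential at the midpoint times cosh of the half
difference. The bound cosh t ≤ exp(t²/2) costs s²A²/2, which `hsA` makes at most half of the average
gain. -/
theorem PairDescent.exp_add_exp_le {κ₁ κ₃ A a b c κ s : ℝ} (h : PairDescent κ₁ κ₃ A a b c)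
    (h1 : κ ≤ κ₁) (h3 : 2 * κ ≤ κ₃) (hs : 0 ≤ s) (hsA : s * A ^ 2 ≤ κ₃) :
    Real.exp (s * b) + Real.exp (s * c) ≤ 2 * Real.exp (s * (a - κ)) := by
  rcases h with ⟨rfl, h⟩ | ⟨h, hA⟩
  · have : Real.exp (s * b) ≤ Real.exp (s * (a - κ)) := Real.exp_le_exp.2 (by gcongr; linarith)
    linarith
  · have e : Real.exp (s * b) + Real.exp (s * c)
        = 2 * (Real.exp (s * ((b + c) / 2)) * Real.cosh (s * ((b - c) / 2))) := by
      rw [Real.cosh_eq]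
      have e1 : s * b = s * ((b + c) / 2) + s * ((b - c) / 2) := by ring
      have e2 : s * c = s * ((b + c) / 2) + -(s * ((b - c) / 2)) := by ring
      rw [e1, e2, Real.exp_add, Real.exp_add]
      ring
    rw [e]
    gcongr
    calc Real.exp (s * ((b + c) / 2)) * Real.cosh (s * ((b - c) / 2))
        ≤ Real.exp (s * ((b + c) / 2)) * Real.exp ((s * ((b - c) / 2)) ^ 2 / 2) := by
          gcongr
          exact Real.cosh_le_exp_half_sq _
      _ = Real.exp (s * ((b + c) / 2) + (s * ((b - c) / 2)) ^ 2 / 2) := (Real.exp_add _ _).symm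
      _ ≤ Real.exp (s * (a - κ)) := by
          refine Real.exp_le_exp.2 ?_
          have h4 : ((b - c) / 2) ^ 2 ≤ A ^ 2 := by
            rw [← sq_abs]
            refine pow_le_pow_left₀ (abs_nonneg _) ?_ 2
            rw [abs_div, abs_two]
            linarith
          have h5 : s * (s * ((b - c) / 2) ^ 2) ≤ s * (s * A ^ 2) := by gcongr
          have h6 : s * (s * A ^ 2) ≤ s * κ₃ := by gcongr
          have h7 : s * ((b + c) / 2) ≤ s * (a - κ₃) := by gcongr; linarith
          have h8 : s * κ ≤ s * (κ₃ / 2) := by gcongr; linarith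
          nlinarith

section Termination

variable {S V : Type*} [MeasurableSpace S] [MeasurableSpace V] {ν : Measure S}
  [IsProbabilityMeasure ν] {flip : S → S} {iter : S × V → V ⊕ V} {T : ℕ → (ℕ → S) → V ⊕ V} {x₀ : V}
  {g : V → ℝ} {P : Set V} {κ₁ κ₃ A p : ℝ}

/-- A step from `x` is good if, for both signs, it returns a point of `P`, or descends in pairs. -/
def IsGoodStep (flip : S → S) (iter : S × V → V ⊕ V) (g : V → ℝ) (P : Set V) (κ₁ κ₃ A : ℝ) (x : V)
    (s : S) : Prop :=
  (∃ y ∈ P, ∃ y' ∈ P, iter (s, x) = Sum.inr y ∧ iter (flip s, x) = Sum.inr y') ∨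
    ∃ z z', iter (s, x) = Sum.inl z ∧ iter (flip s, x) = Sum.inl z' ∧
      PairDescent κ₁ κ₃ A (g x) (g z) (g z')

/-- At a running state, `Ψ n` bounds the failure probability by the potential `φ` plus `p` for each
remaining iteration; at a returned state it is 1 outside `P`. Since the sign flip preserves the law
of the seed, averaging over a seed and its flip turns descent in pairs into a supermartingale. -/
theorem measure_not_terminated_le (hflip : MeasurePreserving flip ν ν) (hiter : Measurable iter)
    (hT0 : ∀ ω, T 0 ω = Sum.inl x₀)
    (hT : ∀ n ω, T (n + 1) ω = Sum.elim (fun x => iter (ω n, x)) Sum.inr (T n ω))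
    (hg : Measurable g) (hg0 : ∀ x, 0 ≤ g x) (hP : MeasurableSet P) (hp : 0 ≤ p)
    (hbad : ∀ x, ν {s | ¬ IsGoodStep flip iter g P κ₁ κ₃ A x s} ≤ ENNReal.ofReal p) (N : ℕ)
    {φ : ℕ → ℝ → ℝ} (hφm : ∀ n, Measurable (φ n)) (hφ0 : ∀ n a, 0 ≤ a → 0 ≤ φ n a)
    (hφ : ∀ n a b c, PairDescent κ₁ κ₃ A a b c → φ (n + 1) b + φ (n + 1) c ≤ 2 * φ n a)
    (hφN : ∀ a, 0 ≤ a → 1 ≤ φ N a) :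
    (Measure.infinitePi fun _ => ν) {ω | ¬ ∃ y ∈ P, T N ω = Sum.inr y}
      ≤ ENNReal.ofReal (φ 0 (g x₀) + N * p) := by
  classical
  -- Truncation at 1 ensures that a bad seed costs no more than its probability, however large the
  -- potential may become.
  let Ψ : ℕ → V ⊕ V → ENNReal := fun n => Sum.elim
    (fun x => min 1 (ENNReal.ofReal (φ n (g x) + (N - n) * p))) (Pᶜ.indicator 1)
  let step : S × (V ⊕ V) → V ⊕ V := fun z => Sum.elim (fun x => iter (z.1, x)) Sum.inr z.2
  have hΨ1 : ∀ n z, Ψ n z ≤ 1 := by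
    rintro n (x | y)
    · exact min_le_left _ _
    · exact Set.indicator_le_self' (fun _ _ => zero_le) y
  have hΨ : ∀ n, Measurable (Ψ n) := fun n => by
    have := hφm n
    exact Measurable.sumElim (by fun_prop) (measurable_one.indicator hP.compl)
  have hstep : Measurable step := by
    have e : step = (Sum.elim iter (fun z => Sum.inr z.2)) ∘
        (MeasurableEquiv.prodSumDistrib S V V) := by
      funext ⟨s, z⟩
      rcases z with x | y <;> rfl
    rw [e]
    exact (hiter.sumElim (measurable_inr.comp measurable_snd)).comp (MeasurableEquiv.measurable _)
  have hchain : ∀ n < N, ∀ x, ∫⁻ s, Ψ (n + 1) (step (s, x)) ∂ν ≤ Ψ n x := by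
    rintro n hn (x | y)
    · set τ : ENNReal := ENNReal.ofReal (φ n (g x) + (N - (n + 1 : ℕ)) * p) with hτ
      have hnN : ((n + 1 : ℕ) : ℝ) ≤ N := by exact_mod_cast hn
      have hNp : 0 ≤ (N - (n + 1 : ℕ)) * p := mul_nonneg (by linarith) hp
      have hm1 : Measurable fun s => Ψ (n + 1) (iter (s, x)) := (hΨ _).comp (by fun_prop)
      have hfl : ∫⁻ s, Ψ (n + 1) (iter (flip s, x)) ∂ν = ∫⁻ s, Ψ (n + 1) (iter (s, x)) ∂ν :=
        hflip.lintegral_comp hm1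
      -- The measurable hull avoids having to prove that goodness is measurable.
      set E := toMeasurable ν {s | ¬ IsGoodStep flip iter g P κ₁ κ₃ A x s} with hE
      have hpt : ∀ s, Ψ (n + 1) (iter (s, x)) + Ψ (n + 1) (iter (flip s, x))
          ≤ 2 * (E.indicator 1 s + τ) := fun s => by
        by_cases hs : s ∈ E
        · rw [Set.indicator_of_mem hs, two_mul]
          exact add_le_add ((hΨ1 _ _).trans le_self_add) ((hΨ1 _ _).trans le_self_add)
        · have hgood : IsGoodStep flip iter g P κ₁ κ₃ A x s := by
            by_contra hcon
            exact hs (subset_toMeasurable _ _ hcon)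
          rw [Set.indicator_of_notMem hs, zero_add]
          rcases hgood with ⟨y, hy, y', hy', h1, h2⟩ | ⟨z, z', h1, h2, h3⟩
          · simp [h1, h2, Ψ, hy, hy']
          · rw [h1, h2]
            refine (add_le_add (min_le_right _ _) (min_le_right _ _)).trans ?_
            have := hφ n _ _ _ h3
            have hz := hφ0 (n + 1) _ (hg0 z)
            have hz' := hφ0 (n + 1) _ (hg0 z')
            rw [← ENNReal.ofReal_add (by positivity) (by positivity), hτ,
              show (2 : ENNReal) = ENNReal.ofReal 2 by simp, ← ENNReal.ofReal_mul zero_le_two]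
            exact ENNReal.ofReal_le_ofReal (by linarith)
      have h2 : 2 * ∫⁻ s, Ψ (n + 1) (iter (s, x)) ∂ν ≤ 2 * (ENNReal.ofReal p + τ) := by
        calc 2 * ∫⁻ s, Ψ (n + 1) (iter (s, x)) ∂ν
            = ∫⁻ s, (Ψ (n + 1) (iter (s, x)) + Ψ (n + 1) (iter (flip s, x))) ∂ν := by
              rw [lintegral_add_left hm1, hfl, two_mul]
          _ ≤ ∫⁻ s, 2 * (E.indicator 1 s + τ) ∂ν := lintegral_mono hpt
          _ = 2 * (ν E + τ) := by
              have hEm : MeasurableSet E := measurableSet_toMeasurable _ _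
              rw [lintegral_const_mul _ ((measurable_one.indicator hEm).add_const _),
                lintegral_add_right _ measurable_const, lintegral_indicator_one hEm]
              simp
          _ ≤ _ := by
              rw [hE, measure_toMeasurable]
              gcongr
              exact hbad x
      have h3 := (ENNReal.mul_le_mul_iff_right two_ne_zero ENNReal.ofNat_ne_top).1 h2
      refine le_min ?_ (h3.trans (le_of_eq ?_))
      · refine (lintegral_mono fun s => hΨ1 _ _).trans ?_
        simp
      · rw [hτ, ← ENNReal.ofReal_add hp (add_nonneg (hφ0 _ _ (hg0 x)) hNp)]
        congr 1
        push_cast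
        ring
    · simp [step, Ψ]
  have hTm := measurable_chain (T := T) (step := step) hstep hT0 hT N
  have hsub : {ω | ¬ ∃ y ∈ P, T N ω = Sum.inr y} ⊆ {ω | 1 ≤ Ψ N (T N ω)} := by
    intro ω hω
    have hω' : ¬ ∃ y ∈ P, T N ω = Sum.inr y := hω
    change 1 ≤ Ψ N (T N ω)
    rcases hTω : T N ω with x | y
    · simp only [Ψ, Sum.elim_inl, sub_self, zero_mul, add_zero, le_min_iff, le_refl, true_and]
      rw [← ENNReal.ofReal_one]
      exact ENNReal.ofReal_le_ofReal (hφN _ (hg0 x))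
    · have hy : y ∉ P := fun hy => hω' ⟨y, hy, hTω⟩
      simp [Ψ, hy]
  calc _ ≤ (Measure.infinitePi fun _ => ν) {ω | 1 ≤ Ψ N (T N ω)} := measure_mono hsub
    _ = 1 * (Measure.infinitePi fun _ => ν) {ω | 1 ≤ Ψ N (T N ω)} := (one_mul _).symm
    _ ≤ ∫⁻ ω, Ψ N (T N ω) ∂(Measure.infinitePi fun _ => ν) :=
      mul_meas_ge_le_lintegral ((hΨ N).comp hTm) 1
    _ ≤ Ψ 0 (Sum.inl x₀) := lintegral_chain_le hstep hT0 hT hΨ hchain le_rfl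
    _ ≤ _ := by
      refine (min_le_right _ _).trans (le_of_eq ?_)
      simp

theorem measure_not_terminated_le_div (hflip : MeasurePreserving flip ν ν) (hiter : Measurable iter)
    (hT0 : ∀ ω, T 0 ω = Sum.inl x₀)
    (hT : ∀ n ω, T (n + 1) ω = Sum.elim (fun x => iter (ω n, x)) Sum.inr (T n ω))
    (hg : Measurable g) (hg0 : ∀ x, 0 ≤ g x) (hP : MeasurableSet P) (hp : 0 ≤ p)
    (hbad : ∀ x, ν {s | ¬ IsGoodStep flip iter g P κ₁ κ₃ A x s} ≤ ENNReal.ofReal p) {N : ℕ}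
    (hN : 0 < N) {κ : ℝ} (hκ : 0 < κ) (h1 : κ ≤ κ₁) (h3 : κ ≤ κ₃) :
    (Measure.infinitePi fun _ => ν) {ω | ¬ ∃ y ∈ P, T N ω = Sum.inr y}
      ≤ ENNReal.ofReal (g x₀ / (N * κ) + N * p) := by
  have hN' : (0 : ℝ) < N := by exact_mod_cast hN
  have h := measure_not_terminated_le hflip hiter hT0 hT hg hg0 hP hp hbad N
    (φ := fun n a => (a + n * κ) / (N * κ)) (fun n => by fun_prop)
    (fun n a ha => by positivity) (fun n a b c habc => by
      have := habc.add_le h1 h3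
      rw [← add_div, ← mul_div_assoc]
      gcongr
      push_cast
      linarith) (fun a ha => by
      rw [le_div_iff₀ (by positivity)]
      linarith)
  simpa using h

theorem measure_not_terminated_le_exp (hflip : MeasurePreserving flip ν ν) (hiter : Measurable iter)
    (hT0 : ∀ ω, T 0 ω = Sum.inl x₀)
    (hT : ∀ n ω, T (n + 1) ω = Sum.elim (fun x => iter (ω n, x)) Sum.inr (T n ω))
    (hg : Measurable g) (hg0 : ∀ x, 0 ≤ g x) (hP : MeasurableSet P) (hp : 0 ≤ p)
    (hbad : ∀ x, ν {s | ¬ IsGoodStep flip iter g P κ₁ κ₃ A x s} ≤ ENNReal.ofReal p) (N : ℕ)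
    {κ s : ℝ} (h1 : κ ≤ κ₁) (h3 : 2 * κ ≤ κ₃) (hs : 0 ≤ s) (hsA : s * A ^ 2 ≤ κ₃) :
    (Measure.infinitePi fun _ => ν) {ω | ¬ ∃ y ∈ P, T N ω = Sum.inr y}
      ≤ ENNReal.ofReal (Real.exp (s * (g x₀ - N * κ)) + N * p) := by
  have h := measure_not_terminated_le hflip hiter hT0 hT hg hg0 hP hp hbad N
    (φ := fun n a => Real.exp (s * (a - (N - n) * κ))) (fun n => by fun_prop)
    (fun n a ha => by positivity) (fun n a b c habc => by
      have := habc.exp_add_exp_le h1 h3 hs hsA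
      have e : ∀ a k : ℝ, Real.exp (s * (a - (N - k) * κ))
          = Real.exp (s * a) * Real.exp (-(s * (N - k) * κ)) := fun a k => by
        rw [← Real.exp_add]; congr 1; ring
      have e2 : Real.exp (s * (a - (N - n) * κ))
          = Real.exp (s * (a - κ)) * Real.exp (-(s * (N - (n + 1 : ℕ)) * κ)) := by
        rw [← Real.exp_add]; congr 1; push_cast; ring
      rw [e b, e c, e2, ← add_mul, ← mul_assoc]
      gcongr) (fun a ha => by
      rw [sub_self, zero_mul, sub_zero]
      exact Real.one_le_exp (by positivity))
  simpa using h

end Termination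

/-! ### Gradient steps and escaping steps -/

theorem IsSmooth.sub_smul_le {d : ℕ} {g : Vec d → ℝ} {L₁ L₂ : ℝ} (hg : IsSmooth g L₁ L₂)
    (hL : 0 < L₁) (x w : Vec d) : g (x - L₁⁻¹ • w)
      ≤ g x - ‖gradient g x‖ ^ 2 / (2 * L₁) + ‖w - gradient g x‖ ^ 2 / (2 * L₁) := by
  have h := hg.le_quadratic x (-(L₁⁻¹ • w))
  rw [← sub_eq_add_neg, inner_neg_right, inner_smul_right, norm_neg, norm_smul,
    Real.norm_of_nonneg (inv_nonneg.2 hL.le)] at h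
  rw [norm_sub_sq_real, real_inner_comm]
  refine h.trans (le_of_eq ?_)
  field_simp
  ring

theorem PairDescent.add_const {κ₁ κ₃ A a b c : ℝ} (h : PairDescent κ₁ κ₃ A a b c) (k : ℝ) :
    PairDescent κ₁ κ₃ A (a + k) (b + k) (c + k) := by
  rcases h with ⟨h1, h2⟩ | ⟨h1, h2⟩
  · exact Or.inl ⟨by rw [h1], by linarith⟩
  · exact Or.inr ⟨by linarith, by rwa [add_sub_add_right_eq_sub]⟩

/-- Averaging over the sign cancels the gradient term. The step length σ = κ/(4L₂) makes the Taylor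
error κσ²/4, half of the quadratic gain κσ²/2. The gradient term survives only in the deviation, as
σε. -/
theorem IsSmooth.pairDescent_escape {d : ℕ} {g : Vec d → ℝ} {L₁ L₂ : ℝ} (hg : IsSmooth g L₁ L₂)
    (hL : 0 < L₂) {x u : Vec d} (hu : ‖u‖ = 1) {ε κ κ₁ t : ℝ} (hx : ‖gradient g x‖ ≤ ε)
    (hκ : 0 ≤ κ) (hH : ⟪u, hess g x u⟫ ≤ -κ) (ht : |t| = κ / (4 * L₂)) :
    PairDescent κ₁ (κ * (κ / (4 * L₂)) ^ 2 / 4)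
      (κ / (4 * L₂) * ε + κ * (κ / (4 * L₂)) ^ 2 / 4) (g x) (g (x - t • u)) (g (x - (-t) • u)) := by
  set σ := κ / (4 * L₂) with hσ
  have hσ0 : 0 ≤ σ := by positivity
  have hLσ : L₂ * σ ^ 3 = κ * σ ^ 2 / 4 := by
    have : L₂ * σ = κ / 4 := by rw [hσ]; field_simp
    calc L₂ * σ ^ 3 = (L₂ * σ) * σ ^ 2 := by ring
      _ = _ := by rw [this]; ring
  have key : ∀ r : ℝ, |r| = σ → |g (x - r • u) - g x + r * ⟪gradient g x, u⟫
      - σ ^ 2 * ⟪u, hess g x u⟫ / 2| ≤ κ * σ ^ 2 / 4 := fun r hr => by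
    have h := hg.abs_sub_quadratic_le hL.le x (-(r • u))
    rw [← sub_eq_add_neg, inner_neg_right, inner_smul_right, norm_neg, norm_smul, hu, mul_one,
      Real.norm_eq_abs, hr, hLσ, map_neg, inner_neg_neg, map_smul, inner_smul_left,
      inner_smul_right] at h
    have e : (starRingEnd ℝ) r * (r * ⟪u, hess g x u⟫) = σ ^ 2 * ⟪u, hess g x u⟫ := by
      rw [← hr, sq_abs, starRingEnd_apply, star_trivial]; ring
    rw [e] at h
    rwa [show g (x - r • u) - g x + r * ⟪gradient g x, u⟫ - σ ^ 2 * ⟪u, hess g x u⟫ / 2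
      = g (x - r • u) - g x - -(r * ⟪gradient g x, u⟫) - σ ^ 2 * ⟪u, hess g x u⟫ / 2 by ring]
  have h1 := abs_le.1 (key t ht)
  have h2 := abs_le.1 (key (-t) (by rwa [abs_neg]))
  have h3 : σ ^ 2 * ⟪u, hess g x u⟫ ≤ σ ^ 2 * -κ := by gcongr
  have h4 : |t * ⟪gradient g x, u⟫| ≤ σ * ε := by
    rw [abs_mul, ht]
    gcongr
    refine (abs_real_inner_le_norm _ _).trans ?_
    rwa [hu, mul_one]
  have h5 := abs_le.1 h4
  refine Or.inr ⟨by linarith [h1.2, h2.2], abs_le.2 ⟨?_, ?_⟩⟩ <;>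
    linarith [h1.1, h1.2, h2.1, h2.2, h5.1, h5.2]

/-! ### Concentration of the mini-batch gradient -/

namespace StandingAssumptions

variable {d : ℕ} {Ξ : Type u} [MeasurableSpace Ξ] {μ : Measure Ξ} [IsProbabilityMeasure μ]
  {f : Vec d → Ξ → ℝ} {x₁ : Vec d} {L₁ L₂ G V Δ σ : ℝ}

omit [IsProbabilityMeasure μ] in
theorem sub_gaussian_of_le (h : StandingAssumptions μ f x₁ L₁ L₂ G V Δ) (hG : 0 < G) (hσ : G ≤ σ)
    (x : Vec d) : ∫⁻ ξ, ENNReal.ofReal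
      (Real.exp (‖sampleGrad f x ξ - gradient (objective μ f) x‖ ^ 2 / σ ^ 2)) ∂μ
        ≤ ENNReal.ofReal (Real.exp 1) := by
  refine (lintegral_mono fun ξ => ENNReal.ofReal_le_ofReal (Real.exp_le_exp.2 ?_)).trans
    (h.sub_gaussian x)
  gcongr

omit [IsProbabilityMeasure μ] in
theorem norm_batchGrad_sub {m : ℕ} (hm : 0 < m) (S : Fin m → Ξ) (x : Vec d) :
    ‖∑ i, (sampleGrad f x (S i) - gradient (objective μ f) x)‖
      = m * ‖batchGrad f S x - gradient (objective μ f) x‖ := by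
  have hm' : (0 : ℝ) < m := by exact_mod_cast hm
  have e : ∀ a : Vec d, (m : ℝ) * ‖a‖ = ‖(m : ℝ) • a‖ := fun a => by
    rw [norm_smul, Real.norm_of_nonneg hm'.le]
  rw [Finset.sum_sub_distrib, Finset.sum_const, Finset.card_univ, Fintype.card_fin, batchGrad,
    ← Nat.cast_smul_eq_nsmul ℝ, e, smul_sub, smul_smul, mul_inv_cancel₀ hm'.ne', one_smul]

theorem measure_batchGrad_le (h : StandingAssumptions μ f x₁ L₁ L₂ G V Δ) (hL : 0 ≤ L₁)
    (hG : 0 < G) (hσ : G ≤ σ) {τ : ℝ} (hτ : 0 ≤ τ) (hτσ : τ ≤ 4 * σ) {m : ℕ} (hm : 0 < m)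
    (x : Vec d) : (Measure.pi fun _ : Fin m => μ)
      {S | ¬ ‖batchGrad f S x - gradient (objective μ f) x‖ ≤ τ}
      ≤ ENNReal.ofReal (2 * Real.exp (-(m * τ ^ 2 / (8 * σ ^ 2)))) := by
  refine (measure_mono fun S hS => ?_).trans (measure_norm_sum_ge_le
    ((h.measurable_sampleGrad x).sub_const _)
    ((h.integrable_sampleGrad x).sub (integrable_const _)) (h.integral_sampleGrad_sub hL x)
    (hG.trans_le hσ) (h.sub_gaussian_of_le hG hσ x) hτ hτσ m)
  have hS' : ¬ ‖batchGrad f S x - gradient (objective μ f) x‖ ≤ τ := hS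
  have e := norm_batchGrad_sub (f := f) (μ := μ) hm S x
  change m * τ ≤ ‖∑ i, (sampleGrad f x (S i) - gradient (objective μ f) x)‖
  rw [e]
  gcongr
  exact (not_le.1 hS').le

theorem lintegral_batchGrad_sq_le (h : StandingAssumptions μ f x₁ L₁ L₂ G V Δ) (hL : 0 ≤ L₁)
    (hG : 0 < G) {m : ℕ} (hm : 0 < m) (x : Vec d) :
    ∫⁻ S, ENNReal.ofReal (‖batchGrad f S x - gradient (objective μ f) x‖ ^ 2)
      ∂(Measure.pi fun _ : Fin m => μ) ≤ ENNReal.ofReal (32 * G ^ 2 / m) := by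
  have hm' : (0 : ℝ) < m := by exact_mod_cast hm
  have key := lintegral_norm_sum_sq_le ((h.measurable_sampleGrad x).sub_const _)
    ((h.integrable_sampleGrad x).sub (integrable_const _)) (h.integral_sampleGrad_sub hL x)
    hG (h.sub_gaussian x) hm
  simp only [norm_batchGrad_sub (f := f) (μ := μ) hm] at key
  have hmeas : Measurable fun S : Fin m → Ξ =>
      ENNReal.ofReal (‖batchGrad f S x - gradient (objective μ f) x‖ ^ 2) := by
    have := h.measurable_batchGrad (Z := Fin m → Ξ) (S := fun S => S) measurable_id
      (x := fun _ => x) measurable_const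
    fun_prop
  simp only [mul_pow, ENNReal.ofReal_mul (sq_nonneg (m : ℝ))] at key
  rw [lintegral_const_mul _ hmeas] at key
  have hm2 : ENNReal.ofReal ((m : ℝ) ^ 2) ≠ 0 := by
    rw [Ne, ENNReal.ofReal_eq_zero, not_le]; positivity
  refine (ENNReal.mul_le_mul_iff_right hm2 ENNReal.ofReal_ne_top).1 (key.trans (le_of_eq ?_))
  rw [← ENNReal.ofReal_mul (by positivity)]
  congr 1
  field_simp

/-- The expected decrease of the stochastic gradient step. -/
theorem integral_msgd_le (h : StandingAssumptions μ f x₁ L₁ L₂ G V Δ) (hL : 0 < L₁) (hG : 0 < G)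
    {m : ℕ} (hm : 0 < m) {e : ℝ} (he : 0 ≤ e) (hme : 64 * G ^ 2 ≤ m * e ^ 2) {x : Vec d}
    (hx : e ≤ ‖gradient (objective μ f) x‖) :
    Integrable (fun S : Fin m → Ξ => objective μ f (x - L₁⁻¹ • batchGrad f S x) - objective μ f x)
      (Measure.pi fun _ => μ) ∧
    ∫ S : Fin m → Ξ, (objective μ f (x - L₁⁻¹ • batchGrad f S x) - objective μ f x)
      ∂(Measure.pi fun _ => μ) ≤ -(e ^ 2 / (4 * L₁)) := by
  have hm' : (0 : ℝ) < m := by exact_mod_cast hm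
  have hF := h.isSmooth_objective hL.le
  have hFc := hF.differentiable.continuous
  have hgm := h.measurable_batchGrad (Z := Fin m → Ξ) (S := fun S => S) measurable_id
      (x := fun _ => x) measurable_const
  have hl := h.lintegral_batchGrad_sq_le hL.le hG hm x
  set F := objective μ f with hFdef
  have hint : Integrable (fun S : Fin m → Ξ => ‖batchGrad f S x - gradient F x‖ ^ 2)
      (Measure.pi fun _ => μ) := by
    refine ⟨by fun_prop, ?_⟩
    rw [hasFiniteIntegral_iff_ofReal (Filter.Eventually.of_forall fun ξ => by positivity)]
    exact hl.trans_lt ENNReal.ofReal_lt_top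
  have hI : ∫ S : Fin m → Ξ, ‖batchGrad f S x - gradient F x‖ ^ 2 ∂(Measure.pi fun _ => μ)
      ≤ 32 * G ^ 2 / m := by
    rw [integral_eq_lintegral_of_nonneg_ae (Filter.Eventually.of_forall fun ξ => by positivity)
      hint.1]
    exact ENNReal.toReal_le_of_le_ofReal (by positivity) hl
  have hup : ∀ S : Fin m → Ξ, F (x - L₁⁻¹ • batchGrad f S x) - F x
      ≤ -(e ^ 2 / (2 * L₁)) + ‖batchGrad f S x - gradient F x‖ ^ 2 / (2 * L₁) := fun S => by
    have h1 := hF.sub_smul_le hL x (batchGrad f S x)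
    have h2 : e ^ 2 / (2 * L₁) ≤ ‖gradient F x‖ ^ 2 / (2 * L₁) := by gcongr
    linarith
  have hbd : Integrable (fun S : Fin m → Ξ =>
      -(e ^ 2 / (2 * L₁)) + ‖batchGrad f S x - gradient F x‖ ^ 2 / (2 * L₁))
      (Measure.pi fun _ => μ) := (integrable_const _).add (hint.div_const _)
  have hmeas : Measurable fun S : Fin m → Ξ => F (x - L₁⁻¹ • batchGrad f S x) - F x := by
    have := hFc.measurable
    fun_prop
  have hres : Integrable (fun S : Fin m → Ξ => F (x - L₁⁻¹ • batchGrad f S x) - F x)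
      (Measure.pi fun _ => μ) := by
    refine (hbd.norm.add (integrable_const |F x - F x₁ + Δ|)).mono' hmeas.aestronglyMeasurable
      (Filter.Eventually.of_forall fun S => ?_)
    simp only [Pi.add_apply, Real.norm_eq_abs]
    have h1 := h.bounded_gap (x - L₁⁻¹ • batchGrad f S x)
    have h2 := hup S
    rw [abs_le]
    constructor
    · linarith [le_abs_self (F x - F x₁ + Δ), abs_nonneg (-(e ^ 2 / (2 * L₁))
        + ‖batchGrad f S x - gradient F x‖ ^ 2 / (2 * L₁))]
    · linarith [abs_nonneg (F x - F x₁ + Δ), le_abs_self (-(e ^ 2 / (2 * L₁))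
        + ‖batchGrad f S x - gradient F x‖ ^ 2 / (2 * L₁))]
  refine ⟨hres, (integral_mono hres hbd hup).trans ?_⟩
  rw [integral_add (integrable_const _) (hint.div_const _), integral_div]
  simp only [integral_const, probReal_univ, one_smul]
  -- The batch size makes the mean squared error at most half of e², so half of the deterministic
  -- gain e²/(2L₁) remains.
  have h3 : (∫ S : Fin m → Ξ, ‖batchGrad f S x - gradient F x‖ ^ 2 ∂(Measure.pi fun _ => μ))
      ≤ e ^ 2 / 2 := by
    refine hI.trans ?_
    rw [div_le_iff₀ hm']
    linarith
  have h4 : (∫ S : Fin m → Ξ, ‖batchGrad f S x - gradient F x‖ ^ 2 ∂(Measure.pi fun _ => μ))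
      / (2 * L₁) ≤ e ^ 2 / 2 / (2 * L₁) := by gcongr
  have h5 : e ^ 2 / 2 / (2 * L₁) = e ^ 2 / (4 * L₁) := by field_simp; ring
  have h6 : e ^ 2 / (2 * L₁) = 2 * (e ^ 2 / (4 * L₁)) := by field_simp; ring
  linarith

end StandingAssumptions

/-! ### One iteration of NEON-MSGD -/

theorem measurePreserving_not_fairCoin : MeasurePreserving not fairCoin fairCoin := by
  refine ⟨measurable_from_top, ?_⟩
  refine Measure.ext_of_singleton fun b => ?_
  rw [Measure.map_apply measurable_from_top (measurableSet_singleton b)]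
  have : not ⁻¹' {b} = {!b} := by ext c; cases b <;> cases c <;> simp
  rw [this, fairCoin, PMF.toMeasure_apply_singleton _ _ (measurableSet_singleton _),
    PMF.toMeasure_apply_singleton _ _ (measurableSet_singleton _)]
  simp

/-- The change of the sign in the randomness of an iteration. -/
def Seed.flip {d : ℕ} {Ξ : Type u} {p : MSGDParams} (s : Seed d Ξ p) : Seed d Ξ p :=
  (s.1, s.2.1, s.2.2.1, s.2.2.2.1, !s.2.2.2.2)

section Iteration

variable {d : ℕ} {Ξ : Type u} [MeasurableSpace Ξ] {μ : Measure Ξ} [IsProbabilityMeasure μ]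
  {p : MSGDParams}

theorem measurePreserving_flip :
    MeasurePreserving (Seed.flip (d := d) (p := p)) (seedLaw μ d p) (seedLaw μ d p) :=
  (MeasurePreserving.id _).prod ((MeasurePreserving.id _).prod ((MeasurePreserving.id _).prod
    ((MeasurePreserving.id _).prod measurePreserving_not_fairCoin)))

theorem seedLaw_fst_le (A : Set (Fin p.m₁ → Ξ)) :
    seedLaw μ d p {s | s.1 ∈ A} ≤ (Measure.pi fun _ => μ) A :=
  measurePreserving_fst.measure_preimage_le A

theorem seedLaw_snd_fst_le (A : Set (Fin p.mc → Ξ)) :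
    seedLaw μ d p {s | s.2.1 ∈ A} ≤ (Measure.pi fun _ => μ) A :=
  (measurePreserving_fst.comp measurePreserving_snd).measure_preimage_le A

theorem seedLaw_samples_le (A : Set (Fin p.m₂ → Ξ)) :
    seedLaw μ d p {s | s.2.2.1 ∈ A} ≤ (Measure.pi fun _ => μ) A :=
  (measurePreserving_fst.comp (measurePreserving_snd.comp measurePreserving_snd)).measure_preimage_le
    A

theorem seedLaw_noise_le (A : Set (Vec d)) :
    seedLaw μ d p {s | s.2.2.2.1 ∈ A} ≤ unitBallLaw d A :=
  (measurePreserving_fst.comp (measurePreserving_snd.comp (measurePreserving_snd.comp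
    measurePreserving_snd))).measure_preimage_le A

/-- Fubini, conditioning on the batch. The set `B`, not known to be measurable, is replaced by the
measurable set of batches whose section has probability at most `q`. -/
theorem seedLaw_samples_noise_le {A : Set ((Fin p.m₂ → Ξ) × Vec d)} (hA : MeasurableSet A)
    {B : Set (Fin p.m₂ → Ξ)} {q : ENNReal} (hB : ∀ S ∈ B, unitBallLaw d {e | (S, e) ∈ A} ≤ q) :
    seedLaw μ d p {s | s.2.2.1 ∈ B ∧ (s.2.2.1, s.2.2.2.1) ∈ A} ≤ q := by
  have hM : Measurable fun S : Fin p.m₂ → Ξ => unitBallLaw d (Prod.mk S ⁻¹' A) :=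
    measurable_measure_prodMk_left hA
  set M := {S : Fin p.m₂ → Ξ | unitBallLaw d (Prod.mk S ⁻¹' A) ≤ q} with hMdef
  have hMm : MeasurableSet M := measurableSet_le hM measurable_const
  have hproj : MeasurePreserving (fun s : Seed d Ξ p => (s.2.2.1, s.2.2.2.1)) (seedLaw μ d p)
      ((Measure.pi fun _ => μ).prod (unitBallLaw d)) :=
    ((MeasurePreserving.id _).prod measurePreserving_fst).comp
      (measurePreserving_snd.comp measurePreserving_snd)
  refine (measure_mono ?_).trans
    ((hproj.measure_preimage_le (A ∩ Prod.fst ⁻¹' M)).trans ?_)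
  · rintro s ⟨h1, h2⟩
    exact ⟨h2, hB _ h1⟩
  · rw [Measure.prod_apply (hA.inter (hMm.preimage measurable_fst))]
    calc _ ≤ ∫⁻ _ : Fin p.m₂ → Ξ, q ∂(Measure.pi fun _ => μ) := by
          refine lintegral_mono fun S => ?_
          by_cases hS : S ∈ M
          · exact (measure_mono fun e he => he.1).trans hS
          · have : Prod.mk S ⁻¹' (A ∩ Prod.fst ⁻¹' M) = ∅ := by
              ext e
              simp [hS]
            rw [this, measure_empty]
            exact zero_le
      _ = q := by simp

variable {f : Vec d → Ξ → ℝ} {x₁ : Vec d} {L₁ L₂ G V Δ : ℝ}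

omit [MeasurableSpace Ξ] in
open Classical in
theorem neonMSGDIter_result (v : NeonVariant) (ε γ : ℝ) (s : Seed d Ξ p) (x : Vec d) :
    (neonMSGDIter v p L₁ L₂ ε γ s x).result f =
      if ‖batchGrad f s.2.1 x‖ ≤ ε then
        if (neonProc v p.nc γ s.2.2.1 x (p.nc.r • s.2.2.2.1)).result f = 0 then Sum.inr x
        else Sum.inl (x - (p.c * γ * (if s.2.2.2.2 then (1 : ℝ) else -1) / L₂) •
          (‖(neonProc v p.nc γ s.2.2.1 x (p.nc.r • s.2.2.2.1)).result f‖⁻¹ •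
            (neonProc v p.nc γ s.2.2.1 x (p.nc.r • s.2.2.2.1)).result f))
      else Sum.inl (x - L₁⁻¹ • batchGrad f s.1 x) := by
  simp only [neonMSGDIter, ncStep, IFOProg.result_bind, apply_ite (IFOProg.result f),
    IFOProg.result_pure, msgd_result, evalBatch_result]

/-- The objective, normalized to be nonnegative. -/
noncomputable def objectiveGap (μ : Measure Ξ) (f : Vec d → Ξ → ℝ) (x₁ : Vec d) (Δ : ℝ) (x : Vec d) : ℝ :=
  objective μ f x + (Δ - objective μ f x₁)

/-- A deterministic statement about one seed. If the gradient test passes, the true gradient is at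
most 5ε/8. A returned point then has curvature at least -γ/2 - κ ≥ -γ, and a direction of curvature
-2κ for the batch has curvature at most -κ for the objective. If the test fails, the gradient
exceeds 3ε/8 and the decrease is at least (9 - 1)ε²/(128L₁). -/
theorem StandingAssumptions.isGoodStep (h : StandingAssumptions μ f x₁ L₁ L₂ G V Δ) (hL₁ : 0 < L₁)
    (hL₂ : 0 < L₂) {v : NeonVariant} (hp : p.Admissible L₁) {ε γ κ ρ α θ R : ℝ} (hκ : 0 < κ)
    (hq : NeonTuning v p.nc L₁ L₂ (γ / 2) ρ α θ (2 * κ) R) (hc : p.c * (γ / 2) = κ / 4)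
    {x : Vec d} {s : Seed d Ξ p} (hε : 0 < ε)
    (h1 : ‖batchGrad f s.1 x - gradient (objective μ f) x‖ ≤ ε / 8)
    (h2 : ‖batchGrad f s.2.1 x - gradient (objective μ f) x‖ ≤ ε / 8)
    (h3 : ∀ w : Vec d, |⟪w, hess (batchMean f s.2.2.1) x w⟫ - ⟪w, hess (objective μ f) x w⟫|
      ≤ κ * ‖w‖ ^ 2)
    (h4 : (neonProc v p.nc (γ / 2) s.2.2.1 x (p.nc.r • s.2.2.2.1)).result f = 0 →
      ∀ w, -(γ / 2) * ‖w‖ ^ 2 ≤ ⟪w, hess (batchMean f s.2.2.1) x w⟫)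
    (h5 : ‖s.2.2.2.1‖ ≤ 1) :
    IsGoodStep Seed.flip (fun z => (neonMSGDIter v p L₁ L₂ (ε / 2) (γ / 2) z.1 z.2).result f)
      (objectiveGap μ f x₁ Δ) {y | IsSecondOrderStationary (objective μ f) ε γ y}
      (ε ^ 2 / (16 * L₁)) (κ * (κ / (4 * L₂)) ^ 2 / 4)
      (κ / (4 * L₂) * ε + κ * (κ / (4 * L₂)) ^ 2 / 4) x s := by
  have hF := h.isSmooth_objective hL₁.le
  unfold IsGoodStep
  simp only [neonMSGDIter_result, Seed.flip]
  set F := objective μ f with hFdef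
  set w := (neonProc v p.nc (γ / 2) s.2.2.1 x (p.nc.r • s.2.2.2.1)).result f with hw
  have hκγ : 2 * (2 * κ) ≤ γ / 2 := hq.κ_le
  by_cases hg : ‖batchGrad f s.2.1 x‖ ≤ ε / 2
  · have hgF : ‖gradient F x‖ ≤ ε := by
      have := norm_sub_norm_le (gradient F x) (batchGrad f s.2.1 x)
      rw [norm_sub_rev] at this
      linarith
    rw [if_pos hg]
    by_cases hw0 : w = 0
    · refine Or.inl ⟨x, ?_, x, ?_, if_pos hw0, by rw [if_pos hg, if_pos hw0]⟩ <;>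
      · refine ⟨hgF, fun u => ?_⟩
        have h6 := h4 hw0 u
        have h7 := (abs_le.1 (h3 u)).2
        have h8 : κ * ‖u‖ ^ 2 ≤ γ / 2 * ‖u‖ ^ 2 := by gcongr; linarith
        linarith
    · refine Or.inr ⟨_, _, if_neg hw0, by rw [if_pos hg, if_neg hw0], ?_⟩
      have hu : ‖p.nc.r • s.2.2.2.1‖ ≤ p.nc.r := by
        rw [norm_smul, Real.norm_of_nonneg hq.r_nonneg]
        exact mul_le_of_le_one_right hq.r_nonneg h5
      have hs := hq.sound h.isSmooth hp.m₂_pos hL₁.le hL₂.le hp.ζ_pos hu hw0 (S := s.2.2.1) (x := x)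
      rw [← hw] at hs
      have hwn : 0 < ‖w‖ := norm_pos_iff.2 hw0
      have h6 := (abs_le.1 (h3 w)).1
      have h7 : ⟪‖w‖⁻¹ • w, hess F x (‖w‖⁻¹ • w)⟫ ≤ -κ := by
        rw [map_smul, inner_smul_left, inner_smul_right, starRingEnd_apply, star_trivial]
        have h8 : ⟪w, hess F x w⟫ ≤ -κ * ‖w‖ ^ 2 := by linarith
        calc ‖w‖⁻¹ * (‖w‖⁻¹ * ⟪w, hess F x w⟫) ≤ ‖w‖⁻¹ * (‖w‖⁻¹ * (-κ * ‖w‖ ^ 2)) := by gcongr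
          _ = -κ := by field_simp
      have hunit : ‖‖w‖⁻¹ • w‖ = 1 := by simpa using norm_smul_inv_norm (𝕜 := ℝ) hw0
      have key : ∀ b : Bool, p.c * (γ / 2) * (if (!b) then (1 : ℝ) else -1) / L₂
          = -(p.c * (γ / 2) * (if b then (1 : ℝ) else -1) / L₂) := fun b => by
        cases b <;> simp [neg_div]
      rw [key]
      refine (hF.pairDescent_escape hL₂ hunit hgF hκ.le h7 ?_).add_const _
      rw [hc]
      have h9 : |κ / 4 / L₂| = κ / (4 * L₂) := by
        rw [abs_of_pos (by positivity)]; field_simp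
      rw [← h9, mul_div_right_comm, abs_mul]
      split_ifs <;> simp
  · rw [if_neg hg]
    refine Or.inr ⟨_, _, rfl, if_neg hg, ?_⟩
    refine PairDescent.add_const (Or.inl ⟨rfl, ?_⟩) _
    have h6 := hF.sub_smul_le hL₁ x (batchGrad f s.1 x)
    have h7 := norm_sub_norm_le (batchGrad f s.2.1 x) (gradient F x)
    have h8 : (3 * ε / 8) ^ 2 ≤ ‖gradient F x‖ ^ 2 := by
      gcongr
      linarith
    have h9 : ‖batchGrad f s.1 x - gradient F x‖ ^ 2 ≤ (ε / 8) ^ 2 := by gcongr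
    have h10 : ‖gradient F x‖ ^ 2 / (2 * L₁) ≥ (3 * ε / 8) ^ 2 / (2 * L₁) := by gcongr
    have h11 : ‖batchGrad f s.1 x - gradient F x‖ ^ 2 / (2 * L₁) ≤ (ε / 8) ^ 2 / (2 * L₁) := by
      gcongr
    have h12 : (3 * ε / 8) ^ 2 / (2 * L₁) = 9 * (ε ^ 2 / (128 * L₁)) := by field_simp; ring
    have h13 : (ε / 8) ^ 2 / (2 * L₁) = ε ^ 2 / (128 * L₁) := by field_simp; ring
    have h14 : ε ^ 2 / (16 * L₁) = 8 * (ε ^ 2 / (128 * L₁)) := by field_simp; ring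
    linarith

/-- A union bound over the two gradient batches, the Hessian batch and the noise direction; noise
outside the unit ball has probability zero. -/
theorem StandingAssumptions.seedLaw_not_isGoodStep_le (h : StandingAssumptions μ f x₁ L₁ L₂ G V Δ)
    (hL₁ : 0 < L₁) (hL₂ : 0 < L₂) (hG : 0 < G) (hd : 1 ≤ d) {v : NeonVariant} (hp : p.Admissible L₁)
    {ε γ κ ρ a θ R σ : ℝ} (hκ : 0 < κ) (ha : 0 < a)
    (hq : NeonTuning v p.nc L₁ L₂ (γ / 2) ρ (p.nc.r * a) θ (2 * κ) R)
    (hc : p.c * (γ / 2) = κ / 4) (hε : 0 < ε) (hσ : G ≤ σ) (hεσ : ε ≤ 32 * σ) (P : ℕ) (x : Vec d) :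
    seedLaw μ d p {s | ¬ IsGoodStep Seed.flip
      (fun z => (neonMSGDIter v p L₁ L₂ (ε / 2) (γ / 2) z.1 z.2).result f)
      (objectiveGap μ f x₁ Δ) {y | IsSecondOrderStationary (objective μ f) ε γ y}
      (ε ^ 2 / (16 * L₁)) (κ * (κ / (4 * L₂)) ^ 2 / 4)
      (κ / (4 * L₂) * ε + κ * (κ / (4 * L₂)) ^ 2 / 4) x s} ≤
    ENNReal.ofReal (2 * Real.exp (-(p.m₁ * (ε / 8) ^ 2 / (8 * σ ^ 2)))) +
    ENNReal.ofReal (2 * Real.exp (-(p.mc * (ε / 8) ^ 2 / (8 * σ ^ 2)))) +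
    ENNReal.ofReal (d * (32 * P ^ 2 * L₁ ^ 2 / (p.m₂ * κ ^ 2)) ^ P) +
    ENNReal.ofReal (12 * d * a) := by
  set A₁ := {S : Fin p.m₁ → Ξ | ¬ ‖batchGrad f S x - gradient (objective μ f) x‖ ≤ ε / 8}
  set A₂ := {S : Fin p.mc → Ξ | ¬ ‖batchGrad f S x - gradient (objective μ f) x‖ ≤ ε / 8}
  set A₃ := {S : Fin p.m₂ → Ξ | ¬ ∀ w : Vec d,
    |⟪w, hess (batchMean f S) x w⟫ - ⟪w, hess (objective μ f) x w⟫| ≤ κ * ‖w‖ ^ 2}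
  set B := {S : Fin p.m₂ → Ξ | ¬ ∀ w, -(γ / 2) * ‖w‖ ^ 2 ≤ ⟪w, hess (batchMean f S) x w⟫}
  set A₄ := {z : (Fin p.m₂ → Ξ) × Vec d |
    (neonProc v p.nc (γ / 2) z.1 x (p.nc.r • z.2)).result f = 0}
  set A₅ := {e : Vec d | ¬ ‖e‖ ≤ 1}
  have e1 := (seedLaw_fst_le (d := d) (μ := μ) A₁).trans
    (h.measure_batchGrad_le hL₁.le hG hσ (by positivity) (by linarith) hp.m₁_pos x)
  have e2 := (seedLaw_snd_fst_le (d := d) (μ := μ) A₂).trans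
    (h.measure_batchGrad_le hL₁.le hG hσ (by positivity) (by linarith) hp.mc_pos x)
  have e3 := (seedLaw_samples_le (d := d) (μ := μ) A₃).trans
    (h.measure_hess_batchMean_le hL₁.le x P hp.m₂_pos hκ)
  have hA₄ : MeasurableSet A₄ :=
    (h.measurable_neonProc (Z := (Fin p.m₂ → Ξ) × Vec d) v (S := fun z => z.1) (x := fun _ => x)
      (w := fun z => p.nc.r • z.2) (by fun_prop) (by fun_prop) p.nc (γ / 2) (by fun_prop))
      (measurableSet_singleton 0)
  have e4 := seedLaw_samples_noise_le (μ := μ) hA₄ (B := B) (q := ENNReal.ofReal (12 * d * a))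
    fun S hS => hq.unitBallLaw_eq_zero_le hd ha h.isSmooth hp.m₂_pos hL₁.le hL₂.le hp.ζ_pos hS
  have e5 : seedLaw μ d p {s | s.2.2.2.1 ∈ A₅} ≤ 0 :=
    (seedLaw_noise_le (μ := μ) A₅).trans (ae_iff.1 (ae_norm_le_one_unitBallLaw d)).le
  refine (measure_mono (t := {s : Seed d Ξ p | s.1 ∈ A₁} ∪ {s : Seed d Ξ p | s.2.1 ∈ A₂} ∪
    {s : Seed d Ξ p | s.2.2.1 ∈ A₃} ∪
    {s : Seed d Ξ p | s.2.2.1 ∈ B ∧ (s.2.2.1, s.2.2.2.1) ∈ A₄} ∪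
    {s : Seed d Ξ p | s.2.2.2.1 ∈ A₅}) ?_).trans ?_
  · intro s hs
    by_contra hcon
    simp only [Set.mem_union, not_or] at hcon
    obtain ⟨⟨⟨⟨c1, c2⟩, c3⟩, c4⟩, c5⟩ := hcon
    refine hs (h.isGoodStep hL₁ hL₂ hp hκ hq hc hε (not_not.1 c1) (not_not.1 c2) (not_not.1 c3)
      (fun hw => ?_) (not_not.1 c5))
    by_contra hB
    exact c4 ⟨hB, hw⟩
  · refine (measure_union_le _ _).trans ?_
    rw [← add_zero (_ + ENNReal.ofReal (12 * d * a))]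
    refine add_le_add ((measure_union_le _ _).trans (add_le_add ?_ e4)) e5
    refine (measure_union_le _ _).trans (add_le_add ?_ e3)
    exact (measure_union_le _ _).trans (add_le_add e1 e2)

end Iteration

/-! ### All iterations -/

section Run

variable {d : ℕ} {Ξ : Type u} [MeasurableSpace Ξ] {μ : Measure Ξ} [IsProbabilityMeasure μ]
  {p : MSGDParams} {f : Vec d → Ξ → ℝ} {x₁ : Vec d} {L₁ L₂ G V Δ : ℝ}

theorem IsSmooth.measurableSet_isSecondOrderStationary {g : Vec d → ℝ} (hg : IsSmooth g L₁ L₂)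
    (ε γ : ℝ) : MeasurableSet {y | IsSecondOrderStationary g ε γ y} := by
  have h1 := hg.continuous_gradient
  have h2 := hg.continuous_hess
  have : {y | IsSecondOrderStationary g ε γ y}
      = {y | ‖gradient g y‖ ≤ ε} ∩ ⋂ v : Vec d, {y | -γ * ‖v‖ ^ 2 ≤ ⟪v, hess g y v⟫} := by
    ext y
    simp [IsSecondOrderStationary]
  rw [this]
  exact ((isClosed_le (by fun_prop) (by fun_prop)).inter (isClosed_iInter fun v =>
    isClosed_le (by fun_prop) (by fun_prop))).measurableSet

omit [MeasurableSpace Ξ] in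
theorem neonMSGD_succ_result (v : NeonVariant) (ε γ : ℝ) (ω : ℕ → Seed d Ξ p) (n : ℕ) :
    (neonMSGD v p L₁ L₂ ε γ x₁ ω (n + 1)).result f
      = Sum.elim (fun x => (neonMSGDIter v p L₁ L₂ ε γ (ω n) x).result f) Sum.inr
        ((neonMSGD v p L₁ L₂ ε γ x₁ ω n).result f) := by
  simp only [neonMSGD, IFOProg.result_bind]
  cases (neonMSGD v p L₁ L₂ ε γ x₁ ω n).result f <;> rfl

theorem StandingAssumptions.runLaw_not_terminated_le (h : StandingAssumptions μ f x₁ L₁ L₂ G V Δ)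
    (hL₁ : 0 < L₁) {v : NeonVariant} {ε γ κ₁ κ₃ A q : ℝ} (hq : 0 ≤ q)
    (hbad : ∀ x, seedLaw μ d p {s | ¬ IsGoodStep Seed.flip
      (fun z => (neonMSGDIter v p L₁ L₂ (ε / 2) (γ / 2) z.1 z.2).result f)
      (objectiveGap μ f x₁ Δ) {y | IsSecondOrderStationary (objective μ f) ε γ y}
      κ₁ κ₃ A x s} ≤ ENNReal.ofReal q) {N : ℕ} (hN : 0 < N) {κ s : ℝ} (hκ : 0 < κ) (h1 : κ ≤ κ₁)
    (h3 : 2 * κ ≤ κ₃) (hs : 0 ≤ s) (hsA : s * A ^ 2 ≤ κ₃) :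
    runLaw μ d p {ω | ¬ ∃ y, IsSecondOrderStationary (objective μ f) ε γ y ∧
        (neonMSGD v p L₁ L₂ (ε / 2) (γ / 2) x₁ ω N).result f = Sum.inr y} ≤
      ENNReal.ofReal (min (Δ / (N * κ)) (Real.exp (s * (Δ - N * κ))) + N * q) := by
  have hF := h.isSmooth_objective hL₁.le
  have hgm : Measurable (objectiveGap μ f x₁ Δ) :=
    (hF.differentiable.continuous.add continuous_const).measurable
  have hg0 : ∀ x, 0 ≤ objectiveGap μ f x₁ Δ x := fun x => by
    have := h.bounded_gap x
    unfold objectiveGap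
    linarith
  have hg1 : objectiveGap μ f x₁ Δ x₁ = Δ := by unfold objectiveGap; ring
  have hit := h.measurable_neonMSGDIter v p (ε / 2) (γ / 2)
  have hP := hF.measurableSet_isSecondOrderStationary ε γ
  rcases min_choice (Δ / (N * κ)) (Real.exp (s * (Δ - N * κ))) with hm | hm <;> rw [hm]
  · have := measure_not_terminated_le_div (measurePreserving_flip (μ := μ) (d := d) (p := p)) hit
      (T := fun n ω => (neonMSGD v p L₁ L₂ (ε / 2) (γ / 2) x₁ ω n).result f) (fun _ => rfl)
      (fun n ω => neonMSGD_succ_result v _ _ ω n) hgm hg0 hP hq hbad hN hκ h1 (by linarith)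
    rw [hg1] at this
    exact this
  · have := measure_not_terminated_le_exp (measurePreserving_flip (μ := μ) (d := d) (p := p)) hit
      (T := fun n ω => (neonMSGD v p L₁ L₂ (ε / 2) (γ / 2) x₁ ω n).result f) (fun _ => rfl)
      (fun n ω => neonMSGD_succ_result v _ _ ω n) hgm hg0 hP hq hbad N h1 h3 hs hsA
    rw [hg1] at this
    exact this

end Run

/-! ### Parameters of the negative-curvature procedures -/

theorem pow_le_one_add_pow {β Y : ℝ} (hβ : 0 < β) (hβ1 : β ≤ 1) (hY : 0 < Y) {T : ℕ}
    (hT : 56 * Real.log Y ≤ β * T) : Y ^ 28 ≤ (1 + β) ^ T := by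
  have h1 : Real.exp (β / 2) ≤ 1 + β := by
    have h2 := Real.one_sub_le_exp_neg (β / 2)
    have h3 : Real.exp (β / 2) * Real.exp (-(β / 2)) = 1 := by rw [← Real.exp_add]; simp
    have h4 := Real.exp_pos (β / 2)
    have h5 : Real.exp (β / 2) * (1 - β / 2) ≤ 1 :=
      (mul_le_mul_of_nonneg_left h2 h4.le).trans h3.le
    nlinarith
  calc Y ^ 28 = Real.exp (28 * Real.log Y) := by
        rw [mul_comm, Real.exp_mul, Real.exp_log hY]
        norm_cast
    _ ≤ Real.exp (T * (β / 2)) := Real.exp_le_exp.2 (by linarith)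
    _ = Real.exp (β / 2) ^ T := Real.exp_nat_mul _ _
    _ ≤ _ := by gcongr

/-- All radii are powers of the tiny number `y`, spaced so that every Taylor error carries a spare
power of `y`, which absorbs constants and iteration counts. The threshold nearly saturates `F_le`,
with ratio 7/8. The essential restriction on κ is `hκW`, where the powers of `y` cancel. -/
theorem neonTuning_of_pow {v : NeonVariant} {q : NeonParams} {L₁ L₂ B γ y θ W κ : ℝ}
    (hgr : match v with
    | .neon => θ = 1 ∧ y ^ 30 < (1 + q.η * (γ / 2) / 2) ^ (q.t + 1) * (q.r * y ^ 22)
    | .neonPlus => q.ζ = 1 - θ ∧ θ ≤ 1 / 3 ∧ 6 * θ ^ 2 ≤ q.η * (γ / 2) ∧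
        q.ζ ^ 2 * (1 + q.η * (γ / 2)) ≤ 1 - θ ∧
        y ^ 30 < (1 + θ) ^ (q.t + 1) * (θ * (q.r * y ^ 22)) ∧
        2 * (q.r + (q.t + 2) * √(6 * q.η * q.Fthr)) ≤ 6 * y ^ 30 * W)
    (hB : 10 ^ 9 ≤ B) (hL₁ : 0 < L₁) (hL₁B : L₁ ≤ B) (hL₂B : L₂ ≤ B) (hy : 0 < y)
    (hγ : 0 < γ) (hγ1 : γ ≤ 1) (hyB : B * y ≤ γ) (hθ : y ^ 2 ≤ θ) (hθ1 : θ ≤ 1)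
    (hT : ((q.t + 1 : ℕ) : ℝ) * y ^ 4 ≤ 1) (hW1 : 1 ≤ W) (hW : W * y ^ 2 ≤ 1)
    (hη : q.η = 1 / (16 * B)) (hF : q.Fthr = θ * (y ^ 30) ^ 2 * B / (2 * (q.t + 1 : ℕ)))
    (hU : q.U = 6 * y ^ 30) (hr : q.r = y ^ 33) (hκ0 : 0 ≤ κ) (hκ : κ ≤ γ / 8)
    (hκW : 72 * ((q.t + 1 : ℕ) : ℝ) * W ^ 2 * κ ≤ θ * B) :
    NeonTuning v q L₁ L₂ (γ / 2) (y ^ 30) (q.r * y ^ 22) θ (2 * κ) (6 * y ^ 30 * W) := by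
  have hB0 : 0 < B := by linarith
  have hT0 : (0 : ℝ) < (q.t + 1 : ℕ) := by positivity
  set T : ℝ := ((q.t + 1 : ℕ) : ℝ) with hTdef
  have hθ0 : 0 < θ := lt_of_lt_of_le (by positivity) hθ
  have hy1 : 10 ^ 9 * y ≤ 1 := by nlinarith
  have hy2 : y ≤ 1 := by linarith
  have hyp : ∀ n : ℕ, y ^ (n + 1) ≤ y / 1 := fun n => by
    rw [div_one, pow_succ]
    exact mul_le_of_le_one_left hy.le (pow_le_one₀ hy.le hy2)
  have hL₂y : L₂ * y ≤ γ := le_trans (by gcongr) hyB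
  have hW0 : 0 < W := by linarith
  have hW3 : W ^ 3 * y ^ 6 ≤ 1 := by
    calc W ^ 3 * y ^ 6 = (W * y ^ 2) ^ 3 := by ring
      _ ≤ 1 := pow_le_one₀ (by positivity) hW
  refine
    { η_pos := by rw [hη]; positivity
      η_le := by rw [hη, div_mul_eq_mul_div, div_le_one (by positivity)]; linarith
      γ_pos := by positivity
      ρ_pos := by positivity
      α_pos := by rw [hr]; positivity
      F_pos := by rw [hF]; positivity
      r_nonneg := by rw [hr]; positivity
      r_le := ?_
      r_sq_le := ?_
      θ_pos := hθ0
      θ_le := hθ1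
      F_le := ?_
      U_eq := hU
      U_le := ?_
      ρ_sq_le := ?_
      R_cube_le := ?_
      κ_nonneg := by positivity
      κ_mul_le := ?_
      R_le := ?_
      κ_le := by linarith
      growth := hgr }
  · rw [hr]
    calc y ^ 33 = y ^ 30 * y ^ 3 := by ring
      _ ≤ y ^ 30 * (1 / 2) := by
          gcongr
          have := hyp 2
          linarith
      _ = _ := by ring
  · rw [hr, hF, ← mul_div_assoc, le_div_iff₀ (by positivity)]
    calc L₁ * (y ^ 33) ^ 2 * (2 * T) = 2 * (y ^ 2 * L₁) * (T * y ^ 4) * (y ^ 30) ^ 2 := by ring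
      _ ≤ 2 * (θ * B) * 1 * (y ^ 30) ^ 2 := by gcongr
      _ = _ := by ring
  · rw [hη, hF]
    have : 28 * (1 / (16 * B)) * (θ * (y ^ 30) ^ 2 * B / (2 * T)) * T
        = 7 / 8 * (θ * (y ^ 30) ^ 2) := by field_simp; norm_num
    rw [this]
    have : 0 ≤ θ * (y ^ 30) ^ 2 := by positivity
    linarith
  · rw [hU]
    exact le_mul_of_one_le_right (by positivity) hW1
  · rw [hr]
    calc 18 * L₂ * (y ^ 30) ^ 2 = 18 * (L₂ * y) * y ^ 4 * (y ^ 33 * y ^ 22) := by ring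
      _ ≤ 18 * γ * (1 / 36) * (y ^ 33 * y ^ 22) := by
          gcongr
          have := hyp 3
          linarith
      _ = _ := by ring
  · rw [hF, le_div_iff₀ (by positivity)]
    calc L₂ * (6 * y ^ 30 * W) ^ 3 * (2 * T)
        = L₂ * (W ^ 3 * y ^ 6) * (T * y ^ 4) * (432 * y ^ 18) * y ^ 2 * (y ^ 30) ^ 2 := by ring
      _ ≤ B * 1 * 1 * 1 * θ * (y ^ 30) ^ 2 := by
          gcongr
          have := hyp 17
          linarith
      _ = _ := by ring
  · rw [hF, ← mul_div_assoc, le_div_iff₀ (by positivity)]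
    calc 2 * κ * (6 * y ^ 30 * W) ^ 2 * (2 * T) = 2 * (72 * T * W ^ 2 * κ) * (y ^ 30) ^ 2 := by ring
      _ ≤ 2 * (θ * B) * (y ^ 30) ^ 2 := by gcongr
      _ = _ := by ring
  · calc 6 * L₂ * (6 * y ^ 30 * W) = 36 * (L₂ * y) * (W * y ^ 2) * y ^ 27 := by ring
      _ ≤ 36 * γ * 1 * (1 / 72) := by
          gcongr
          have := hyp 26
          linarith
      _ = _ := by ring

-- Growth by Y²⁸ carries the noise component y⁵⁵ beyond the radius y³⁰, including the loss θ ≥ y²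
-- with momentum. The number T of steps is about log Y/γ or log Y/√γ. The momentum case needs 72T²κ
-- ≤ B, and T² of order log²Y/γ explains the squared logarithm in κ.
set_option maxHeartbeats 1000000 in
theorem exists_neonParams (v : NeonVariant) {L₁ L₂ B γ Y : ℝ}
    (hB : 10 ^ 9 ≤ B) (hL₁ : 0 < L₁) (hL₁B : L₁ ≤ B) (hL₂B : L₂ ≤ B)
    (hγ : 0 < γ) (hγ1 : γ ≤ 1) (hY : B ≤ γ * Y) (hℓ : 1 ≤ Real.log Y) :
    ∃ (q : NeonParams) (θ R : ℝ), NeonTuning v q L₁ L₂ (γ / 2) (Y⁻¹ ^ 30) (q.r * Y⁻¹ ^ 22) θ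
        (2 * (γ / (3 * 10 ^ 8 * Real.log Y ^ 2))) R ∧ 0 < q.ζ ∧ q.ζ < 1 ∧ 0 < q.r ∧
      ((2 * q.t + 4 : ℕ) : ℝ) ≤ 3 * 10 ^ 4 * B * Real.log Y * (γ ^ 2 * neonRate v γ) := by
  have hB0 : 0 < B := by linarith
  have hYB : B ≤ Y := by
    have : 0 < Y := by
      by_contra hcon
      nlinarith
    nlinarith
  have hY0 : 0 < Y := by linarith
  set ℓ := Real.log Y with hℓdef
  have hℓY : ℓ ≤ Y := (Real.log_le_sub_one_of_pos hY0).trans (by linarith)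
  obtain ⟨y, hydef⟩ : ∃ y, y = Y⁻¹ := ⟨_, rfl⟩
  have hy : 0 < y := by rw [hydef]; positivity
  have hYy : Y * y = 1 := by rw [hydef]; exact mul_inv_cancel₀ hY0.ne'
  have hyB : B * y ≤ γ := by
    calc B * y ≤ γ * Y * y := by gcongr
      _ = γ := by rw [mul_assoc, hYy, mul_one]
  have hy1 : 10 ^ 9 * y ≤ 1 := by nlinarith
  have hy2 : y ^ 2 ≤ y / 10 ^ 9 := by nlinarith
  rw [← hydef]
  set κ := γ / (3 * 10 ^ 8 * ℓ ^ 2) with hκ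
  have hκ0 : 0 ≤ κ := by positivity
  have hκγ : κ ≤ γ / 8 := by
    rw [hκ]
    gcongr
    nlinarith
  have hTex : ∀ β : ℝ, 0 < β → β ≤ 1 → ∃ t : ℕ, 56 * ℓ ≤ β * ((t + 1 : ℕ) : ℝ) ∧
      β * ((t + 1 : ℕ) : ℝ) ≤ 57 * ℓ := fun β hβ hβ1 => by
    have h0 : 0 < ⌈56 * ℓ / β⌉₊ := Nat.ceil_pos.2 (by positivity)
    refine ⟨⌈56 * ℓ / β⌉₊ - 1, ?_, ?_⟩ <;> rw [Nat.sub_add_cancel h0]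
    · rw [← div_le_iff₀' hβ]
      exact Nat.le_ceil _
    · have h1 := (Nat.ceil_lt_add_one (show 0 ≤ 56 * ℓ / β by positivity)).le
      calc β * (⌈56 * ℓ / β⌉₊ : ℝ) ≤ β * (56 * ℓ / β + 1) := by gcongr
        _ = 56 * ℓ + β := by field_simp
        _ ≤ _ := by linarith
  have hYpow : ∀ (T : ℕ) (β : ℝ), Y ^ 28 ≤ (1 + β) ^ T → 1 ≤ (1 + β) ^ T * y ^ 28 := fun T β h => by
    calc (1 : ℝ) = Y ^ 28 * y ^ 28 := by rw [← mul_pow, hYy, one_pow]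
      _ ≤ _ := by gcongr
  have hTy : ∀ T : ℝ, T ≤ 7296 * ℓ * Y → T * y ^ 4 ≤ 1 := fun T hT => by
    calc T * y ^ 4 ≤ 7296 * Y * Y * y ^ 4 := by
          gcongr
          exact hT.trans (by gcongr)
      _ = 7296 * (Y * y) ^ 2 * y ^ 2 := by ring
      _ = 7296 * y ^ 2 := by rw [hYy, one_pow, mul_one]
      _ ≤ 1 := by linarith
  have hcast : ∀ t : ℕ, ((2 * t + 4 : ℕ) : ℝ) ≤ 4 * ((t + 1 : ℕ) : ℝ) := fun t => by
    push_cast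
    linarith [(Nat.cast_nonneg t : (0 : ℝ) ≤ t)]
  cases v with
  | neon =>
    -- The guaranteed growth rate of gradient descent, η(γ/2)/2 with η = 1/(16B).
    obtain ⟨β, hβ⟩ : ∃ β, β = γ / (64 * B) := ⟨_, rfl⟩
    have hβ0 : 0 < β := by rw [hβ]; positivity
    have hβ1 : β ≤ 1 := by rw [hβ, div_le_one (by positivity)]; linarith
    obtain ⟨t, ht1, ht2⟩ := hTex β hβ0 hβ1
    have hT : ((t + 1 : ℕ) : ℝ) ≤ 3648 * B * ℓ / γ := by
      rw [hβ, div_mul_eq_mul_div, div_le_iff₀ (by positivity)] at ht2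
      rw [le_div_iff₀ hγ]
      linarith
    have hBγ : B / γ ≤ Y := by rw [div_le_iff₀ hγ]; linarith
    refine ⟨⟨t, 1 / (16 * B), 1 * (y ^ 30) ^ 2 * B / (2 * (t + 1 : ℕ)), 6 * y ^ 30, y ^ 33, 1 / 2⟩, 1,
      6 * y ^ 30 * 1, neonTuning_of_pow ⟨rfl, ?_⟩ hB hL₁ hL₁B hL₂B hy hγ hγ1 hyB (by nlinarith)
        le_rfl (hTy _ ?_) le_rfl (by nlinarith) rfl rfl rfl rfl hκ0 hκγ ?_, by norm_num, by norm_num,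
        by positivity, ?_⟩
    · have hpow := hYpow (t + 1) β (pow_le_one_add_pow hβ0 hβ1 hY0 ht1)
      have e : 1 / (16 * B) * (γ / 2) / 2 = β := by rw [hβ]; field_simp; norm_num
      simp only [e]
      calc y ^ 30 = 1 * y ^ 30 := (one_mul _).symm
        _ ≤ (1 + β) ^ (t + 1) * y ^ 28 * y ^ 30 := by gcongr
        _ = (1 + β) ^ (t + 1) * (y ^ 33 * y ^ 22) * y ^ 3 := by ring
        _ < (1 + β) ^ (t + 1) * (y ^ 33 * y ^ 22) * 1 := by
            gcongr
            exact pow_lt_one₀ hy.le (by linarith) (by norm_num)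
        _ = _ := mul_one _
    · refine hT.trans ?_
      calc 3648 * B * ℓ / γ = 3648 * ℓ * (B / γ) := by ring
        _ ≤ 3648 * ℓ * Y := by gcongr
        _ ≤ _ := by gcongr; norm_num
    · calc 72 * ((t + 1 : ℕ) : ℝ) * 1 ^ 2 * κ ≤ 72 * (3648 * B * ℓ / γ) * 1 ^ 2 * κ := by gcongr
        _ = 262656 / (3 * 10 ^ 8 * ℓ) * B := by rw [hκ]; field_simp; norm_num
        _ ≤ 1 * B := by
            gcongr
            rw [div_le_one (by positivity)]
            linarith
    · refine (hcast t).trans ?_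
      have e : γ ^ 2 * neonRate .neon γ = 1 / γ := by simp only [neonRate]; field_simp
      rw [e]
      calc 4 * ((t + 1 : ℕ) : ℝ) ≤ 4 * (3648 * B * ℓ / γ) := by gcongr
        _ = 14592 * B * ℓ * (1 / γ) := by ring
        _ ≤ _ := by gcongr; norm_num
  | neonPlus =>
    -- Chosen so that η(γ/2) = 16θ². This exceeds the 6θ² needed for growth, and with θ ≤ 1/16 the
    -- energy still dissipates.
    obtain ⟨θ, hθ⟩ : ∃ θ, θ = √(γ / (32 * B)) / 4 := ⟨_, rfl⟩
    have hθ0 : 0 < θ := by rw [hθ]; positivity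
    have hθsq : θ ^ 2 = γ / (512 * B) := by
      rw [hθ, div_pow, Real.sq_sqrt (by positivity)]
      field_simp
      norm_num
    have hθ16 : θ ≤ 1 / 16 := by
      refine (sq_le_sq₀ hθ0.le (by norm_num)).1 ?_
      rw [hθsq, div_le_iff₀ (by positivity)]
      linarith
    have hθinv : 1 ≤ 128 * Y * θ := by
      have h1 : 1 ≤ (128 * Y) ^ 2 * θ ^ 2 := by
        rw [hθsq]
        have h2 : (128 * Y) ^ 2 * (γ / (512 * B)) = 32 * Y * (γ * Y) / B := by field_simp; ring
        rw [h2, le_div_iff₀ hB0]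
        nlinarith
      rw [← mul_pow] at h1
      exact (one_le_sq_iff₀ (by positivity)).1 h1
    have hθinv' : √γ ≤ 128 * B * θ := by
      rw [Real.sqrt_le_left (by positivity), mul_pow, hθsq]
      have : (128 * B) ^ 2 * (γ / (512 * B)) = 32 * B * γ := by field_simp; ring
      rw [this]
      nlinarith
    have hθy : y ^ 2 ≤ θ := by
      have : y ≤ 128 * θ := by
        calc y = y * 1 := (mul_one y).symm
          _ ≤ y * (128 * Y * θ) := by gcongr
          _ = (Y * y) * (128 * θ) := by ring
          _ = _ := by rw [hYy, one_mul]
      linarith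
    obtain ⟨t, ht1, ht2⟩ := hTex θ hθ0 (by linarith)
    set T : ℝ := ((t + 1 : ℕ) : ℝ) with hTdef
    have hT0 : 0 < T := by positivity
    have hTY : T ≤ 7296 * ℓ * Y := by
      calc T = T * 1 := (mul_one T).symm
        _ ≤ T * (128 * Y * θ) := by gcongr
        _ = 128 * Y * (θ * T) := by ring
        _ ≤ 128 * Y * (57 * ℓ) := by gcongr
        _ = _ := by ring
    -- T steps of length √(6ηF), with F of order θρ²B/T, cover a distance of order ρ√(θT); this is
    -- how far the candidates of NEON⁺ may lie beyond the radius ρ.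
    obtain ⟨W, hW⟩ : ∃ W, W = √(θ * T) := ⟨_, rfl⟩
    have hWsq : W ^ 2 = θ * T := by rw [hW, Real.sq_sqrt (by positivity)]
    have hW1 : 1 ≤ W := by rw [hW]; exact Real.one_le_sqrt.2 (by linarith)
    have hηγ : 1 / (16 * B) * (γ / 2) = 16 * θ ^ 2 := by rw [hθsq]; field_simp; norm_num
    refine ⟨⟨t, 1 / (16 * B), θ * (y ^ 30) ^ 2 * B / (2 * (t + 1 : ℕ)), 6 * y ^ 30, y ^ 33, 1 - θ⟩, θ,
      6 * y ^ 30 * W, neonTuning_of_pow ⟨rfl, by linarith, ?_, ?_, ?_, ?_⟩ hB hL₁ hL₁B hL₂B hy hγ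
        hγ1 hyB hθy (by linarith) (hTy _ hTY) hW1 ?_ rfl rfl rfl rfl hκ0 hκγ ?_, ?_, ?_,
        by positivity, ?_⟩
    · simp only [hηγ]
      nlinarith
    · simp only [hηγ]
      have h1 : (1 - θ) * (1 + 16 * θ ^ 2) ≤ 1 := by
        have h2 : (1 - θ) * (1 + 16 * θ ^ 2) = 1 - 16 * (θ * (1 / 16 - θ)) - 16 * θ ^ 3 := by ring
        have h3 := mul_nonneg hθ0.le (sub_nonneg.2 hθ16)
        have h4 := pow_pos hθ0 3
        linarith
      calc (1 - θ) ^ 2 * (1 + 16 * θ ^ 2) = (1 - θ) * ((1 - θ) * (1 + 16 * θ ^ 2)) := by ring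
        _ ≤ (1 - θ) * 1 := by
            gcongr
            linarith
        _ = _ := mul_one _
    · have hpow := hYpow (t + 1) θ (pow_le_one_add_pow hθ0 (by linarith) hY0 ht1)
      simp only
      calc y ^ 30 = 1 * y ^ 30 := (one_mul _).symm
        _ ≤ (1 + θ) ^ (t + 1) * y ^ 28 * y ^ 30 := by gcongr
        _ = (1 + θ) ^ (t + 1) * (y ^ 2 * (y ^ 33 * y ^ 22)) * y := by ring
        _ < (1 + θ) ^ (t + 1) * (y ^ 2 * (y ^ 33 * y ^ 22)) * 1 := by
            gcongr
            linarith
        _ ≤ _ := by rw [mul_one]; gcongr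
    · have h1 : √(6 * (1 / (16 * B)) * (θ * (y ^ 30) ^ 2 * B / (2 * T))) ≤ y ^ 30 * W / T := by
        rw [Real.sqrt_le_left (by positivity), div_pow, mul_pow, hWsq]
        have h2 : 6 * (1 / (16 * B)) * (θ * (y ^ 30) ^ 2 * B / (2 * T))
          = 3 / 16 * ((y ^ 30) ^ 2 * (θ * T) / T ^ 2) := by field_simp; norm_num
        rw [h2]
        have : 0 ≤ (y ^ 30) ^ 2 * (θ * T) / T ^ 2 := by positivity
        linarith
      have h3 : (t : ℝ) + 2 ≤ 2 * T := by
        rw [hTdef]; push_cast; linarith [(Nat.cast_nonneg t : (0 : ℝ) ≤ t)]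
      have h4 : ((t : ℝ) + 2) * √(6 * (1 / (16 * B)) * (θ * (y ^ 30) ^ 2 * B / (2 * T)))
          ≤ 2 * T * (y ^ 30 * W / T) := by gcongr
      have h5 : 2 * T * (y ^ 30 * W / T) = 2 * (y ^ 30 * W) := by field_simp
      have h6 : y ^ 33 ≤ y ^ 30 * W := by
        calc y ^ 33 ≤ y ^ 30 := pow_le_pow_of_le_one hy.le (by linarith) (by norm_num)
          _ ≤ _ := le_mul_of_one_le_right (by positivity) hW1
      simp only
      linarith
    · refine (sq_le_sq₀ (by positivity) zero_le_one).1 ?_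
      calc (W * y ^ 2) ^ 2 = θ * (T * y ^ 4) := by rw [mul_pow, hWsq]; ring
        _ ≤ 1 * 1 := by gcongr; linarith; exact hTy _ hTY
        _ = _ := by norm_num
    · have h1 : 72 * T ^ 2 * κ ≤ B := by
        have h2 : T ^ 2 ≤ (57 * ℓ) ^ 2 * (512 * B / γ) := by
          calc T ^ 2 = (θ * T) ^ 2 * (512 * B / γ) := by rw [mul_pow, hθsq]; field_simp
            _ ≤ _ := by gcongr
        calc 72 * T ^ 2 * κ ≤ 72 * ((57 * ℓ) ^ 2 * (512 * B / γ)) * κ := by gcongr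
          _ = 119771136 / (3 * 10 ^ 8) * B := by rw [hκ]; field_simp; norm_num
          _ ≤ B := by norm_num; linarith
      rw [hWsq]
      calc 72 * T * (θ * T) * κ = θ * (72 * T ^ 2 * κ) := by ring
        _ ≤ _ := by gcongr
    · simp only; linarith
    · simp only; linarith
    · refine (hcast t).trans ?_
      have e : γ ^ 2 * neonRate .neonPlus γ = 1 / √γ := by simp only [neonRate]; field_simp
      rw [e, mul_one_div, le_div_iff₀ (by positivity)]
      calc 4 * ((t + 1 : ℕ) : ℝ) * √γ ≤ 4 * T * (128 * B * θ) := by gcongr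
        _ = 512 * B * (θ * T) := by ring
        _ ≤ 512 * B * (57 * ℓ) := by gcongr
        _ = 29184 * B * ℓ := by ring
        _ ≤ _ := by gcongr; norm_num

/-! ### The number of iterations -/

set_option maxHeartbeats 1000000 in
theorem exists_iterations {L₁ L₂ B Δ ε γ δ Y ℓ κ : ℝ} (hB : 10 ^ 9 ≤ B) (hL₁ : 0 < L₁)
    (hL₁B : L₁ ≤ B) (hL₂ : 0 < L₂) (hL₂B : L₂ ≤ B) (hL₂B' : 1 ≤ B * L₂) (hΔB : Δ ≤ B)
    (hε : 0 < ε) (hε1 : ε < 1) (hγ : 0 < γ) (hγ1 : γ < 1) (hδ : 0 < δ) (hδ1 : δ < 1)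
    (hY : B ≤ Y * (ε * γ * δ)) (hℓ : ℓ = Real.log Y) (hℓ1 : 1 ≤ ℓ)
    (hκ : κ = γ / (3 * 10 ^ 8 * ℓ ^ 2)) :
    ∃ (N : ℕ) (κm s : ℝ), 0 < N ∧ 0 < κm ∧ κm ≤ ε ^ 2 / (16 * L₁) ∧
      2 * κm ≤ κ * (κ / (4 * L₂)) ^ 2 / 4 ∧ 0 ≤ s ∧
      s * (κ / (4 * L₂) * ε + κ * (κ / (4 * L₂)) ^ 2 / 4) ^ 2 ≤ κ * (κ / (4 * L₂)) ^ 2 / 4 ∧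
      min (Δ / (N * κm)) (Real.exp (s * (Δ - N * κm))) + N * Y⁻¹ ^ 20 ≤ δ ∧
      (N : ℝ) ≤ 2 * 10 ^ 37 * B ^ 4 * ℓ ^ 9 * (1 + min (1 / δ) (ε ^ 2 / γ)) *
        max (1 / ε ^ 2) (1 / γ ^ 3) := by
  have hB0 : 0 < B := by linarith
  have hκ0 : 0 < κ := by rw [hκ]; positivity
  have hκγ : κ ≤ 1 := by
    rw [hκ, div_le_one (by positivity)]
    nlinarith
  have hεγδ : ε * γ * δ ≤ 1 := mul_le_one₀ (mul_le_one₀ hε1.le hγ.le hγ1.le) hδ.le hδ1.le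
  have hεγδ0 : 0 < ε * γ * δ := by positivity
  have hY0 : 0 < Y := by
    by_contra hcon
    nlinarith
  have hBY : B ≤ Y := hY.trans (mul_le_of_le_one_right hY0.le hεγδ)
  have hYδ : B ≤ Y * δ := hY.trans (by
    gcongr
    exact mul_le_of_le_one_left hδ.le (mul_le_one₀ hε1.le hγ.le hγ1.le))
  have hδℓ : Real.log (2 / δ) ≤ ℓ := by
    rw [hℓ]
    refine Real.log_le_log (by positivity) ?_
    rw [div_le_iff₀ hδ]
    linarith
  have hℓY : ℓ ≤ Y := hℓ ▸ (Real.log_le_sub_one_of_pos hY0).trans (by linarith)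
  obtain ⟨σ, hσ⟩ : ∃ σ, σ = κ / (4 * L₂) := ⟨_, rfl⟩
  have hσ0 : 0 < σ := by rw [hσ]; positivity
  rw [← hσ]
  obtain ⟨κ₃, hκ₃⟩ : ∃ κ₃, κ₃ = κ * σ ^ 2 / 4 := ⟨_, rfl⟩
  have hκ₃0 : 0 < κ₃ := by rw [hκ₃]; positivity
  rw [← hκ₃]
  have hκ₃B : κ₃ ≤ B ^ 2 := by
    have h1 : σ ≤ B := by
      rw [hσ, div_le_iff₀ (by positivity)]
      linarith
    rw [hκ₃]
    calc κ * σ ^ 2 / 4 ≤ 1 * B ^ 2 / 4 := by gcongr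
      _ ≤ B ^ 2 := by linarith [sq_nonneg B]
  obtain ⟨A, hA⟩ : ∃ A, A = σ * ε + κ₃ := ⟨_, rfl⟩
  have hA0 : 0 < A := by rw [hA]; positivity
  rw [← hA]
  -- The largest exponent allowed by the cosh estimate.
  obtain ⟨s, hs⟩ : ∃ s, s = κ₃ / A ^ 2 := ⟨_, rfl⟩
  have hs0 : 0 < s := by rw [hs]; positivity
  obtain ⟨κm, hκm⟩ : ∃ κm, κm = min (ε ^ 2 / (16 * L₁)) (κ₃ / 2) := ⟨_, rfl⟩
  have hκm0 : 0 < κm := by rw [hκm]; exact lt_min (by positivity) (by positivity)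
  obtain ⟨M, hM⟩ : ∃ M, M = max (1 / ε ^ 2) (1 / γ ^ 3) := ⟨_, rfl⟩
  have hM1 : 1 / ε ^ 2 ≤ M := hM ▸ le_max_left _ _
  have hM2 : 1 / γ ^ 3 ≤ M := hM ▸ le_max_right _ _
  have hM0 : 0 < M := lt_of_lt_of_le (by positivity) hM1
  have hM' : 1 ≤ M := le_trans (one_le_one_div (by positivity) (pow_le_one₀ hε.le hε1.le)) hM1
  rw [← hM]
  obtain ⟨r, hr⟩ : ∃ r, r = 1 + min (1 / δ) (ε ^ 2 / γ) := ⟨_, rfl⟩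
  have hr1 : 1 ≤ r := by
    have : 0 ≤ min (1 / δ) (ε ^ 2 / γ) := le_min (by positivity) (by positivity)
    linarith
  rw [← hr]
  -- The total decrease to be paid for: the first entry makes the linear bound at most δ/2, the
  -- second the exponential one. Since 1/s = A²/κ₃ is at most 8ε²/κ + 2κ₃, their minimum is what
  -- produces the factor `r`.
  obtain ⟨N₀, hN₀⟩ : ∃ N₀, N₀ = min (2 * B / δ) (B + ℓ / s) := ⟨_, rfl⟩
  have hN₀0 : 0 < N₀ := by rw [hN₀]; exact lt_min (by positivity) (by positivity)
  have hN₀r : N₀ ≤ 3 * 10 ^ 9 * B ^ 2 * ℓ ^ 3 * r := by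
    have hBℓ : B ≤ B ^ 2 * ℓ ^ 3 := by
      calc B = B * 1 * 1 := by ring
        _ ≤ B * B * ℓ ^ 3 := by gcongr; linarith; exact one_le_pow₀ hℓ1
        _ = _ := by ring
    rw [hr, mul_add, mul_one, mul_min_of_nonneg _ _ (by positivity), ← min_add_add_left, hN₀]
    refine min_le_min ?_ ?_
    · calc 2 * B / δ = 2 * B * (1 / δ) := by ring
        _ ≤ 3 * 10 ^ 9 * (B ^ 2 * ℓ ^ 3) * (1 / δ) := by gcongr; norm_num
        _ = 3 * 10 ^ 9 * B ^ 2 * ℓ ^ 3 * (1 / δ) := by ring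
        _ ≤ _ := le_add_of_nonneg_left (by positivity)
    · have h1 : A ^ 2 ≤ κ₃ * (8 * ε ^ 2 / κ + 2 * κ₃) := by
        have h2 : κ₃ * (8 * ε ^ 2 / κ + 2 * κ₃) = 2 * (σ * ε) ^ 2 + 2 * κ₃ ^ 2 := by
          rw [hκ₃]; field_simp; ring
        rw [h2, hA]
        nlinarith [sq_nonneg (σ * ε - κ₃)]
      have h3 : ℓ / s ≤ ℓ * (8 * ε ^ 2 / κ + 2 * B ^ 2) := by
        rw [hs, div_div_eq_mul_div, div_le_iff₀ hκ₃0]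
        calc ℓ * A ^ 2 ≤ ℓ * (κ₃ * (8 * ε ^ 2 / κ + 2 * κ₃)) := by gcongr
          _ ≤ ℓ * (κ₃ * (8 * ε ^ 2 / κ + 2 * B ^ 2)) := by gcongr
          _ = _ := by ring
      have h4 : ℓ * (8 * ε ^ 2 / κ) = 24 * 10 ^ 8 * ℓ ^ 3 * (ε ^ 2 / γ) := by
        rw [hκ]; field_simp; norm_num
      have h5 : ℓ * (2 * B ^ 2) ≤ 2 * (B ^ 2 * ℓ ^ 3) := by
        have : ℓ ≤ ℓ ^ 3 := le_self_pow₀ hℓ1 (by norm_num)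
        calc ℓ * (2 * B ^ 2) = 2 * (B ^ 2 * ℓ) := by ring
          _ ≤ _ := by gcongr
      have h6 : 24 * 10 ^ 8 * ℓ ^ 3 * (ε ^ 2 / γ) ≤ 3 * 10 ^ 9 * B ^ 2 * ℓ ^ 3 * (ε ^ 2 / γ) := by
        gcongr
        · norm_num
        · nlinarith
      linarith [show 0 ≤ B ^ 2 * ℓ ^ 3 by positivity]
  have hκmD : 1 ≤ κm * (4 * 10 ^ 27 * B ^ 2 * ℓ ^ 6 * M) := by
    rw [hκm, min_mul_of_nonneg _ _ (by positivity)]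
    refine le_min ?_ ?_
    · calc (1 : ℝ) = 1 * (ε ^ 2 * (1 / ε ^ 2)) := by field_simp
        _ ≤ (4 * 10 ^ 27 * B ^ 2 * ℓ ^ 6 / (16 * L₁)) * (ε ^ 2 * M) := by
            gcongr
            rw [one_le_div₀ (by positivity)]
            have h1 : B ≤ B ^ 2 := le_self_pow₀ (by linarith) two_ne_zero
            have h2 : B ^ 2 ≤ B ^ 2 * ℓ ^ 6 :=
              le_mul_of_one_le_right (by positivity) (one_le_pow₀ hℓ1)
            linarith
        _ = _ := by ring
    · have h1 : κ₃ / 2 = γ ^ 3 / (128 * (3 * 10 ^ 8) ^ 3 * ℓ ^ 6 * L₂ ^ 2) := by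
        rw [hκ₃, hσ, hκ]; field_simp; norm_num
      rw [h1]
      calc (1 : ℝ) = 1 * (γ ^ 3 * (1 / γ ^ 3)) := by field_simp
        _ ≤ (4 * 10 ^ 27 * B ^ 2 / (128 * (3 * 10 ^ 8) ^ 3 * L₂ ^ 2)) * (γ ^ 3 * M) := by
            gcongr
            rw [one_le_div₀ (by positivity)]
            have : L₂ ^ 2 ≤ B ^ 2 := by gcongr
            norm_num
            linarith
        _ = _ := by field_simp
  obtain ⟨N, hN⟩ : ∃ N : ℕ, N = ⌈N₀ / κm⌉₊ := ⟨_, rfl⟩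
  have hN1 : N₀ ≤ N * κm := by
    rw [← div_le_iff₀ hκm0, hN]
    exact Nat.le_ceil _
  have hN0 : 0 < N := by rw [hN]; exact Nat.ceil_pos.2 (by positivity)
  have hNle : (N : ℝ) ≤ 2 * 10 ^ 37 * B ^ 4 * ℓ ^ 9 * r * M := by
    have h1 : (N : ℝ) ≤ N₀ / κm + 1 := by
      rw [hN]
      exact (Nat.ceil_lt_add_one (by positivity)).le
    have h2 : N₀ / κm ≤ 12 * 10 ^ 36 * (B ^ 4 * ℓ ^ 9 * r * M) := by
      rw [div_le_iff₀ hκm0]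
      calc N₀ = N₀ * 1 := (mul_one _).symm
        _ ≤ 3 * 10 ^ 9 * B ^ 2 * ℓ ^ 3 * r * (κm * (4 * 10 ^ 27 * B ^ 2 * ℓ ^ 6 * M)) := by gcongr
        _ = _ := by ring
    have h3 : 1 ≤ B ^ 4 * ℓ ^ 9 * r * M := by
      have h4 : 1 ≤ B ^ 4 := one_le_pow₀ (by linarith)
      have h5 : 1 ≤ ℓ ^ 9 := one_le_pow₀ hℓ1
      exact one_le_mul_of_one_le_of_one_le (one_le_mul_of_one_le_of_one_le
        (one_le_mul_of_one_le_of_one_le h4 h5) hr1) hM'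
    linarith
  refine ⟨N, κm, s, hN0, hκm0, hκm ▸ min_le_left _ _, ?_, hs0.le, ?_, ?_, hNle⟩
  · have : κm ≤ κ₃ / 2 := hκm ▸ min_le_right _ _
    linarith
  · rw [hs, div_mul_cancel₀ _ (by positivity)]
  · have hN' : (0 : ℝ) < N := by exact_mod_cast hN0
    have h1 : min (Δ / (N * κm)) (Real.exp (s * (Δ - N * κm))) ≤ δ / 2 := by
      rcases min_choice (2 * B / δ) (B + ℓ / s) with h | h
      · rw [hN₀, h, div_le_iff₀ hδ] at hN1
        refine (min_le_left _ _).trans ?_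
        rw [div_le_iff₀ (by positivity)]
        linarith
      · rw [hN₀, h] at hN1
        refine (min_le_right _ _).trans ?_
        have h2 : s * (Δ - N * κm) ≤ -Real.log (2 / δ) := by
          calc s * (Δ - N * κm) ≤ s * (-(ℓ / s)) := by gcongr; linarith
            _ = -ℓ := by field_simp
            _ ≤ _ := neg_le_neg hδℓ
        calc Real.exp (s * (Δ - N * κm)) ≤ Real.exp (-Real.log (2 / δ)) := Real.exp_le_exp.2 h2
          _ = δ / 2 := by rw [Real.exp_neg, Real.exp_log (by positivity), inv_div]
    -- The number of iterations is polynomial in Y with degree below 20, and `hY` turns the powers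
    -- of 1/ε, 1/γ and 1/δ into powers of Y.
    have h2 : N * Y⁻¹ ^ 20 ≤ δ / 2 := by
      have hM3 : M ≤ 1 / (ε * γ * δ) ^ 3 * δ ^ 3 := by
        have e : 1 / (ε * γ * δ) ^ 3 * δ ^ 3 = 1 / (ε ^ 3 * γ ^ 3) := by field_simp
        rw [e, hM]
        refine max_le ?_ ?_
        · refine one_div_le_one_div_of_le (by positivity) ?_
          calc ε ^ 3 * γ ^ 3 = ε ^ 2 * (ε * γ ^ 3) := by ring
            _ ≤ ε ^ 2 * 1 := by
              gcongr
              exact mul_le_one₀ hε1.le (by positivity) (pow_le_one₀ hγ.le hγ1.le)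
            _ = _ := mul_one _
        · exact one_div_le_one_div_of_le (by positivity)
            (mul_le_of_le_one_left (by positivity) (pow_le_one₀ hε.le hε1.le))
      have hBM : B ^ 3 * M ≤ Y ^ 3 * δ ^ 3 := by
        calc B ^ 3 * M ≤ (Y * (ε * γ * δ)) ^ 3 * (1 / (ε * γ * δ) ^ 3 * δ ^ 3) := by gcongr
          _ = _ := by field_simp
      have hrδ : r * δ ≤ 2 := by
        have : min (1 / δ) (ε ^ 2 / γ) * δ ≤ 1 := by
          calc _ ≤ 1 / δ * δ := by gcongr; exact min_le_left _ _
            _ = 1 := by field_simp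
        rw [hr]
        linarith
      rw [inv_pow, ← div_eq_mul_inv, div_le_iff₀ (by positivity)]
      calc (N : ℝ) ≤ 2 * 10 ^ 37 * B ^ 4 * ℓ ^ 9 * r * M := hNle
        _ = 2 * 10 ^ 37 * B * ℓ ^ 9 * r * (B ^ 3 * M) := by ring
        _ ≤ 2 * 10 ^ 37 * B * Y ^ 9 * r * (Y ^ 3 * δ ^ 3) := by gcongr
        _ = 2 * 10 ^ 37 * B * Y ^ 12 * (r * δ) * δ * δ := by ring
        _ ≤ 2 * 10 ^ 37 * Y * Y ^ 12 * 2 * 1 * δ := by gcongr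
        _ = 8 * 10 ^ 37 * Y ^ 13 * (δ / 2) := by ring
        _ ≤ Y ^ 7 * Y ^ 13 * (δ / 2) := by
            gcongr
            calc (8 * 10 ^ 37 : ℝ) ≤ (10 ^ 9) ^ 7 := by norm_num
              _ ≤ Y ^ 7 := by gcongr; linarith
        _ = _ := by ring
    linarith

/-! ### The failure probability of an iteration -/

/-- Each of the four terms is at most a quarter of the right side. The constant 10752 = 21 · 8 · 64
makes each gradient exponential at most Y⁻²¹. The constant 96 = 3 · 32 brings the base of the
Hessian term below 1/3 ≤ 1/e, so that its power is at most Y⁻²², and the factor d ≤ Y is absorbed.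
-/
theorem failure_sum_le {L₁ B ε κ Y : ℝ} {d m m₂ P : ℕ} (hB : 10 ^ 9 ≤ B) (hL₁ : 0 < L₁)
    (hL₁B : L₁ ≤ B) (hε : 0 < ε) (hκ : 0 < κ) (hd : (d : ℝ) ≤ Y) (hY : 10 ^ 9 ≤ Y)
    (hm : 10752 * B ^ 2 * Real.log Y / ε ^ 2 ≤ m) (hP : 22 * Real.log Y ≤ P)
    (hm₂ : 96 * P ^ 2 * B ^ 2 / κ ^ 2 ≤ m₂) (hm₂0 : 0 < m₂) :
    ENNReal.ofReal (2 * Real.exp (-(m * (ε / 8) ^ 2 / (8 * B ^ 2)))) +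
    ENNReal.ofReal (2 * Real.exp (-(m * (ε / 8) ^ 2 / (8 * B ^ 2)))) +
    ENNReal.ofReal (d * (32 * P ^ 2 * L₁ ^ 2 / (m₂ * κ ^ 2)) ^ P) +
    ENNReal.ofReal (12 * d * Y⁻¹ ^ 22) ≤ ENNReal.ofReal (Y⁻¹ ^ 20) := by
  have hB0 : 0 < B := by linarith
  have hY0 : 0 < Y := by linarith
  have hm₂' : (0 : ℝ) < m₂ := by exact_mod_cast hm₂0
  have hexp : ∀ (k : ℕ) (a : ℝ), k * Real.log Y ≤ a → Real.exp (-a) ≤ Y⁻¹ ^ k := fun k a h => by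
    calc Real.exp (-a) ≤ Real.exp (-(k * Real.log Y)) := Real.exp_le_exp.2 (neg_le_neg h)
      _ = Y⁻¹ ^ k := by
        rw [← mul_neg, Real.exp_nat_mul, Real.exp_neg, Real.exp_log hY0]
  obtain ⟨y, hy⟩ : ∃ y, y = Y⁻¹ := ⟨_, rfl⟩
  have hy0 : 0 < y := by rw [hy]; positivity
  have hYy : Y * y = 1 := by rw [hy]; exact mul_inv_cancel₀ hY0.ne'
  have hy1 : 10 ^ 9 * y ≤ 1 := by nlinarith
  have hdy : d * y ≤ 1 := hYy ▸ (by gcongr)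
  rw [← hy] at hexp ⊢
  have h1 : 2 * Real.exp (-(m * (ε / 8) ^ 2 / (8 * B ^ 2))) ≤ y ^ 20 / 4 := by
    have h2 := hexp 21 (m * (ε / 8) ^ 2 / (8 * B ^ 2)) (by
      rw [le_div_iff₀ (by positivity)]
      rw [div_le_iff₀ (by positivity)] at hm
      push_cast
      linarith)
    calc 2 * Real.exp (-(m * (ε / 8) ^ 2 / (8 * B ^ 2))) ≤ 2 * y ^ 21 := by gcongr
      _ = (2 * y) * y ^ 20 := by ring
      _ ≤ 1 / 4 * y ^ 20 := by gcongr; linarith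
      _ = _ := by ring
  have h3 : d * (32 * P ^ 2 * L₁ ^ 2 / (m₂ * κ ^ 2)) ^ P ≤ y ^ 20 / 4 := by
    have h4 : 32 * (P : ℝ) ^ 2 * L₁ ^ 2 / (m₂ * κ ^ 2) ≤ Real.exp (-1) := by
      have h5 : (1 : ℝ) / 3 ≤ Real.exp (-1) := by
        rw [Real.exp_neg, one_div]
        exact inv_anti₀ (Real.exp_pos 1) Real.exp_one_lt_three.le
      refine le_trans ?_ h5
      rw [div_le_iff₀ (by positivity)]
      rw [div_le_iff₀ (by positivity)] at hm₂
      have : 32 * (P : ℝ) ^ 2 * L₁ ^ 2 ≤ 32 * P ^ 2 * B ^ 2 := by gcongr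
      linarith
    have h6 : Real.exp (-1) ^ P ≤ y ^ 22 := by
      rw [← Real.exp_nat_mul, mul_neg, mul_one]
      exact hexp 22 P (by exact_mod_cast hP)
    calc d * (32 * P ^ 2 * L₁ ^ 2 / (m₂ * κ ^ 2)) ^ P ≤ d * Real.exp (-1) ^ P := by gcongr
      _ ≤ d * y ^ 22 := by gcongr
      _ = (d * y) * y * y ^ 20 := by ring
      _ ≤ 1 * (1 / 4) * y ^ 20 := by gcongr; linarith
      _ = _ := by ring
  have h7 : 12 * d * y ^ 22 ≤ y ^ 20 / 4 := by
    calc 12 * d * y ^ 22 = (d * y) * (12 * y) * y ^ 20 := by ring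
      _ ≤ 1 * (1 / 4) * y ^ 20 := by gcongr; linarith
      _ = _ := by ring
  rw [← ENNReal.ofReal_add (by positivity) (by positivity),
    ← ENNReal.ofReal_add (by positivity) (by positivity),
    ← ENNReal.ofReal_add (by positivity) (by positivity)]
  exact ENNReal.ofReal_le_ofReal (by linarith)

/-! ### The main theorem -/

theorem natCeil_le_add {a b : ℝ} (ha : 0 ≤ a) (hb : 1 ≤ b) : (⌈a⌉₊ : ℝ) ≤ a + b :=
  (Nat.ceil_lt_add_one ha).le.trans (by linarith)

set_option maxHeartbeats 1000000 in
theorem mainTheorem7 :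
    ∃ K : ℕ, ∀ (v : NeonVariant) (L₁ L₂ G V Δ : ℝ),
      0 < L₁ → 0 < L₂ → 0 < G → 0 < V → 0 ≤ Δ →
    ∃ C : ℝ, 0 < C ∧ ∀ (d : ℕ) (ε γ δ : ℝ),
      1 ≤ d → 0 < ε → ε < 1 → 0 < γ → γ < 1 → 0 < δ → δ < 1 →
    ∃ (p : MSGDParams) (Tn : ℕ), p.Admissible L₁ ∧
      (p.m₁ : ℝ) ≤ C * polylog K d ε γ δ * (1 / ε ^ 2) ∧
      (Tn : ℝ) ≤ C * polylog K d ε γ δ * neonRate v γ ∧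
      ∀ (Ξ : Type u) [MeasurableSpace Ξ] (μ : Measure Ξ) [IsProbabilityMeasure μ]
        (f : Vec d → Ξ → ℝ) (x₁ : Vec d), StandingAssumptions μ f x₁ L₁ L₂ G V Δ →
        -- the IFO complexity of the MSGD step
        (∀ (S₁ : Fin p.m₁ → Ξ) (x : Vec d),
          ((msgd L₁ S₁ x).cost f : ℝ) ≤ C * polylog K d ε γ δ * (1 / ε ^ 2)) ∧
        -- the expected decrease of the MSGD step
        (∀ (x : Vec d) (e : ℝ), ε / 2 ≤ e → e ≤ ‖gradient (objective μ f) x‖ →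
          Integrable (fun S₁ : Fin p.m₁ → Ξ =>
            objective μ f ((msgd L₁ S₁ x).result f).2 - objective μ f x)
            (Measure.pi fun _ => μ) ∧
          ∫ S₁ : Fin p.m₁ → Ξ,
            (objective μ f ((msgd L₁ S₁ x).result f).2 - objective μ f x)
            ∂(Measure.pi fun _ => μ) ≤ -(e ^ 2 / (4 * L₁))) ∧
        (∀ x : Vec d, ∫ S₁ : Fin p.m₁ → Ξ,
            (objective μ f ((msgd L₁ S₁ x).result f).1 - objective μ f x)
            ∂(Measure.pi fun _ => μ) ≤ 0) ∧
        -- the IFO complexity of the negative-curvature step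
        (∀ (S₂ : Fin p.m₂ → Ξ) (e : Vec d) (sgn : Bool) (y : Vec d),
          (ncStep v p L₂ (γ / 2) S₂ e sgn y).cost f ≤ Tn) ∧
        -- the guarantee for the whole algorithm, with probability at least `1 - δ`
        runLaw μ d p {ω | ¬ ∃ (n : ℕ) (y : Vec d),
            (neonMSGD v p L₁ L₂ (ε / 2) (γ / 2) x₁ ω n).result f = Sum.inr y ∧
            IsSecondOrderStationary (objective μ f) ε γ y ∧
            ((neonMSGD v p L₁ L₂ (ε / 2) (γ / 2) x₁ ω n).cost f : ℝ) ≤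
              C * polylog K d ε γ δ * (1 + min (1 / δ) (ε ^ 2 / γ)) *
                max (1 / ε ^ 2) (1 / γ ^ 3) * (Tn + 1 / ε ^ 2)}
          ≤ ENNReal.ofReal δ := by
  -- Nine logarithms come from the number of iterations and one from the gradient batches.
  refine ⟨10, fun v L₁ L₂ G V Δ hL₁ hL₂ hG _ hΔ => ?_⟩
  -- A single constant that dominates the problem constants used in the estimates; the summand 10⁹
  -- lets numerical factors be absorbed as well.
  obtain ⟨B, hBdef⟩ : ∃ B, B = 10 ^ 9 + L₁ + L₂ + L₂⁻¹ + G + Δ := ⟨_, rfl⟩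
  have hL₂i : 0 < L₂⁻¹ := inv_pos.2 hL₂
  have hB : 10 ^ 9 ≤ B := by linarith
  have hB0 : 0 < B := by linarith
  have hL₁B : L₁ ≤ B := by linarith
  have hL₂B : L₂ ≤ B := by linarith
  have hL₂B' : 1 ≤ B * L₂ := by
    rw [← div_le_iff₀ hL₂, one_div]
    linarith
  have hGB : G ≤ B := by linarith
  have hΔB : Δ ≤ B := by linarith
  have hlogB : 0 ≤ Real.log B := Real.log_nonneg (by linarith)
  obtain ⟨C, hC⟩ : ∃ C, C = 10 ^ 45 * B ^ 6 * (1 + Real.log B) ^ 10 := ⟨_, rfl⟩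
  have hC0 : 0 < C := by rw [hC]; positivity
  refine ⟨C, hC0, fun d ε γ δ hd hε hε1 hγ hγ1 hδ hδ1 => ?_⟩
  have hd' : (1 : ℝ) ≤ d := by exact_mod_cast hd
  have hεγδ0 : 0 < ε * γ * δ := by positivity
  have hεγδ : ε * γ * δ ≤ 1 := mul_le_one₀ (mul_le_one₀ hε1.le hγ.le hγ1.le) hδ.le hδ1.le
  obtain ⟨X, hX⟩ : ∃ X, X = d / (ε * γ * δ) := ⟨_, rfl⟩
  have hXd : d ≤ X := by
    rw [hX, le_div_iff₀ hεγδ0]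
    exact mul_le_of_le_one_right (by positivity) hεγδ
  have hX1 : 1 ≤ X := hd'.trans hXd
  obtain ⟨Y, hYdef⟩ : ∃ Y, Y = B * X := ⟨_, rfl⟩
  have hY0 : 0 < Y := by rw [hYdef]; positivity
  have hY : B ≤ Y * (ε * γ * δ) := by
    rw [hYdef, mul_assoc, hX, div_mul_cancel₀ _ hεγδ0.ne']
    exact le_mul_of_one_le_right hB0.le hd'
  have hYγ : B ≤ γ * Y := by
    refine hY.trans ?_
    calc Y * (ε * γ * δ) = γ * Y * (ε * δ) := by ring
      _ ≤ γ * Y := mul_le_of_le_one_right (by positivity) (mul_le_one₀ hε1.le hδ.le hδ1.le)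
  have hBY : B ≤ Y := hYdef ▸ le_mul_of_one_le_right hB0.le hX1
  have hdY : (d : ℝ) ≤ Y := by
    rw [hYdef]
    nlinarith
  obtain ⟨ℓ, hℓ⟩ : ∃ ℓ, ℓ = Real.log Y := ⟨_, rfl⟩
  have hℓ1 : 1 ≤ ℓ := by
    rw [hℓ, Real.le_log_iff_exp_le hY0]
    linarith [Real.exp_one_lt_three]
  obtain ⟨Λ, hΛ⟩ : ∃ Λ, Λ = polylog 10 d ε γ δ := ⟨_, rfl⟩
  have hℓΛ : ℓ ^ 10 ≤ (1 + Real.log B) ^ 10 * Λ := by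
    rw [hΛ, polylog, ← hX, ← mul_pow, hℓ, hYdef, Real.log_mul hB0.ne' (by positivity)]
    have : 0 ≤ Real.log X := Real.log_nonneg hX1
    gcongr
    nlinarith
  have hCℓ : 10 ^ 45 * B ^ 6 * ℓ ^ 10 ≤ C * Λ := by
    rw [hC, mul_assoc (10 ^ 45 * B ^ 6)]
    gcongr
  have hΛ0 : 0 < Λ := by
    by_contra hcon
    have h1 : C * Λ ≤ 0 := mul_nonpos_of_nonneg_of_nonpos hC0.le (not_lt.1 hcon)
    have h2 : 0 < 10 ^ 45 * B ^ 6 * ℓ ^ 10 := by positivity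
    linarith
  rw [← hΛ]
  obtain ⟨κ, hκ⟩ : ∃ κ, κ = γ / (3 * 10 ^ 8 * ℓ ^ 2) := ⟨_, rfl⟩
  have hκ0 : 0 < κ := by rw [hκ]; positivity
  obtain ⟨q, θ, R, hq, hζ0, hζ1, hr0, hqt⟩ :=
    exists_neonParams v hB hL₁ hL₁B hL₂B hγ hγ1.le hYγ (hℓ ▸ hℓ1)
  rw [← hℓ, ← hκ] at hq
  rw [← hℓ] at hqt
  obtain ⟨m, hm⟩ : ∃ m, m = ⌈10752 * B ^ 2 * ℓ / ε ^ 2⌉₊ := ⟨_, rfl⟩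
  have hm1 : 10752 * B ^ 2 * ℓ / ε ^ 2 ≤ m := hm ▸ Nat.le_ceil _
  have hBℓε : 1 ≤ B ^ 2 * ℓ / ε ^ 2 := by
    rw [one_le_div₀ (by positivity)]
    calc ε ^ 2 ≤ 1 := pow_le_one₀ hε.le hε1.le
      _ ≤ B ^ 2 * ℓ := one_le_mul_of_one_le_of_one_le (one_le_pow₀ (by linarith)) hℓ1
  have hm2 : m ≤ 10753 * B ^ 2 * ℓ * (1 / ε ^ 2) := by
    rw [hm]
    refine (natCeil_le_add (by positivity) hBℓε).trans (le_of_eq ?_)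
    ring
  have hm0 : 0 < m := hm ▸ Nat.ceil_pos.2 (by positivity)
  obtain ⟨P, hP⟩ : ∃ P, P = ⌈22 * ℓ⌉₊ := ⟨_, rfl⟩
  have hP1 : 22 * ℓ ≤ P := hP ▸ Nat.le_ceil _
  have hP2 : P ≤ 23 * ℓ := by
    rw [hP]
    refine (natCeil_le_add (by positivity) hℓ1).trans (le_of_eq ?_)
    ring
  have hP0 : (0 : ℝ) < P := by linarith
  obtain ⟨m₂, hm₂⟩ : ∃ m₂, m₂ = ⌈96 * P ^ 2 * B ^ 2 / κ ^ 2⌉₊ := ⟨_, rfl⟩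
  have hm₂1 : 96 * P ^ 2 * B ^ 2 / κ ^ 2 ≤ m₂ := hm₂ ▸ Nat.le_ceil _
  have hm₂0 : 0 < m₂ := hm₂ ▸ Nat.ceil_pos.2 (by positivity)
  have hκγ : κ ≤ γ := by
    rw [hκ]
    refine div_le_self hγ.le ?_
    nlinarith
  have hm₂2 : m₂ ≤ 5 * 10 ^ 21 * ℓ ^ 6 * B ^ 2 / γ ^ 2 := by
    have h1 : 1 ≤ P ^ 2 * B ^ 2 / κ ^ 2 := by
      rw [one_le_div₀ (by positivity)]
      calc κ ^ 2 ≤ 1 := pow_le_one₀ hκ0.le (by linarith)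
        _ ≤ P ^ 2 * B ^ 2 := one_le_mul_of_one_le_of_one_le (one_le_pow₀ (by linarith))
          (one_le_pow₀ (by linarith))
    rw [hm₂]
    refine (natCeil_le_add (by positivity) h1).trans ?_
    calc 96 * P ^ 2 * B ^ 2 / κ ^ 2 + P ^ 2 * B ^ 2 / κ ^ 2 = 97 * P ^ 2 * B ^ 2 / κ ^ 2 := by ring
      _ ≤ 97 * (23 * ℓ) ^ 2 * B ^ 2 / κ ^ 2 := by gcongr
      _ = 97 * 23 ^ 2 * 9 * 10 ^ 16 * (ℓ ^ 6 * B ^ 2 / γ ^ 2) := by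
          rw [hκ]; field_simp; norm_num
      _ ≤ 5 * 10 ^ 21 * (ℓ ^ 6 * B ^ 2 / γ ^ 2) :=
          mul_le_mul_of_nonneg_right (by norm_num) (by positivity)
      _ = _ := by ring
  obtain ⟨N, κm, s, hN0, hκm0, hκm1, hκm3, hs0, hsA, hNδ, hNle⟩ :=
    exists_iterations hB hL₁ hL₁B hL₂ hL₂B hL₂B' hΔB hε hε1 hγ hγ1 hδ hδ1 hY hℓ hℓ1 hκ
  -- This `c` makes the escaping step, which uses the tolerance γ/2, have length κ/(4L₂).
  let p : MSGDParams := ⟨m, m, m₂, κ / (2 * γ), q⟩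
  have hp : p.Admissible L₁ :=
    { m₁_pos := hm0
      mc_pos := hm0
      m₂_pos := hm₂0
      c_pos := by positivity
      c_le := by
        change κ / (2 * γ) ≤ 1
        rw [div_le_one (by positivity)]
        linarith
      η_pos := hq.η_pos
      η_le := hq.η_le
      Fthr_pos := hq.F_pos
      U_pos := by
        have h1 := hq.U_eq
        have h2 := hq.ρ_pos
        change 0 < q.U
        linarith
      r_pos := hr0
      ζ_pos := hζ0
      ζ_lt := hζ1 }
  have hBC : ∀ (c : ℝ) (i j : ℕ), 0 ≤ c → c ≤ 10 ^ 45 → i ≤ 6 → j ≤ 10 →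
      c * B ^ i * ℓ ^ j ≤ C * Λ := fun c i j hc0 hc hi hj => by
    refine le_trans ?_ hCℓ
    have h1 : B ^ i ≤ B ^ 6 := pow_le_pow_right₀ (by linarith) hi
    have h2 : ℓ ^ j ≤ ℓ ^ 10 := pow_le_pow_right₀ hℓ1 hj
    gcongr
  have hmC : (m : ℝ) ≤ C * Λ * (1 / ε ^ 2) := by
    refine hm2.trans (mul_le_mul_of_nonneg_right ?_ (by positivity))
    simpa using hBC 10753 2 1 (by norm_num) (by norm_num) (by norm_num) (by norm_num)
  have hrate : 0 < neonRate v γ := by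
    cases v <;> simp only [neonRate] <;> positivity
  refine ⟨p, (2 * q.t + 4) * m₂, hp, hmC, ?_, fun Ξ _ μ _ f x₁ h => ⟨fun S₁ x => ?_, fun x e he hx => ?_,
    fun x => ?_, fun S₂ e sgn y => ncStep_cost_le f v p L₂ (γ / 2) S₂ e sgn y, ?_⟩⟩
  · rw [Nat.cast_mul]
    calc ((2 * q.t + 4 : ℕ) : ℝ) * m₂
        ≤ 3 * 10 ^ 4 * B * ℓ * (γ ^ 2 * neonRate v γ) * (5 * 10 ^ 21 * ℓ ^ 6 * B ^ 2 / γ ^ 2) := by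
          gcongr
      _ = 15 * 10 ^ 25 * B ^ 3 * ℓ ^ 7 * neonRate v γ := by field_simp; norm_num
      _ ≤ _ := by
          refine mul_le_mul_of_nonneg_right ?_ hrate.le
          exact hBC (15 * 10 ^ 25) 3 7 (by norm_num) (by norm_num) (by norm_num) (by norm_num)
  · rw [msgd_cost]
    exact hmC
  · simp only [msgd_result]
    refine h.integral_msgd_le hL₁ hG hm0 (by linarith) ?_ hx
    rw [div_le_iff₀ (by positivity)] at hm1
    have h1 : (ε / 2) ^ 2 ≤ e ^ 2 := by gcongr
    have h2 : (m : ℝ) * (ε / 2) ^ 2 ≤ m * e ^ 2 := by gcongr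
    have h3 : G ^ 2 ≤ B ^ 2 := by gcongr
    have h4 : B ^ 2 ≤ B ^ 2 * ℓ := le_mul_of_one_le_right (by positivity) hℓ1
    change 64 * G ^ 2 ≤ (m : ℝ) * e ^ 2
    linarith [sq_nonneg B]
  · simp
  · have hc : p.c * (γ / 2) = κ / 4 := by
      change κ / (2 * γ) * (γ / 2) = κ / 4
      field_simp
      norm_num
    have hfail : ∀ x, _ := fun x => (h.seedLaw_not_isGoodStep_le (p := p) hL₁ hL₂ hG hd hp hκ0
      (a := Y⁻¹ ^ 22) (by positivity) hq hc hε hGB (by linarith) P x).trans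
      (failure_sum_le hB hL₁ hL₁B hε hκ0 hdY (hB.trans hBY) (hℓ ▸ hm1) (hℓ ▸ hP1) hm₂1 hm₂0)
    have hrun := h.runLaw_not_terminated_le hL₁ (v := v) (by positivity) hfail hN0 hκm0 hκm1 hκm3
      hs0 hsA
    refine (measure_mono fun ω hω => ?_).trans (hrun.trans (ENNReal.ofReal_le_ofReal hNδ))
    rintro ⟨y, hy1, hy2⟩
    -- The cost of N iterations is bounded for every seed sequence, so only the failure to return a
    -- good point by time N has positive probability to be paid for.
    refine hω ⟨N, y, hy2, hy1, ?_⟩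
    have hcost := neonMSGD_cost_le f v p L₁ L₂ (ε / 2) (γ / 2) x₁ ω N
    have hcost' : ((neonMSGD v p L₁ L₂ (ε / 2) (γ / 2) x₁ ω N).cost f : ℝ)
        ≤ N * (m + m + ((2 * q.t + 4) * m₂ : ℕ)) := by exact_mod_cast hcost
    refine hcost'.trans ?_
    obtain ⟨Tn, hTn⟩ : ∃ Tn : ℝ, Tn = ((2 * q.t + 4) * m₂ : ℕ) := ⟨_, rfl⟩
    have hTn0 : 0 ≤ Tn := by rw [hTn]; positivity
    rw [← hTn]
    have h1 : (m : ℝ) + m + Tn ≤ 21506 * B ^ 2 * ℓ * (Tn + 1 / ε ^ 2) := by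
      have h2 : 1 ≤ 21506 * B ^ 2 * ℓ := by
        have : 1 ≤ B ^ 2 * ℓ := one_le_mul_of_one_le_of_one_le (one_le_pow₀ (by linarith)) hℓ1
        linarith
      have h3 := le_mul_of_one_le_left hTn0 h2
      linarith
    have hr : 0 ≤ 1 + min (1 / δ) (ε ^ 2 / γ) := by
      have : 0 ≤ min (1 / δ) (ε ^ 2 / γ) := le_min (by positivity) (by positivity)
      linarith
    have hM : 0 ≤ max (1 / ε ^ 2) (1 / γ ^ 3) := le_max_of_le_left (by positivity)
    calc (N : ℝ) * (m + m + Tn)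
        ≤ 2 * 10 ^ 37 * B ^ 4 * ℓ ^ 9 * (1 + min (1 / δ) (ε ^ 2 / γ)) *
          max (1 / ε ^ 2) (1 / γ ^ 3) * (21506 * B ^ 2 * ℓ * (Tn + 1 / ε ^ 2)) := by gcongr
      _ = 43012 * 10 ^ 37 * B ^ 6 * ℓ ^ 10 * (1 + min (1 / δ) (ε ^ 2 / γ)) *
          max (1 / ε ^ 2) (1 / γ ^ 3) * (Tn + 1 / ε ^ 2) := by ring
      _ ≤ _ := by
          refine mul_le_mul_of_nonneg_right (mul_le_mul_of_nonneg_right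
            (mul_le_mul_of_nonneg_right ?_ hr) hM) (by positivity)
          exact hBC (43012 * 10 ^ 37) 6 10 (by norm_num) (by norm_num) le_rfl le_rfl
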